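/- For each $n\ge 1$ let $p=p_n\in(0,1)$ and let $S_n=(s_{ij})_{1\le i,j\le n}$ be a real symmetric matrix with $0\le s_{ij}\le C$ and $p\,s_{ij}\le 1$ for all $i,j$, where $C$ does not depend on $n$. Let $A_n=(a_{ij})$ be the adjacency matrix of the inhomogeneous random graph on $\{1,\dots,n\}$ with edge probabilities $p\,s_{ij}$: $A_n$ is symmetric, $a_{ii}=0$, the entries $a_{ij}$ with $i<j$ are independent, and $a_{ij}\sim\mathrm{Ber}(p\,s_{ij})$ for $i\ne j$. Put $\overline{A}_n=A_n-\mathbb{E}A_n$ and, for $k\ge 2$, \[ X_{n,k}=\sqrt{p}\left(\operatorname{tr}\Big(\frac{\overline{A}_n}{\sqrt{np}}\Big)^k-\mathbb{E}\operatorname{tr}\Big(\frac{\overline{A}_n}{\sqrt{np}}\Big)^k\right). \] Let $W_n:[0,1]^2\to\mathbb{R}$ be the step-function graphon of $S_n$, equal to $s_{ij}$ on $\left[\frac{i-1}{n},\frac{i}{n}\right)\times\left[\frac{j-1}{n},\frac{j}{n}\right)$ and $0$ elsewhere, and for a finite simple graph $F=(V,E)$ let $t(F,W)=\int_{[0,1]^V}\prod_{ij\in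 E}W(x_i,x_j)\prod_{i\in V}dx_i$ be its homomorphism density in $W$. For even integers $k,h\ge 2$ let $\mathcal{T}_1^{k,h}$ be the (finite) set of all planar trees obtained by joining two rooted planar trees, with $k/2$ and $h/2$ edges respectively, along one overlapping edge. An element of $\mathcal{T}_1^{k,h}$ is determined by the two rooted planar trees, the choice of one edge in each of them, and one of the two directions in which these edges are identified; different choices count as different elements. It has $(k+h)/2$ vertices and $(k+h)/2-1$ edges, and $\left|\mathcal{T}_1^{k,h}\right|=\frac{kh}{2}\,C_{k/2}\,C_{h/2}$, where $C_m=\frac{1}{m+1}\binom{2m}{m}$. Theorem. Suppose that $p\to 0$ and $np\to\infty$ as $n\to\infty$, and that for every finite tree $T$ there is a constant $\beta_T$ with $t(T,W_n)\to\beta_T$ as $n\to\infty$. Then $\{X_{n,k}\}_{k\ge 2}$ converges, in the sense of finite-dimensional distributions, to a centered Gaussian process $\{X_k\}_{k\ge 2}$ with \[ \operatorname{Cov}(X_k,X_h)=\begin{cases}\displaystyle\sum_{T\in\mathcal{T}_1^{k,h}}\beta_T & \text{if } k,h \text{ are both even},\\[6pt] 0 & \text{otherwise,}\end{cases} \] where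 $\beta_T$ for $T\in\mathcal{T}_1^{k,h}$ means the constant of the underlying tree of $T$. In particular, a Gaussian process with this covariance exists. -/

import Mathlib

open MeasureTheory ProbabilityTheory Filter
open scoped Topology unitInterval

noncomputable section

/-! ## Graphons and homomorphism densities -/

/-- A graphon: a symmetric integrable function `[0,1]² → ℝ`. -/
structure Graphon where
  toFun : I → I → ℝ
  symm' : ∀ x y, toFun x y = toFun y x
  integrable' : Integrable (fun z : I × I => toFun z.1 z.2)

/-- Homomorphism density `t(F, W) = ∫_{[0,1]^V} ∏_{ij ∈ E(F)} W(x_i, x_j) ∏_i dx_i`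
of a finite simple graph `F` in a graphon `W`. -/
def homDensity {V : Type} [Fintype V] (F : SimpleGraph V) (W : Graphon) : ℝ :=
  open Classical in
  ∫ x : V → I, ∏ e ∈ F.edgeFinset,
    Sym2.lift ⟨fun i j => W.toFun (x i) (x j), fun i j => W.symm' (x i) (x j)⟩ e

/-- The `i`-th of `n` consecutive intervals of length `1 / n` in `[0,1]`. -/
def cell {n : ℕ} (i : Fin n) : Set I :=
  {x | (i : ℝ) / n ≤ (x : ℝ) ∧ (x : ℝ) < ((i : ℝ) + 1) / n}

theorem measurableSet_cell {n : ℕ} (i : Fin n) : MeasurableSet (cell i) :=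
  (measurableSet_le measurable_const measurable_subtype_coe).inter
    (measurableSet_lt measurable_subtype_coe measurable_const)

/-- The step-function graphon of a symmetric matrix: it equals `S i j` on `cell i × cell j`. -/
def stepGraphon {n : ℕ} (S : Matrix (Fin n) (Fin n) ℝ) (hS : S.IsSymm) : Graphon where
  toFun x y := ∑ i, ∑ j, (cell i ×ˢ cell j).indicator (fun _ => S i j) (x, y)
  symm' x y := by
    rw [Finset.sum_comm]
    refine Finset.sum_congr rfl fun i _ => Finset.sum_congr rfl fun j _ => ?_
    have h : S j i = S i j := hS.apply i j
    by_cases hx : x ∈ cell j <;> by_cases hy : y ∈ cell i <;> simp [Set.indicator, h, hx, hy]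
  integrable' := by
    refine integrable_finsetSum _ fun i _ => integrable_finsetSum _ fun j _ => ?_
    exact (integrable_const (S i j)).indicator
      ((measurableSet_cell i).prod (measurableSet_cell j))

/-! ## Rooted planar trees -/

/-- Finite rooted planar (plane, ordered) trees. Such a tree is either a single vertex `point`, or
it arises, in a unique way, as `graft s r`: the root of the rooted planar tree `r` receives one
further child, to the left of all its other children, and `s` is the subtree carried by it. -/
inductive PlanarTree : Type
  | point : PlanarTree
  | graft (s r : PlanarTree) : PlanarTree

namespace PlanarTree

/-- The vertices of a rooted planar tree. -/
def Vertex : PlanarTree → Type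
  | point => Unit
  | graft s r => s.Vertex ⊕ r.Vertex

/-- The root. -/
def root : (T : PlanarTree) → T.Vertex
  | point => ()
  | graft _ r => Sum.inr r.root

/-- The edges: `none` is the edge from the root of `graft s r` to its leftmost child. -/
def Edge : PlanarTree → Type
  | point => Empty
  | graft s r => Option (s.Edge ⊕ r.Edge)

/-- The endpoint of an edge closer to the root. -/
def parent : (T : PlanarTree) → T.Edge → T.Vertex
  | point, e => Empty.elim e
  | graft _ r, none => Sum.inr r.root
  | graft s _, some (Sum.inl e) => Sum.inl (s.parent e)
  | graft _ r, some (Sum.inr e) => Sum.inr (r.parent e)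

/-- The endpoint of an edge farther from the root. -/
def child : (T : PlanarTree) → T.Edge → T.Vertex
  | point, e => Empty.elim e
  | graft s _, none => Sum.inl s.root
  | graft s _, some (Sum.inl e) => Sum.inl (s.child e)
  | graft _ r, some (Sum.inr e) => Sum.inr (r.child e)

/-- The number of edges. -/
def numEdges : PlanarTree → ℕ
  | point => 0
  | graft s r => s.numEdges + r.numEdges + 1

/-- The underlying simple graph. -/
def graph (T : PlanarTree) : SimpleGraph T.Vertex :=
  SimpleGraph.fromRel fun u v => ∃ e, u = T.parent e ∧ v = T.child e

instance fintypeVertex : (T : PlanarTree) → Fintype T.Vertex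
  | point => inferInstanceAs (Fintype Unit)
  | graft s r =>
    letI := fintypeVertex s
    letI := fintypeVertex r
    inferInstanceAs (Fintype (s.Vertex ⊕ r.Vertex))

instance fintypeEdge : (T : PlanarTree) → Fintype T.Edge
  | point => inferInstanceAs (Fintype Empty)
  | graft s r =>
    letI := fintypeEdge s
    letI := fintypeEdge r
    inferInstanceAs (Fintype (Option (s.Edge ⊕ r.Edge)))

/-- Rooted planar trees with `m` edges. -/
abbrev OfSize (m : ℕ) : Type := {T : PlanarTree // T.numEdges = m}

theorem finite_le (m : ℕ) : {T : PlanarTree | T.numEdges ≤ m}.Finite := by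
  induction m with
  | zero =>
    refine (Set.finite_singleton point).subset fun T hT => ?_
    cases T with
    | point => rfl
    | graft s r => simp [numEdges] at hT
  | succ m ih =>
    refine ((Set.finite_singleton point).union (Set.Finite.image2 graft ih ih)).subset
      fun T hT => ?_
    cases T with
    | point => exact Or.inl rfl
    | graft s r =>
      simp only [Set.mem_ofPred_eq, numEdges] at hT
      refine Or.inr ⟨s, ?_, r, ?_, rfl⟩ <;> simp only [Set.mem_ofPred_eq] <;> omega

instance finiteOfSize (m : ℕ) : Finite (OfSize m) :=
  ((finite_le m).subset fun T (hT : T.numEdges = m) => le_of_eq hT).to_subtype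

instance fintypeOfSize (m : ℕ) : Fintype (OfSize m) := Fintype.ofFinite _

end PlanarTree

/-! ## Two rooted planar trees joined along one edge -/

/-- An element of `𝒯₁^{k,h}`: two rooted planar trees with `k / 2` and `h / 2` edges, one edge of
each, and the direction in which these two edges are made to overlap (`flip = false`: child on
child and parent on parent; `flip = true`: child on parent and parent on child). -/
def JoinedTree (k h : ℕ) : Type :=
  Σ (T₁ : PlanarTree.OfSize (k / 2)) (T₂ : PlanarTree.OfSize (h / 2)),
    T₁.1.Edge × T₂.1.Edge × Bool

instance fintypeJoinedTree (k h : ℕ) : Fintype (JoinedTree k h) :=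
  inferInstanceAs (Fintype (Σ (T₁ : PlanarTree.OfSize (k / 2)) (T₂ : PlanarTree.OfSize (h / 2)),
    T₁.1.Edge × T₂.1.Edge × Bool))

namespace JoinedTree

variable {k h : ℕ} (T : JoinedTree k h)

/-- The first tree. -/
def left : PlanarTree := T.1.1

/-- The second tree. -/
def right : PlanarTree := T.2.1.1

/-- The chosen edge of the first tree. -/
def leftEdge : T.left.Edge := T.2.2.1

/-- The chosen edge of the second tree. -/
def rightEdge : T.right.Edge := T.2.2.2.1

/-- The direction of the overlap. -/
def flip : Bool := T.2.2.2.2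

/-- The vertices of the joined tree: those of the first tree, and those of the second tree that do
not lie on the overlapping edge. -/
def Vertex : Type :=
  T.left.Vertex ⊕
    {v : T.right.Vertex // v ≠ T.right.child T.rightEdge ∧ v ≠ T.right.parent T.rightEdge}

instance fintypeVertex : Fintype T.Vertex := by
  classical
  exact inferInstanceAs (Fintype (T.left.Vertex ⊕
    {v : T.right.Vertex // v ≠ T.right.child T.rightEdge ∧ v ≠ T.right.parent T.rightEdge}))

/-- The first tree inside the joined tree. -/
def ofLeft (v : T.left.Vertex) : T.Vertex := Sum.inl v

/-- The second tree inside the joined tree: the endpoints of its chosen edge are identified with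
those of the chosen edge of the first tree. -/
def ofRight (v : T.right.Vertex) : T.Vertex :=
  open Classical in
  if hc : v = T.right.child T.rightEdge then
    Sum.inl (if T.flip then T.left.parent T.leftEdge else T.left.child T.leftEdge)
  else if hp : v = T.right.parent T.rightEdge then
    Sum.inl (if T.flip then T.left.child T.leftEdge else T.left.parent T.leftEdge)
  else Sum.inr ⟨v, hc, hp⟩

/-- The underlying simple graph of the joined tree: the union of the images of the two trees. -/
def graph : SimpleGraph T.Vertex :=
  T.left.graph.map T.ofLeft ⊔ T.right.graph.map T.ofRight

end JoinedTree

/-! ## Inhomogeneous random graphs and their linear spectral statistics -/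

/-- `A` is the random adjacency matrix of an inhomogeneous random graph on `n` vertices with
sparsity parameter `p` and variance profile `S`: it is symmetric with zero diagonal, the entries
above the diagonal are independent, and `A i j` has law `Ber(p * S i j)` for `i ≠ j`. -/
structure IsInhomRandomGraph {Ω : Type*} [MeasurableSpace Ω] (P : Measure Ω) {n : ℕ} (p : ℝ)
    (S : Matrix (Fin n) (Fin n) ℝ) (A : Ω → Matrix (Fin n) (Fin n) ℝ) : Prop where
  measurable : ∀ i j, Measurable fun ω => A ω i j
  symm : ∀ ω, (A ω).IsSymm
  diag : ∀ ω i, A ω i i = 0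
  indep : iIndepFun (fun (e : {e : Fin n × Fin n // e.1 < e.2}) ω => A ω e.1.1 e.1.2) P
  bernoulli : ∀ i j, i ≠ j → ∃ q : I, (q : ℝ) = p * S i j ∧
    HasLaw (fun ω => A ω i j) (bernoulliMeasure (1 : ℝ) 0 q) P

/-- The centered matrix `A - 𝔼 A`. -/
def centered {Ω : Type*} [MeasurableSpace Ω] (P : Measure Ω) {n : ℕ}
    (A : Ω → Matrix (Fin n) (Fin n) ℝ) (ω : Ω) : Matrix (Fin n) (Fin n) ℝ :=
  A ω - Matrix.of fun i j => ∫ ω', A ω' i j ∂P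

/-- `tr ((A - 𝔼 A) / √(n p)) ^ k`. -/
def centeredTrace {Ω : Type*} [MeasurableSpace Ω] (P : Measure Ω) {n : ℕ} (p : ℝ)
    (A : Ω → Matrix (Fin n) (Fin n) ℝ) (k : ℕ) (ω : Ω) : ℝ :=
  Matrix.trace (((√(n * p))⁻¹ • centered P A ω) ^ k)

/-- The rescaled linear spectral statistic
`X_{n,k} = √p (tr (Ā / √(n p)) ^ k - 𝔼 tr (Ā / √(n p)) ^ k)`, where `Ā = A - 𝔼 A`. -/
def spectralStat {Ω : Type*} [MeasurableSpace Ω] (P : Measure Ω) {n : ℕ} (p : ℝ)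
    (A : Ω → Matrix (Fin n) (Fin n) ℝ) (k : ℕ) (ω : Ω) : ℝ :=
  √p * (centeredTrace P p A k ω - ∫ ω', centeredTrace P p A k ω' ∂P)

end

noncomputable section

set_option linter.unusedSectionVars false

/-! ## Closed walks in connected graphs -/

namespace SimpleGraph

variable {V : Type*} {G : SimpleGraph V}

/-! Expand `tr Ā^k` over closed walks of length `k` in the complete graph: each walk contributes a
monomial in the independent, centered, bounded entries `a_e`, whose nonzero powers all have moments
of size `O(p)`. The walks that drive the fluctuations are the double ones, which use every edge
exactly twice and visit `k / 2 + 1` vertices. They are the contours of injectively labelled rooted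
planar trees (`PlanarTree.toDouble_bijective`).

For a double walk, replace the centered monomial by its first-order Hoeffding projection, a sum of
functions of single entries; replace all other centered monomials by zero. The squared error is a
sum over pairs of walks. A pair contributes nothing unless the walks share an edge and every edge of
their union is used at least twice in total. With `E` edges and `v` vertices in the union, the
normalised contribution of all such pairs is of order `p (np)^{-k} p^E n^v`, so `v ≤ E` gives
`O(p)`. If `v = E + 1`, the union is a tree, every edge is a cut, and each closed walk crosses it an
even number of times. Shared edges are then used at least four times, so `E ≤ k - 1`. Equality
forces a single shared edge and two double walks, and then the covariance of the monomials is
exactly that of their projections, so the terms cancel (`IsSmallIndep.linCov_eq_cov`). All remaining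
tree-like pairs have `E ≤ k - 2` and give `O(1 / (np))`. Hence the error vanishes when `p → 0` and
`np → ∞` (`IsSmallIndep.integral_sq_trace_sub_le`).

What remains is a linear form in the independent variables `a_e ^ 2 - 𝔼 a_e ^ 2`, with coefficients
`O(√p)`. Its characteristic function is therefore close to that of a Gaussian with the same variance
(`norm_integral_exp_sum_sub_exp_le`). The product of two coefficients at an entry `e` counts pairs
of labelled trees with one marked edge each, both marked edges lying over `e`. Gluing them, in one
of two directions, gives labelled elements of `𝒯₁^{k,h}` (`sum_linCoef_mul_linCoef`). Since `𝔼 a_e ^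
2` and `Var (a_e ^ 2)` are both `p s_e (1 + O(p))`, and noninjective labellings cost a factor `1 /
n`, the covariances converge to sums of tree densities (`IsInhomRandomGraph.abs_statCov_sub_le`).

The limit kernel is positive semidefinite as a limit of Gram kernels, so it is realised by a
Gaussian process, and Lévy's continuity theorem concludes. -/

theorem Subgraph.card_edgeSet_coe (H : G.Subgraph) :
    Nat.card H.coe.edgeSet = H.edgeSet.ncard := by
  rw [Nat.card_coe_set_eq, ← H.image_coe_edgeSet_coe]
  exact (Set.ncard_image_of_injective _ (Sym2.map.injective Subtype.val_injective)).symm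

theorem Subgraph.Connected.ncard_verts_le [Finite V] {H : G.Subgraph} (hH : H.Connected) :
    H.verts.ncard ≤ H.edgeSet.ncard + 1 := by
  have := hH.coe.card_vert_le_card_edgeSet_add_one
  rwa [H.card_edgeSet_coe, Nat.card_coe_set_eq] at this

/-- Every edge of a connected subgraph with one vertex more than edges separates its endpoints. -/
theorem Subgraph.Connected.exists_cut [Finite V] {H : G.Subgraph} (hH : H.Connected)
    (hcard : H.verts.ncard = H.edgeSet.ncard + 1) {a b : V} (hab : H.Adj a b) :
    ∃ S : V → Prop, S a ∧ ¬ S b ∧ ∀ x y, H.Adj x y → s(x, y) ≠ s(a, b) → (S x ↔ S y) := by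
  have hT : H.coe.IsTree := by
    rw [isTree_iff_connected_and_card, H.card_edgeSet_coe, Nat.card_coe_set_eq]
    exact ⟨hH.coe, hcard.symm⟩
  have hadj : H.coe.Adj ⟨a, hab.fst_mem⟩ ⟨b, hab.snd_mem⟩ := hab
  have hb := isBridge_iff.1 (isAcyclic_iff_forall_adj_isBridge.1 hT.isAcyclic hadj)
  set D := H.coe.deleteEdges {s(⟨a, hab.fst_mem⟩, ⟨b, hab.snd_mem⟩)} with hD
  -- The cut is the component of `a` once the bridge `ab` has been deleted.
  refine ⟨fun x => ∃ hx : x ∈ H.verts, D.Reachable ⟨a, hab.fst_mem⟩ ⟨x, hx⟩,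
    ⟨hab.fst_mem, Reachable.refl _⟩, fun ⟨_, h⟩ => hb h, fun x y hxy hne => ?_⟩
  have hDxy : D.Adj ⟨x, hxy.fst_mem⟩ ⟨y, hxy.snd_mem⟩ := by
    rw [hD, SimpleGraph.deleteEdges_adj]
    refine ⟨hxy, fun h => hne ?_⟩
    have := congrArg (Sym2.map Subtype.val) (Set.mem_singleton_iff.1 h)
    simpa using this
  exact ⟨fun ⟨_, h⟩ => ⟨hxy.snd_mem, h.trans hDxy.reachable⟩,
    fun ⟨_, h⟩ => ⟨hxy.fst_mem, h.trans hDxy.symm.reachable⟩⟩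

/-! ### Parity of crossings of a cut -/

namespace Walk

/-- A walk crosses the only edge of a cut an even number of times iff its endpoints lie on the same
side. -/
theorem even_count_edges_iff [DecidableEq V] {S : V → Prop} {a b : V} (ha : S a) (hb : ¬ S b) :
    ∀ {u v : V} (p : G.Walk u v),
      (∀ x y, s(x, y) ∈ p.edges → s(x, y) ≠ s(a, b) → (S x ↔ S y)) →
      (Even (p.edges.count s(a, b)) ↔ (S u ↔ S v))
  | _, _, .nil, _ => by simp
  | u, v, .cons (v := w) h p, hS => by
    have ih := even_count_edges_iff ha hb p fun x y hxy => hS x y (by simp [hxy])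
    rw [edges_cons, List.count_cons]
    by_cases he : s(u, w) = s(a, b)
    · have : ¬ (S u ↔ S w) := by
        rcases Sym2.eq_iff.1 he with ⟨rfl, rfl⟩ | ⟨rfl, rfl⟩ <;> tauto
      simp only [he, beq_self_eq_true, if_true, Nat.even_add_one, ih]
      tauto
    · have := hS u w (by simp) he
      simp only [beq_iff_eq, he, if_false, add_zero, ih]
      tauto

/-- A walk avoiding the only edge of a cut stays on one side. -/
theorem cut_iff_of_mem_support {S : V → Prop} {a b : V} :
    ∀ {u v : V} (p : G.Walk u v),
      (∀ x y, s(x, y) ∈ p.edges → s(x, y) ≠ s(a, b) → (S x ↔ S y)) →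
      s(a, b) ∉ p.edges → ∀ x ∈ p.support, (S x ↔ S u)
  | _, _, .nil, _, _, x, hx => by simp_all
  | u, v, .cons (v := w) h p, hS, hp, x, hx => by
    rw [edges_cons, List.mem_cons, not_or] at hp
    have huw := hS u w (by simp) (Ne.symm hp.1)
    rw [support_cons, List.mem_cons] at hx
    rcases hx with rfl | hx
    · rfl
    · rw [huw]
      exact cut_iff_of_mem_support p (fun x y hxy => hS x y (by simp [hxy])) hp.2 x hx

/-- Splitting a walk at the first passage through an edge. -/
theorem exists_eq_append_cons {e : Sym2 V} : ∀ {u v : V} (p : G.Walk u v), e ∈ p.edges →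
    ∃ (x y : V) (q : G.Walk u x) (h : G.Adj x y) (r : G.Walk y v),
      s(x, y) = e ∧ e ∉ q.edges ∧ p = q.append (.cons h r)
  | _, _, .nil, he => by simp at he
  | u, v, .cons (v := w) h p, he => by
    by_cases hw : s(u, w) = e
    · exact ⟨u, w, .nil, h, p, hw, by simp, rfl⟩
    · have he' : e ∈ p.edges := by
        rw [edges_cons, List.mem_cons] at he
        exact he.resolve_left (Ne.symm hw)
      obtain ⟨x, y, q, h', r, hxy, hq, rfl⟩ := exists_eq_append_cons p he'
      refine ⟨x, y, .cons h q, h', r, hxy, ?_, rfl⟩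
      rw [edges_cons, List.mem_cons, not_or]
      exact ⟨Ne.symm hw, hq⟩

variable [DecidableEq V]

theorem ncard_verts_toSubgraph {u v : V} (p : G.Walk u v) :
    p.toSubgraph.verts.ncard = p.support.toFinset.card := by
  rw [← Set.ncard_coe_finset]; congr 1; ext; simp

theorem ncard_edgeSet_toSubgraph {u v : V} (p : G.Walk u v) :
    p.toSubgraph.edgeSet.ncard = p.edges.toFinset.card := by
  rw [← Set.ncard_coe_finset]; congr 1; ext; simp

theorem card_support_le [Finite V] {u v : V} (p : G.Walk u v) :
    p.support.toFinset.card ≤ p.edges.toFinset.card + 1 := by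
  have := p.toSubgraph_connected.ncard_verts_le
  rwa [ncard_verts_toSubgraph, ncard_edgeSet_toSubgraph] at this

theorem two_mul_card_edges_le {u v : V} (p : G.Walk u v)
    (hp : ∀ e ∈ p.edges, 2 ≤ p.edges.count e) : 2 * p.edges.toFinset.card ≤ p.length := by
  rw [← length_edges, ← List.sum_toFinset_count_eq_length, mul_comm, ← smul_eq_mul]
  exact Finset.card_nsmul_le_sum _ _ _ fun e he => hp e (List.mem_toFinset.1 he)

/-- A closed walk traversing each of its edges at least twice and visiting as many vertices as its
length permits. -/
def IsDouble {u : V} (p : G.Walk u u) : Prop :=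
  (∀ e ∈ p.edges, 2 ≤ p.edges.count e) ∧ 2 * p.support.toFinset.card = p.length + 2

end Walk

end SimpleGraph

/-! ### Unions of two closed walks sharing an edge -/

namespace SimpleGraph.Walk

variable {V : Type*} {G : SimpleGraph V} [DecidableEq V]

/-- The total number of traversals of an edge by two walks. -/
def pairCount {u v : V} (p : G.Walk u u) (q : G.Walk v v) (e : Sym2 V) : ℕ :=
  p.edges.count e + q.edges.count e

/-- The vertices visited by two walks. -/
def pairVerts {u v : V} (p : G.Walk u u) (q : G.Walk v v) : Finset V :=
  p.support.toFinset ∪ q.support.toFinset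

/-- The edges traversed by two walks. -/
def pairEdges {u v : V} (p : G.Walk u u) (q : G.Walk v v) : Finset (Sym2 V) :=
  p.edges.toFinset ∪ q.edges.toFinset

/-- The edges traversed by both of two walks. -/
def sharedEdges {u v : V} (p : G.Walk u u) (q : G.Walk v v) : Finset (Sym2 V) :=
  p.edges.toFinset ∩ q.edges.toFinset

variable {u v : V} {p : G.Walk u u} {q : G.Walk v v}

theorem pair_subgraph_connected (h : (sharedEdges p q).Nonempty) :
    (p.toSubgraph ⊔ q.toSubgraph).Connected := by
  obtain ⟨e, he⟩ := h
  induction e with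
  | h a b =>
    simp only [sharedEdges, Finset.mem_inter, List.mem_toFinset] at he
    refine Subgraph.connected_sup p.toSubgraph_connected.preconnected
      q.toSubgraph_connected.preconnected ⟨a, ?_⟩
    simp [p.fst_mem_support_of_mem_edges he.1, q.fst_mem_support_of_mem_edges he.2]

theorem pair_ncard_verts : (p.toSubgraph ⊔ q.toSubgraph).verts.ncard = (pairVerts p q).card := by
  rw [← Set.ncard_coe_finset]; congr 1; ext; simp [pairVerts]

theorem pair_ncard_edgeSet :
    (p.toSubgraph ⊔ q.toSubgraph).edgeSet.ncard = (pairEdges p q).card := by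
  rw [← Set.ncard_coe_finset]; congr 1; ext; simp [pairEdges]

theorem card_pairVerts_le [Finite V] (h : (sharedEdges p q).Nonempty) :
    (pairVerts p q).card ≤ (pairEdges p q).card + 1 := by
  have := (pair_subgraph_connected h).ncard_verts_le
  rwa [pair_ncard_verts, pair_ncard_edgeSet] at this

/-- The union is connected with one vertex more than edges, hence a tree. Each of its edges is the
only edge of a cut, and a closed walk ends on the side where it started. -/
theorem even_count_of_pair [Finite V] (h : (sharedEdges p q).Nonempty)
    (hcard : (pairVerts p q).card = (pairEdges p q).card + 1) (e : Sym2 V) :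
    Even (p.edges.count e) ∧ Even (q.edges.count e) := by
  by_cases he : e ∈ pairEdges p q
  · induction e with
    | h a b =>
      have hab : (p.toSubgraph ⊔ q.toSubgraph).Adj a b := by
        simp only [pairEdges, Finset.mem_union, List.mem_toFinset, ← mem_edges_toSubgraph] at he
        exact he
      obtain ⟨S, ha, hb, hS⟩ := (pair_subgraph_connected h).exists_cut
        (by rw [pair_ncard_verts, pair_ncard_edgeSet, hcard]) hab
      exact ⟨(even_count_edges_iff ha hb p fun x y hxy => hS x y
          (Or.inl ((mem_edges_toSubgraph p).2 hxy))).2 Iff.rfl,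
        (even_count_edges_iff ha hb q fun x y hxy => hS x y
          (Or.inr ((mem_edges_toSubgraph q).2 hxy))).2 Iff.rfl⟩
  · simp only [pairEdges, Finset.mem_union, List.mem_toFinset, not_or] at he
    simp [List.count_eq_zero_of_not_mem he.1, List.count_eq_zero_of_not_mem he.2]

theorem sum_pairCount : ∑ e ∈ pairEdges p q, pairCount p q e = p.length + q.length := by
  have key : ∀ (w : V) (r : G.Walk w w), r.edges.toFinset ⊆ pairEdges p q →
      ∑ e ∈ pairEdges p q, r.edges.count e = r.length := fun w r hr => by
    rw [← length_edges, ← List.sum_toFinset_count_eq_length]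
    refine (Finset.sum_subset hr fun e _ he => ?_).symm
    exact List.count_eq_zero_of_not_mem fun h => he (List.mem_toFinset.2 h)
  simp only [pairCount, Finset.sum_add_distrib]
  rw [key u p Finset.subset_union_left, key v q Finset.subset_union_right]

theorem two_mul_card_pairEdges_le (h2 : ∀ e ∈ pairEdges p q, 2 ≤ pairCount p q e) :
    2 * (pairEdges p q).card ≤ p.length + q.length := by
  rw [← sum_pairCount, mul_comm, ← smul_eq_mul]
  exact Finset.card_nsmul_le_sum _ _ _ h2

/-- By parity each of the two walks uses a shared edge at least twice, so such an edge absorbs four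
steps instead of the two guaranteed for the others. -/
theorem two_mul_card_add_le_of_pair [Finite V] (h : (sharedEdges p q).Nonempty)
    (h2 : ∀ e ∈ pairEdges p q, 2 ≤ pairCount p q e)
    (hcard : (pairVerts p q).card = (pairEdges p q).card + 1) :
    2 * (pairEdges p q).card + 2 * (sharedEdges p q).card ≤ p.length + q.length := by
  have hsub : sharedEdges p q ⊆ pairEdges p q :=
    Finset.inter_subset_left.trans Finset.subset_union_left
  have hle : ∀ e ∈ pairEdges p q, 2 + (if e ∈ sharedEdges p q then 2 else 0) ≤ pairCount p q e := by
    intro e he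
    have hev := even_count_of_pair h hcard e
    split_ifs with hs
    · simp only [sharedEdges, Finset.mem_inter, List.mem_toFinset, ← List.count_pos_iff] at hs
      unfold pairCount
      obtain ⟨⟨i, hi⟩, j, hj⟩ := hev
      omega
    · exact h2 e he
  have := Finset.sum_le_sum hle
  rw [Finset.sum_add_distrib, sum_pairCount, Finset.sum_const, ← Finset.sum_filter,
    Finset.sum_const, smul_eq_mul, smul_eq_mul,
    Finset.filter_mem_eq_inter, Finset.inter_eq_right.2 hsub] at this
  omega

/-- Two closed walks whose union is a tree and which share exactly one edge are both double as soon
as they traverse as many edges as their lengths permit. -/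
theorem isDouble_of_pair [Finite V] (hs : (sharedEdges p q).card = 1)
    (hcard : (pairVerts p q).card = (pairEdges p q).card + 1)
    (hlen : 2 * (pairEdges p q).card + 2 = p.length + q.length) :
    p.IsDouble ∧ q.IsDouble := by
  have h : (sharedEdges p q).Nonempty := Finset.card_pos.1 (by omega)
  have hp : ∀ e ∈ p.edges, 2 ≤ p.edges.count e := fun e he => by
    obtain ⟨i, hi⟩ := (even_count_of_pair h hcard e).1
    have := List.count_pos_iff.2 he
    omega
  have hq : ∀ e ∈ q.edges, 2 ≤ q.edges.count e := fun e he => by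
    obtain ⟨i, hi⟩ := (even_count_of_pair h hcard e).2
    have := List.count_pos_iff.2 he
    omega
  have hE := Finset.card_union_add_card_inter p.edges.toFinset q.edges.toFinset
  have hV := Finset.card_union_add_card_inter p.support.toFinset q.support.toFinset
  -- Both endpoints of the shared edge are common vertices.
  have hV2 : 2 ≤ (p.support.toFinset ∩ q.support.toFinset).card := by
    obtain ⟨e, he⟩ := h
    induction e with
    | h a b =>
      simp only [sharedEdges, Finset.mem_inter, List.mem_toFinset] at he
      have hne : a ≠ b := (p.adj_of_mem_edges he.1).ne
      rw [← Finset.card_pair hne]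
      refine Finset.card_le_card fun x hx => ?_
      simp only [Finset.mem_insert, Finset.mem_singleton] at hx
      rcases hx with rfl | rfl
      · simp [p.fst_mem_support_of_mem_edges he.1, q.fst_mem_support_of_mem_edges he.2]
      · simp [p.snd_mem_support_of_mem_edges he.1, q.snd_mem_support_of_mem_edges he.2]
  have e1 := p.two_mul_card_edges_le hp
  have e2 := q.two_mul_card_edges_le hq
  have v1 := p.card_support_le
  have v2 := q.card_support_le
  unfold sharedEdges at hs
  unfold pairVerts pairEdges at hcard
  unfold pairEdges at hlen
  -- Inclusion-exclusion gives `v₁ + v₂ ≥ e₁ + e₂ + 2` and `2 (e₁ + e₂)` equal to the total length.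
  -- The bounds `vᵢ ≤ eᵢ + 1` and `2 eᵢ ≤ ℓᵢ` must then all be equalities.
  refine ⟨⟨hp, ?_⟩, hq, ?_⟩ <;> omega

end SimpleGraph.Walk

/-! ## Rooted planar trees and double closed walks -/

namespace PlanarTree

theorem card_vertex : (T : PlanarTree) → Fintype.card T.Vertex = T.numEdges + 1
  | point => rfl
  | graft s r => by
    have hs := card_vertex s
    have hr := card_vertex r
    have : Fintype.card (graft s r).Vertex = Fintype.card s.Vertex + Fintype.card r.Vertex :=
      Fintype.card_sum
    rw [this, hs, hr, numEdges]; omega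

theorem card_edge : (T : PlanarTree) → Fintype.card T.Edge = T.numEdges
  | point => rfl
  | graft s r => by
    have hs := card_edge s
    have hr := card_edge r
    have : Fintype.card (graft s r).Edge = Fintype.card s.Edge + Fintype.card r.Edge + 1 := by
      rw [← Fintype.card_sum]; exact Fintype.card_option
    rw [this, hs, hr, numEdges]

/-- The unordered pair of endpoints of an edge. -/
def ends (T : PlanarTree) (ε : T.Edge) : Sym2 T.Vertex := s(T.parent ε, T.child ε)

theorem sum_edge_graft {M : Type*} [AddCommMonoid M] (s r : PlanarTree)
    (f : (graft s r).Edge → M) :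
    ∑ ε, f ε = f none + (∑ ε : s.Edge, f (some (Sum.inl ε)) + ∑ ε : r.Edge, f (some (Sum.inr ε))) := by
  have h1 : ∑ ε, f ε = f none + ∑ ε : s.Edge ⊕ r.Edge, f (some ε) := Fintype.sum_option f
  rw [h1, Fintype.sum_sum_type]

/-- The inclusion of the vertices of the subtree carried by the leftmost child of the root. -/
def inL (s r : PlanarTree) : s.Vertex → (graft s r).Vertex := Sum.inl

/-- The inclusion of the vertices of the tree without the leftmost branch. -/
def inR (s r : PlanarTree) : r.Vertex → (graft s r).Vertex := Sum.inr

theorem inL_injective (s r : PlanarTree) : Function.Injective (inL s r) := Sum.inl_injective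

theorem inR_injective (s r : PlanarTree) : Function.Injective (inR s r) := Sum.inr_injective

theorem inL_ne_inR {s r : PlanarTree} {v : s.Vertex} {w : r.Vertex} : inL s r v ≠ inR s r w :=
  Sum.inl_ne_inr

theorem root_graft (s r : PlanarTree) : (graft s r).root = inR s r r.root := rfl

theorem vertex_cases {s r : PlanarTree} {C : (graft s r).Vertex → Prop}
    (hl : ∀ v, C (inL s r v)) (hr : ∀ v, C (inR s r v)) : ∀ v, C v
  | Sum.inl v => hl v
  | Sum.inr v => hr v

theorem ends_graft_none (s r : PlanarTree) :
    (graft s r).ends none = s(inR s r r.root, inL s r s.root) := rfl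

theorem ends_graft_inl (s r : PlanarTree) (ε : s.Edge) :
    (graft s r).ends (some (Sum.inl ε)) = (s.ends ε).map (inL s r) := rfl

theorem ends_graft_inr (s r : PlanarTree) (ε : r.Edge) :
    (graft s r).ends (some (Sum.inr ε)) = (r.ends ε).map (inR s r) := rfl

theorem parent_ne_child : (T : PlanarTree) → (ε : T.Edge) → T.parent ε ≠ T.child ε
  | point, ε => Empty.elim ε
  | graft _ _, none => Sum.inr_ne_inl
  | graft s _, some (Sum.inl ε) => fun h => parent_ne_child s ε (Sum.inl_injective h)
  | graft _ r, some (Sum.inr ε) => fun h => parent_ne_child r ε (Sum.inr_injective h)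

/-- There are no multiple edges, so a contour uses the image of an edge twice and not more often. -/
theorem ends_injective : (T : PlanarTree) → Function.Injective T.ends
  | point => fun ε => Empty.elim ε
  | graft s r => by
    have hlr : ∀ (z : Sym2 s.Vertex) (z' : Sym2 r.Vertex), z.map (inL s r) ≠ z'.map (inR s r) := by
      intro z z' h
      induction z with
      | h a b =>
        have : inL s r a ∈ z'.map (inR s r) := h ▸ Sym2.mem_mk_left _ _
        obtain ⟨c, -, hc⟩ := Sym2.mem_map.1 this
        exact inL_ne_inR hc.symm
    have h0l : ∀ z : Sym2 s.Vertex, s(inR s r r.root, inL s r s.root) ≠ z.map (inL s r) := by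
      intro z h
      obtain ⟨c, -, hc⟩ := Sym2.mem_map.1 (h ▸ Sym2.mem_mk_left _ _ : inR s r r.root ∈ z.map (inL s r))
      exact inL_ne_inR hc
    have h0r : ∀ z : Sym2 r.Vertex, s(inR s r r.root, inL s r s.root) ≠ z.map (inR s r) := by
      intro z h
      obtain ⟨c, -, hc⟩ := Sym2.mem_map.1 (h ▸ Sym2.mem_mk_right _ _ : inL s r s.root ∈ z.map (inR s r))
      exact inL_ne_inR hc.symm
    intro ε ε' h
    rcases ε with _ | ε | ε <;> rcases ε' with _ | ε' | ε'
    · rfl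
    · exact (h0l (s.ends ε') h).elim
    · exact (h0r (r.ends ε') h).elim
    · exact (h0l (s.ends ε) h.symm).elim
    · exact congrArg _ (congrArg _ (ends_injective s (Sym2.map.injective (inL_injective s r) h)))
    · exact (hlr (s.ends ε) (r.ends ε') h).elim
    · exact (h0r (r.ends ε) h.symm).elim
    · exact (hlr (s.ends ε') (r.ends ε) h.symm).elim
    · exact congrArg _ (congrArg _ (ends_injective r (Sym2.map.injective (inR_injective s r) h)))

variable {V : Type*}

/-- The sequence of labels met on the walk around a labelled planar tree. -/
def contourList : (T : PlanarTree) → (T.Vertex → V) → List V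
  | point, φ => [φ ()]
  | graft s r, φ =>
    φ (graft s r).root :: (contourList s (φ ∘ inL s r) ++ contourList r (φ ∘ inR s r))

theorem contourList_graft (s r : PlanarTree) (φ : (graft s r).Vertex → V) :
    contourList (graft s r) φ =
      φ (graft s r).root :: (contourList s (φ ∘ inL s r) ++ contourList r (φ ∘ inR s r)) := rfl

theorem contourList_head : (T : PlanarTree) → (φ : T.Vertex → V) →
    ∃ l, T.contourList φ = φ T.root :: l
  | point, _ => ⟨_, rfl⟩
  | graft _ _, _ => ⟨_, rfl⟩

theorem mem_contourList : (T : PlanarTree) → (φ : T.Vertex → V) → {x : V} →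
    (x ∈ T.contourList φ ↔ ∃ v, φ v = x)
  | point, φ, x => by
    rw [contourList, List.mem_singleton]
    exact ⟨fun h => ⟨(), h.symm⟩, fun ⟨_, h⟩ => h.symm⟩
  | graft s r, φ, x => by
    rw [contourList, List.mem_cons, List.mem_append, mem_contourList s, mem_contourList r]
    constructor
    · rintro (rfl | ⟨v, rfl⟩ | ⟨v, rfl⟩)
      exacts [⟨_, rfl⟩, ⟨_, rfl⟩, ⟨_, rfl⟩]
    · rintro ⟨v, rfl⟩
      exact vertex_cases (C := fun w => φ w = φ (graft s r).root ∨ (∃ v, (φ ∘ inL s r) v = φ w) ∨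
        ∃ v, (φ ∘ inR s r) v = φ w) (fun v => Or.inr (Or.inl ⟨v, rfl⟩))
        (fun v => Or.inr (Or.inr ⟨v, rfl⟩)) v

theorem append_cons_inj {x : V} {l₁ l₂ r₁ r₂ : List V} (h₁ : x ∉ l₁) (h₂ : x ∉ l₂)
    (h : l₁ ++ x :: r₁ = l₂ ++ x :: r₂) : l₁ = l₂ ∧ r₁ = r₂ := by
  induction l₁ generalizing l₂ with
  | nil =>
    cases l₂ with
    | nil => simpa using h
    | cons a l =>
      exact (h₂ (by simp [(List.cons.inj h).1])).elim
  | cons a l ih =>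
    cases l₂ with
    | nil => exact (h₁ (by simp [(List.cons.inj h).1])).elim
    | cons b m =>
      simp only [List.cons_append, List.cons.injEq] at h
      have := ih (fun hx => h₁ (by simp [hx])) (fun hx => h₂ (by simp [hx])) h.2
      simp [h.1, this]

/-- As the labels are distinct, the first return to the label of the root marks the end of the
leftmost branch. The list thus splits uniquely into the contours of the two subtrees, and recursion
recovers the tree together with its labelling. -/
theorem contourList_injective : (T T' : PlanarTree) → (φ : T.Vertex ↪ V) → (φ' : T'.Vertex ↪ V) →
    T.contourList φ = T'.contourList φ' →
    (⟨T, φ⟩ : Σ T : PlanarTree, T.Vertex ↪ V) = ⟨T', φ'⟩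
  | point, point, φ, φ', h => by
    have : φ = φ' := by
      ext v; exact (List.cons.inj h).1
    rw [this]
  | point, graft s r, φ, φ', h => by
    obtain ⟨l, hl⟩ := contourList_head s (φ' ∘ inL s r)
    simp [contourList, hl] at h
  | graft s r, point, φ, φ', h => by
    obtain ⟨l, hl⟩ := contourList_head s (φ ∘ inL s r)
    simp [contourList, hl] at h
  | graft s r, graft s' r', φ, φ', h => by
    have key : ∀ (s r : PlanarTree) (φ : (graft s r).Vertex ↪ V),
        φ (graft s r).root ∉ contourList s (φ ∘ inL s r) := by
      intro s r φ hx
      obtain ⟨v, hv⟩ := (mem_contourList _ _).1 hx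
      exact inL_ne_inR (φ.injective hv)
    have h0 := (List.cons.inj h).1
    have h1 := (List.cons.inj h).2
    obtain ⟨l, hl⟩ : ∃ l, r.contourList (φ ∘ inR s r) = φ (graft s r).root :: l := contourList_head r _
    obtain ⟨l', hl'⟩ : ∃ l, r'.contourList (φ' ∘ inR s' r') = φ (graft s r).root :: l := by
      rw [h0]; exact contourList_head r' _
    rw [hl, hl'] at h1
    have h2 := append_cons_inj (key s r φ) (by rw [h0]; exact key s' r' φ') h1
    have h3 : contourList r (φ ∘ inR s r) = contourList r' (φ' ∘ inR s' r') := by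
      rw [hl, hl', h2.2]
    have hs := contourList_injective s s' ((⟨inL s r, inL_injective s r⟩ : s.Vertex ↪ _).trans φ)
      ((⟨inL s' r', inL_injective s' r'⟩ : s'.Vertex ↪ _).trans φ') h2.1
    have hr := contourList_injective r r' ((⟨inR s r, inR_injective s r⟩ : r.Vertex ↪ _).trans φ)
      ((⟨inR s' r', inR_injective s' r'⟩ : r'.Vertex ↪ _).trans φ') h3
    obtain rfl := (Sigma.mk.inj_iff.1 hs).1
    obtain rfl := (Sigma.mk.inj_iff.1 hr).1
    have hs' := eq_of_heq (Sigma.mk.inj_iff.1 hs).2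
    have hr' := eq_of_heq (Sigma.mk.inj_iff.1 hr).2
    have : φ = φ' := by
      ext v
      exact vertex_cases (C := fun v => φ v = φ' v) (fun v => DFunLike.congr_fun hs' v)
        (fun v => DFunLike.congr_fun hr' v) v
    rw [this]

theorem comp_inL_root (s r : PlanarTree) (φ : (graft s r).Vertex → V) :
    (φ ∘ inL s r) s.root = φ (inL s r s.root) := rfl

theorem comp_inR_root (s r : PlanarTree) (φ : (graft s r).Vertex → V) :
    (φ ∘ inR s r) r.root = φ (graft s r).root := rfl

/-- The closed walk around an injectively labelled planar tree. -/
def contour : (T : PlanarTree) → (φ : T.Vertex → V) → Function.Injective φ →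
    (⊤ : SimpleGraph V).Walk (φ T.root) (φ T.root)
  | point, _, _ => .nil
  | graft s r, φ, hφ =>
    have hne : φ (graft s r).root ≠ φ (inL s r s.root) := fun h => inL_ne_inR (hφ h).symm
    .cons (v := φ (inL s r s.root)) ((SimpleGraph.top_adj _ _).2 hne)
      (((contour s (φ ∘ inL s r) (hφ.comp (inL_injective s r))).copy
        (comp_inL_root s r φ) (comp_inL_root s r φ)).append
        (.cons ((SimpleGraph.top_adj _ _).2 hne.symm)
          ((contour r (φ ∘ inR s r) (hφ.comp (inR_injective s r))).copy
            (comp_inR_root s r φ) (comp_inR_root s r φ))))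

theorem support_contour : (T : PlanarTree) → (φ : T.Vertex → V) → (hφ : Function.Injective φ) →
    (T.contour φ hφ).support = T.contourList φ
  | point, _, _ => rfl
  | graft s r, φ, hφ => by
    have hs := support_contour s (φ ∘ inL s r) (hφ.comp (inL_injective s r))
    have hr := support_contour r (φ ∘ inR s r) (hφ.comp (inR_injective s r))
    rw [contour, contourList_graft, SimpleGraph.Walk.support_cons, SimpleGraph.Walk.support_append,
      SimpleGraph.Walk.support_cons, List.tail_cons, SimpleGraph.Walk.support_copy,
      SimpleGraph.Walk.support_copy, hs, hr]

theorem length_contour : (T : PlanarTree) → (φ : T.Vertex → V) → (hφ : Function.Injective φ) →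
    (T.contour φ hφ).length = 2 * T.numEdges
  | point, _, _ => rfl
  | graft s r, φ, hφ => by
    have hs := length_contour s (φ ∘ inL s r) (hφ.comp (inL_injective s r))
    have hr := length_contour r (φ ∘ inR s r) (hφ.comp (inR_injective s r))
    rw [contour, numEdges, SimpleGraph.Walk.length_cons, SimpleGraph.Walk.length_append,
      SimpleGraph.Walk.length_cons, SimpleGraph.Walk.length_copy, SimpleGraph.Walk.length_copy, hs, hr]
    omega

/-- Each tree edge is traversed once downwards and once upwards. Writing the count as a sum over
tree edges lets the induction run without knowing that different edges have different images. -/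
theorem count_edges_contour [DecidableEq V] : (T : PlanarTree) → (φ : T.Vertex → V) →
    (hφ : Function.Injective φ) → (e : Sym2 V) →
    (T.contour φ hφ).edges.count e = ∑ ε, if (T.ends ε).map φ = e then 2 else 0
  | point, _, _, _ => rfl
  | graft s r, φ, hφ, e => by
    have hs := count_edges_contour s (φ ∘ inL s r) (hφ.comp (inL_injective s r)) e
    have hr := count_edges_contour r (φ ∘ inR s r) (hφ.comp (inR_injective s r)) e
    rw [contour, sum_edge_graft, SimpleGraph.Walk.edges_cons, SimpleGraph.Walk.edges_append,
      SimpleGraph.Walk.edges_cons, List.count_cons, List.count_append, List.count_cons,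
      SimpleGraph.Walk.edges_copy, SimpleGraph.Walk.edges_copy, hs, hr]
    simp only [ends_graft_none, ends_graft_inl, ends_graft_inr, Sym2.map_map, Sym2.map_mk, beq_iff_eq,
      ← root_graft, Sym2.eq_swap (a := φ (inL s r s.root))]
    by_cases h : s(φ (graft s r).root, φ (inL s r s.root)) = e
    · simp only [h, if_true]; omega
    · simp only [h, if_false]; omega

theorem count_edges_contour_of_mem [DecidableEq V] (T : PlanarTree) (φ : T.Vertex → V)
    (hφ : Function.Injective φ) (ε : T.Edge) :
    (T.contour φ hφ).edges.count ((T.ends ε).map φ) = 2 := by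
  classical
  rw [count_edges_contour, Finset.sum_eq_single ε]
  · simp
  · intro ε' _ hne
    rw [if_neg]
    exact fun h => hne (T.ends_injective (Sym2.map.injective hφ h))
  · simp

theorem isDouble_contour [DecidableEq V] (T : PlanarTree) (φ : T.Vertex → V)
    (hφ : Function.Injective φ) : (T.contour φ hφ).IsDouble := by
  constructor
  · intro e he
    rw [← List.count_pos_iff] at he
    have h2 : 0 < ∑ ε, if (T.ends ε).map φ = e then 2 else 0 := by
      rwa [← count_edges_contour T φ hφ]
    obtain ⟨ε, -, hε⟩ := Finset.exists_ne_zero_of_sum_ne_zero h2.ne'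
    have : (T.ends ε).map φ = e := by by_contra h; simp [h] at hε
    rw [← this, count_edges_contour_of_mem]
  · have : (T.contour φ hφ).support.toFinset = Finset.univ.image φ := by
      ext x; simp [support_contour, mem_contourList]
    rw [this, Finset.card_image_of_injective _ hφ, length_contour, Finset.card_univ, card_vertex]
    ring

end PlanarTree

/-! ### Double walks as contours of trees -/

namespace SimpleGraph.Walk

variable {V : Type*} [DecidableEq V]

namespace IsDouble

variable {G : SimpleGraph V} {u : V} {p : G.Walk u u}

theorem card_edges [Finite V] (hp : p.IsDouble) : 2 * p.edges.toFinset.card = p.length := by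
  have h1 := p.two_mul_card_edges_le hp.1
  have h2 := p.card_support_le
  have h3 := hp.2
  omega

/-- The counts are at least two and add up to the length, which is twice the number of edges, so
none can exceed two. -/
theorem count_eq_two [Finite V] (hp : p.IsDouble) {e : Sym2 V} (he : e ∈ p.edges) :
    p.edges.count e = 2 := by
  have h := (Finset.sum_eq_sum_iff_of_le (s := p.edges.toFinset) (f := fun _ => 2)
    (g := fun e => p.edges.count e) fun e he => hp.1 e (List.mem_toFinset.1 he)).1 (by
      rw [List.sum_toFinset_count_eq_length, length_edges, ← hp.card_edges, Finset.sum_const,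
        smul_eq_mul, mul_comm])
  exact (h e (List.mem_toFinset.2 he)).symm

theorem even_length [Finite V] (hp : p.IsDouble) : Even p.length :=
  ⟨_, by rw [← hp.card_edges, two_mul]⟩

/-- A nontrivial double walk goes along an edge, around a double walk, back along the edge, and
around another double walk, which has no vertex in common with the first one. -/
theorem exists_decomp [Finite V] {w : V} {h : G.Adj u w} {p' : G.Walk w u}
    (hp : (cons h p').IsDouble) :
    ∃ (q : G.Walk w w) (r : G.Walk u u), q.IsDouble ∧ r.IsDouble ∧
      p' = q.append (cons h.symm r) ∧ ∀ x ∈ q.support, x ∉ r.support := by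
  set p := cons h p' with hpdef
  have hce : p.edges.count s(u, w) = 2 := hp.count_eq_two (by simp [hpdef])
  have hce' : p'.edges.count s(u, w) = 1 := by
    simpa [hpdef, edges_cons] using hce
  -- The first edge is used exactly once more; that second passage cuts the rest into `q` and `r`.
  obtain ⟨x, y, q, h', r, hxy, hq, rfl⟩ :=
    exists_eq_append_cons p' (List.count_pos_iff.1 (by rw [hce']; exact one_pos))
  have hadj : p.toSubgraph.Adj w u := by
    rw [← Subgraph.mem_edgeSet, mem_edges_toSubgraph]; simp [hpdef, Sym2.eq_swap]
  have hc1 := hp.card_edges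
  have hc2 := hp.2
  -- The traced subgraph is a tree, and `S` is the side of `w` once the first edge is removed.
  obtain ⟨S, hSw, hSu, hS⟩ := p.toSubgraph_connected.exists_cut
    (by rw [ncard_verts_toSubgraph, ncard_edgeSet_toSubgraph]; omega) hadj
  have hS' : ∀ a b, s(a, b) ∈ p.edges → s(a, b) ≠ s(w, u) → (S a ↔ S b) := fun a b hab =>
    hS a b ((mem_edges_toSubgraph p).2 hab)
  have hpe : p.edges = s(u, w) :: (q.edges ++ s(x, y) :: r.edges) := by
    simp [hpdef, edges_append]
  have hr : s(u, w) ∉ r.edges := by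
    rw [← List.count_eq_zero]
    rw [hpe, hxy, List.count_cons_self, List.count_append, List.count_cons_self] at hce
    omega
  have hqS : ∀ z ∈ q.support, S z := fun z hz =>
    (cut_iff_of_mem_support q (fun a b hab => hS' a b (by rw [hpe]; simp [hab]))
      (by rwa [Sym2.eq_swap]) z hz).2 hSw
  -- The walk `q` starts at `w` and avoids the cut edge, so it ends on the side of `w`, and the
  -- second passage must go backwards.
  have hxw : x = w ∧ y = u := by
    rcases Sym2.eq_iff.1 hxy with ⟨rfl, -⟩ | h
    · exact (hSu (hqS _ q.end_mem_support)).elim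
    · exact h
  obtain ⟨rfl, rfl⟩ := hxw
  have hrS : ∀ z ∈ r.support, ¬ S z := fun z hz hSz => hSu
    ((cut_iff_of_mem_support r (fun a b hab => hS' a b (by rw [hpe]; simp [hab]))
      (by rwa [Sym2.eq_swap]) z hz).1 hSz)
  have hdisj : ∀ z ∈ q.support, z ∉ r.support := fun z hz hz' => hrS z hz' (hqS z hz)
  have hedisj : ∀ f ∈ q.edges, f ∉ r.edges := fun f hf hf' => by
    induction f with
    | h a b =>
      exact hdisj a (q.fst_mem_support_of_mem_edges hf) (r.fst_mem_support_of_mem_edges hf')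
  -- The supports of `q` and `r` are disjoint, so every traversal of an edge of `q` already takes
  -- place in `q`.
  have hq2 : ∀ f ∈ q.edges, 2 ≤ q.edges.count f := fun f hf => by
    have h0 : f ≠ s(y, x) := fun h => hq (h ▸ hf)
    have h1 := hp.1 f (by rw [hpe]; simp [hf])
    rw [hpe, List.count_cons_of_ne h0.symm, List.count_append, hxy, List.count_cons_of_ne h0.symm,
      List.count_eq_zero_of_not_mem (hedisj f hf)] at h1
    omega
  have hr2 : ∀ f ∈ r.edges, 2 ≤ r.edges.count f := fun f hf => by
    have h0 : f ≠ s(y, x) := fun h => hr (h ▸ hf)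
    have h1 := hp.1 f (by rw [hpe]; simp [hf])
    rw [hpe, List.count_cons_of_ne h0.symm, List.count_append, hxy, List.count_cons_of_ne h0.symm,
      List.count_eq_zero_of_not_mem (fun h => hedisj f h hf)] at h1
    omega
  have hsupp : p.support.toFinset = q.support.toFinset ∪ r.support.toFinset := by
    ext z
    simp only [hpdef, support_cons, support_append, List.tail_cons, List.toFinset_cons,
      List.toFinset_append, Finset.mem_insert, Finset.mem_union, List.mem_toFinset]
    constructor
    · rintro (rfl | h)
      exacts [Or.inr r.start_mem_support, h]
    · exact Or.inr
  have hcard : p.support.toFinset.card = q.support.toFinset.card + r.support.toFinset.card := by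
    rw [hsupp]
    refine Finset.card_union_of_disjoint (Finset.disjoint_left.2 fun z hz hz' => ?_)
    exact hdisj z (List.mem_toFinset.1 hz) (List.mem_toFinset.1 hz')
  have hlen : p.length = q.length + r.length + 2 := by
    simp [hpdef]; ring
  have v1 := q.card_support_le
  have v2 := r.card_support_le
  have e1 := q.two_mul_card_edges_le hq2
  have e2 := r.two_mul_card_edges_le hr2
  -- The vertex numbers add up and the lengths add up to two less than that of `p`. As `2 v ≤ ℓ + 2`
  -- holds for `q` and `r`, and their sum is attained, both inequalities are equalities.
  exact ⟨q, r, ⟨hq2, by omega⟩, ⟨hr2, by omega⟩, rfl, hdisj⟩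

end IsDouble

/-- Every double walk is the walk around an injectively labelled planar tree. -/
theorem IsDouble.exists_contourList [Finite V] (m : ℕ) :
    ∀ {u : V} (p : (⊤ : SimpleGraph V).Walk u u), p.length ≤ m → p.IsDouble →
      ∃ (T : PlanarTree) (φ : T.Vertex → V), Function.Injective φ ∧ p.support = T.contourList φ := by
  -- The induction is on a bound for the length, because the pieces `q` and `r` are not structural
  -- subterms of `p`.
  induction m with
  | zero =>
    intro u p hm _
    cases p with
    | nil => exact ⟨.point, fun _ => u, fun _ _ _ => rfl, rfl⟩
    | cons h p' => simp at hm
  | succ m ih =>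
    intro u p hm hp
    cases p with
    | nil => exact ⟨.point, fun _ => u, fun _ _ _ => rfl, rfl⟩
    | @cons _ w _ h p' =>
      obtain ⟨q, r, hq, hr, rfl, hd⟩ := hp.exists_decomp
      rw [length_cons, length_append, length_cons] at hm
      obtain ⟨T, φ, hφ, hT⟩ := ih q (by omega) hq
      obtain ⟨T', φ', hφ', hT'⟩ := ih r (by omega) hr
      let ψ : (PlanarTree.graft T T').Vertex → V := Sum.elim φ φ'
      have hl : ψ ∘ PlanarTree.inL T T' = φ := rfl
      have hr : ψ ∘ PlanarTree.inR T T' = φ' := rfl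
      refine ⟨.graft T T', ψ, ?_, ?_⟩
      · refine Function.Injective.sumElim hφ hφ' fun a b hab => hd (φ a) ?_ ?_
        · rw [hT, PlanarTree.mem_contourList]; exact ⟨a, rfl⟩
        · rw [hT', PlanarTree.mem_contourList]; exact ⟨b, hab.symm⟩
      · have hroot : ψ (PlanarTree.graft T T').root = u := by
          obtain ⟨l, hl⟩ := PlanarTree.contourList_head T' φ'
          have := hT'.symm.trans r.cons_tail_support.symm
          rw [hl] at this
          exact (List.cons.inj this).1
        rw [PlanarTree.contourList_graft, hl, hr, hroot, ← hT, ← hT', support_cons, support_append,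
          support_cons, List.tail_cons]

theorem sigma_ext_support {V : Type*} {G : SimpleGraph V} {u v : V} {p : G.Walk u u} {q : G.Walk v v}
    (h : p.support = q.support) : (⟨u, p⟩ : Σ u, G.Walk u u) = ⟨v, q⟩ := by
  have huv : u = v := by
    have := p.cons_tail_support.trans (h.trans q.cons_tail_support.symm)
    exact (List.cons.inj this).1
  subst huv
  rw [ext_support h]

end SimpleGraph.Walk

/-- Closed walks of length `k` in the complete graph. -/
abbrev ClosedWalk (V : Type*) (k : ℕ) : Type _ :=
  Σ u : V, {p : (⊤ : SimpleGraph V).Walk u u // p.length = k}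

namespace PlanarTree

variable {V : Type*} [DecidableEq V]

/-- The walk around a labelled planar tree with `m` edges, as a double closed walk. -/
def toDouble {k : ℕ} (hk : Even k) (x : Σ T : OfSize (k / 2), T.1.Vertex ↪ V) :
    {w : ClosedWalk V k // w.2.1.IsDouble} :=
  ⟨⟨x.2 x.1.1.root, x.1.1.contour x.2 x.2.injective, by
    rw [length_contour, x.1.2, Nat.mul_div_cancel' hk.two_dvd]⟩, isDouble_contour _ _ _⟩

/-- This turns sums over double walks into sums over planar trees and injective labellings.
Injectivity is unique readability of contours; surjectivity is the recursive decomposition of a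
double walk. -/
theorem toDouble_bijective [Finite V] {k : ℕ} (hk : Even k) :
    Function.Bijective (toDouble (V := V) hk) := by
  constructor
  · rintro ⟨⟨T, hT⟩, φ⟩ ⟨⟨T', hT'⟩, φ'⟩ h
    have h1 := congrArg (fun w => w.1.2.1.support) h
    simp only [toDouble, support_contour] at h1
    have h2 := contourList_injective T T' φ φ' h1
    obtain rfl := (Sigma.mk.inj_iff.1 h2).1
    obtain rfl := eq_of_heq (Sigma.mk.inj_iff.1 h2).2
    rfl
  · rintro ⟨⟨u, p, hpk⟩, hp⟩
    obtain ⟨T, φ, hφ, hT⟩ := SimpleGraph.Walk.IsDouble.exists_contourList k p hpk.le hp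
    have h1 : (T.contour φ hφ).support = p.support := by rw [support_contour, hT]
    have h2 : T.numEdges = k / 2 := by
      have h3 := congrArg List.length h1
      rw [SimpleGraph.Walk.length_support, SimpleGraph.Walk.length_support, length_contour, hpk] at h3
      omega
    refine ⟨⟨⟨T, h2⟩, ⟨φ, hφ⟩⟩, Subtype.ext ?_⟩
    have h4 := SimpleGraph.Walk.sigma_ext_support h1
    obtain rfl := (Sigma.mk.inj_iff.1 h4).1
    have h5 := eq_of_heq (Sigma.mk.inj_iff.1 h4).2
    simp only [toDouble, Function.Embedding.coeFn_mk]
    exact Sigma.ext rfl (heq_of_eq (Subtype.ext h5))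

end PlanarTree

/-! ## Expansion of traces of powers over closed walks -/

namespace SimpleGraph

variable {V : Type*} [Fintype V] [DecidableEq V]

/-- The vanishing diagonal removes index sequences with equal consecutive entries, and those left
are precisely the walks in the complete graph. Symmetry is what lets the weight be a function of
unordered pairs. -/
theorem pow_apply_eq_sum_walk (M : Matrix V V ℝ) (g : Sym2 V → ℝ)
    (hg : ∀ i j, i ≠ j → M i j = g s(i, j)) (h0 : ∀ i, M i i = 0) (k : ℕ) (u v : V) :
    (M ^ k) u v = ∑ p ∈ (⊤ : SimpleGraph V).finsetWalkLength k u v, (p.edges.map g).prod := by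
  induction k generalizing u v with
  | zero => obtain rfl | h := eq_or_ne u v <;> simp [finsetWalkLength, *]
  | succ k ih =>
    rw [pow_succ', Matrix.mul_apply, finsetWalkLength, Finset.sum_biUnion]
    · have step : ∀ w : (⊤ : SimpleGraph V).neighborSet u,
          ∑ p ∈ ((⊤ : SimpleGraph V).finsetWalkLength k w v).map
            ⟨fun p => Walk.cons w.property p, fun _ _ h => by cases h; rfl⟩, (p.edges.map g).prod =
          M u w * (M ^ k) w v := by
        intro w
        have hadj : (⊤ : SimpleGraph V).Adj u w := w.2
        rw [ih, Finset.mul_sum, Finset.sum_map]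
        refine Finset.sum_congr rfl fun p _ => ?_
        change (List.map g (Walk.cons hadj p).edges).prod = _
        rw [Walk.edges_cons, List.map_cons, List.prod_cons, hg u w hadj.ne]
      refine Eq.trans ?_ (Finset.sum_congr rfl fun w _ => (step w).symm)
      rw [← Finset.sum_subtype (Finset.univ.filter (· ≠ u)) (p := (· ∈ (⊤ : SimpleGraph V).neighborSet u))
        (by simp [eq_comm]) (f := fun w => M u w * (M ^ k) w v), Finset.sum_filter]
      refine Finset.sum_congr rfl fun w _ => ?_
      by_cases hw : w = u <;> simp [hw, h0]
    · rintro ⟨x, hx⟩ - ⟨y, hy⟩ - hxy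
      rw [Function.onFun, disjoint_iff_inf_le]
      intro p hp
      simp only [Finset.inf_eq_inter, Finset.mem_inter, Finset.mem_map] at hp
      obtain ⟨⟨px, _, rfl⟩, ⟨py, hpy, hp⟩⟩ := hp
      cases hp
      simp at hxy

theorem trace_pow_eq_sum_closedWalk (M : Matrix V V ℝ) (g : Sym2 V → ℝ)
    (hg : ∀ i j, i ≠ j → M i j = g s(i, j)) (h0 : ∀ i, M i i = 0) (k : ℕ) :
    (M ^ k).trace = ∑ w : ClosedWalk V k, ∏ e, g e ^ w.2.1.edges.count e := by
  rw [Matrix.trace, Fintype.sum_sigma]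
  refine Finset.sum_congr rfl fun u _ => ?_
  rw [Matrix.diag_apply, pow_apply_eq_sum_walk M g hg h0 k u u,
    Finset.sum_subtype _ (p := fun p => p.length = k) fun p => mem_finsetWalkLength_iff]
  refine Finset.sum_congr rfl fun p _ => ?_
  rw [Finset.prod_list_map_count]
  refine Finset.prod_subset (Finset.subset_univ _) fun e _ he => ?_
  rw [List.count_eq_zero_of_not_mem fun h => he (List.mem_toFinset.2 h), pow_zero]

end SimpleGraph

/-! ## Counting pairs of walks by the number of their vertices -/

/-- Functions from a finite set into `V`, weighted by a power of `|V|⁻¹` given by the number of their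
values, have bounded total weight. -/
theorem sum_inv_pow_card_image_le {ι V : Type*} [Fintype ι] [DecidableEq ι] [Fintype V] [DecidableEq V] :
    ∑ f : ι → V, ((Fintype.card V : ℝ)⁻¹) ^ (Finset.univ.image f).card ≤
      (Fintype.card ι + 1) * (Fintype.card ι : ℝ) ^ Fintype.card ι := by
  classical
  set N := Fintype.card V
  set m := Fintype.card ι
  have hmaps : ∀ f ∈ (Finset.univ : Finset (ι → V)), (Finset.univ.image f).card ∈ Finset.range (m + 1) :=
    fun f _ => Finset.mem_range.2 (Nat.lt_succ_of_le Finset.card_image_le)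
  rw [← Finset.sum_fiberwise_of_maps_to hmaps]
  have hv : ∀ v ∈ Finset.range (m + 1),
      ∑ f ∈ Finset.univ.filter (fun f : ι → V => (Finset.univ.image f).card = v),
        ((N : ℝ)⁻¹) ^ (Finset.univ.image f).card ≤ (m : ℝ) ^ m := by
    intro v hv
    rw [Finset.sum_congr rfl fun f hf => by rw [(Finset.mem_filter.1 hf).2], Finset.sum_const,
      nsmul_eq_mul]
    -- Choose the set of values, in at most `N ^ v` ways, and then a function into it, in `v ^ m ≤ m
    -- ^ m` ways.
    have hcount : (Finset.univ.filter (fun f : ι → V => (Finset.univ.image f).card = v)).card ≤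
        N ^ v * m ^ m := by
      have hsub : Finset.univ.filter (fun f : ι → V => (Finset.univ.image f).card = v) ⊆
          (Finset.powersetCard v (Finset.univ : Finset V)).biUnion
            fun R => Fintype.piFinset fun _ => R := by
        intro f hf
        rw [Finset.mem_biUnion]
        refine ⟨Finset.univ.image f, ?_, ?_⟩
        · rw [Finset.mem_powersetCard]; exact ⟨Finset.subset_univ _, (Finset.mem_filter.1 hf).2⟩
        · rw [Fintype.mem_piFinset]; exact fun i => Finset.mem_image_of_mem _ (Finset.mem_univ _)
      refine (Finset.card_le_card hsub).trans (Finset.card_biUnion_le.trans ?_)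
      rw [Finset.sum_congr rfl fun R hR => by
        rw [Fintype.card_piFinset, Finset.prod_const, (Finset.mem_powersetCard.1 hR).2,
          Finset.card_univ], Finset.sum_const, Finset.card_powersetCard, Finset.card_univ, smul_eq_mul]
      refine Nat.mul_le_mul (Nat.choose_le_pow _ _) (Nat.pow_le_pow_left ?_ _)
      have := Finset.mem_range.1 hv; omega
    have hcount' : ((Finset.univ.filter (fun f : ι → V => (Finset.univ.image f).card = v)).card : ℝ) ≤
        (N : ℝ) ^ v * (m : ℝ) ^ m := by exact_mod_cast hcount
    refine (mul_le_mul_of_nonneg_right hcount' (by positivity)).trans ?_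
    -- For `N = 0` the inverse is zero by convention and nothing cancels; only `v = 0` then has
    -- nonzero weight.
    rcases Nat.eq_zero_or_pos N with h0 | h0
    · rw [h0]
      rcases Nat.eq_zero_or_pos v with rfl | hv0
      · simp
      · simp [hv0.ne']
    · have hN : (N : ℝ) ≠ 0 := by positivity
      rw [mul_right_comm, ← mul_pow, mul_inv_cancel₀ hN, one_pow, one_mul]
  refine (Finset.sum_le_sum hv).trans ?_
  rw [Finset.sum_const, Finset.card_range, nsmul_eq_mul]
  push_cast
  exact le_rfl

open SimpleGraph.Walk in
-- A pair of walks is encoded by its `2 * (k + 1)` successive vertices, and the number of distinct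
-- values of this sequence is the number of vertices of the union. The resulting bound does not
-- depend on `V`.
theorem sum_pair_inv_pow_le {V : Type*} [Fintype V] [DecidableEq V] (k : ℕ) :
    ∑ x : ClosedWalk V k × ClosedWalk V k,
      ((Fintype.card V : ℝ)⁻¹) ^ (pairVerts x.1.2.1 x.2.2.1).card ≤
      (2 * (k + 1) + 1) * (2 * (k + 1) : ℝ) ^ (2 * (k + 1)) := by
  let F : ClosedWalk V k × ClosedWalk V k → (Fin (k + 1) ⊕ Fin (k + 1) → V) := fun x =>
    Sum.elim (fun i => x.1.2.1.getVert i) (fun i => x.2.2.1.getVert i)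
  have hget : ∀ (w w' : ClosedWalk V k), (∀ i : Fin (k + 1), w.2.1.getVert i = w'.2.1.getVert i) →
      w = w' := by
    rintro ⟨u, p, hp⟩ ⟨v, q, hq⟩ h
    have huv : u = v := by simpa using h 0
    subst huv
    have : p = q := ext_getVert_le_length (hp.trans hq.symm) fun i hi =>
      h ⟨i, by rw [hp] at hi; omega⟩
    subst this
    rfl
  have hF : Function.Injective F := by
    rintro ⟨x, y⟩ ⟨x', y'⟩ h
    rw [hget x x' fun i => congrFun h (Sum.inl i), hget y y' fun i => congrFun h (Sum.inr i)]
  have himg : ∀ x, pairVerts x.1.2.1 x.2.2.1 = Finset.univ.image (F x) := by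
    have key : ∀ (w : ClosedWalk V k) (z : V), z ∈ w.2.1.support ↔
        ∃ i : Fin (k + 1), w.2.1.getVert i = z := by
      intro w z
      rw [mem_support_iff_exists_getVert, w.2.2]
      constructor
      · rintro ⟨i, hi, hik⟩
        exact ⟨⟨i, by omega⟩, hi⟩
      · rintro ⟨i, hi⟩
        exact ⟨i, hi, by omega⟩
    intro x
    ext z
    simp [pairVerts, key, F]
  simp only [himg]
  have h1 := Finset.sum_map Finset.univ ⟨F, hF⟩
    fun f => ((Fintype.card V : ℝ)⁻¹) ^ (Finset.univ.image f).card
  simp only [Function.Embedding.coeFn_mk] at h1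
  rw [← h1]
  refine (Finset.sum_le_sum_of_subset_of_nonneg (Finset.subset_univ _)
    fun f _ _ => by positivity).trans (sum_inv_pow_card_image_le.trans_eq ?_)
  simp only [Fintype.card_sum, Fintype.card_fin]
  push_cast
  rw [show k + 1 + (k + 1) = 2 * (k + 1) by ring]
  ring

/-! ## Monomials in independent bounded centered variables -/

/-- Independent centered random variables, bounded by `1`, with variances at most `q`. -/
structure IsSmallIndep {Ω E : Type*} [MeasurableSpace Ω] (P : Measure Ω) (a : E → Ω → ℝ)
    (q : ℝ) : Prop where
  measurable : ∀ e, Measurable (a e)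
  indep : iIndepFun a P
  bdd : ∀ e, ∀ᵐ ω ∂P, |a e ω| ≤ 1
  mean : ∀ e, ∫ ω, a e ω ∂P = 0
  sq_le : ∀ e, ∫ ω, a e ω ^ 2 ∂P ≤ q
  nonneg : 0 ≤ q

section Monomials

variable {Ω E : Type*} [MeasurableSpace Ω] (P : Measure Ω) (a : E → Ω → ℝ)

/-- Moments. -/
def mom (e : E) (i : ℕ) : ℝ := ∫ ω, a e ω ^ i ∂P

variable [Fintype E]

/-- The monomial with exponents `m`. -/
def monomialVar (m : E → ℕ) (ω : Ω) : ℝ := ∏ e, a e ω ^ m e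

/-- The expectation of the monomial with exponents `m`. -/
def monomialMean (m : E → ℕ) : ℝ := ∏ e, mom P a e (m e)

/-- The centered monomial with exponents `m`. -/
def monomialCen (m : E → ℕ) (ω : Ω) : ℝ := monomialVar a m ω - monomialMean P a m

variable [DecidableEq E]

/-- The projection of a centered monomial to sums of functions of single variables. -/
def monomialLin (m : E → ℕ) (ω : Ω) : ℝ :=
  ∑ e, (a e ω ^ m e - mom P a e (m e)) * ∏ f ∈ Finset.univ.erase e, mom P a f (m f)

/-- The covariance of the projections of two monomials. -/
def linCov (m m' : E → ℕ) : ℝ :=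
  ∑ e, (mom P a e (m e + m' e) - mom P a e (m e) * mom P a e (m' e)) *
    ∏ f ∈ Finset.univ.erase e, (mom P a f (m f) * mom P a f (m' f))

end Monomials

theorem MeasureTheory.MemLp.integrable_fun_mul {Ω : Type*} [MeasurableSpace Ω] {P : Measure Ω}
    {f g : Ω → ℝ} (hf : MemLp f 2 P) (hg : MemLp g 2 P) : Integrable (fun ω => f ω * g ω) P :=
  hf.integrable_mul hg

namespace IsSmallIndep

variable {Ω E : Type*} [MeasurableSpace Ω] {P : Measure Ω} [IsProbabilityMeasure P]
  {a : E → Ω → ℝ} {q : ℝ} (ha : IsSmallIndep P a q)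

include ha

theorem ae_abs_pow_le (e : E) (i : ℕ) : ∀ᵐ ω ∂P, |a e ω ^ i| ≤ 1 := by
  filter_upwards [ha.bdd e] with ω h
  rw [abs_pow]; exact pow_le_one₀ (abs_nonneg _) h

theorem mom_zero (e : E) : mom P a e 0 = 1 := by
  simp [mom]

theorem mom_one (e : E) : mom P a e 1 = 0 := by
  simp [mom, ha.mean]

theorem integrable_pow (e : E) (i : ℕ) : Integrable (fun ω => a e ω ^ i) P := by
  exact .of_bound ((ha.measurable e).pow_const i).aestronglyMeasurable 1 (ha.ae_abs_pow_le e i)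

theorem abs_mom_le_one (e : E) (i : ℕ) : |mom P a e i| ≤ 1 := by
  simpa [mom] using norm_integral_le_of_norm_le_const (f := fun ω => a e ω ^ i) (C := 1)
    (ha.ae_abs_pow_le e i)

/-- The first moment vanishes, and from the second on `|a|` to any power is at most `a ^ 2`, since
`|a| ≤ 1`. Each variable present in a monomial thus costs a full factor `q`, whatever its exponent.
-/
theorem abs_mom_le {i : ℕ} (hi : i ≠ 0) (e : E) : |mom P a e i| ≤ q := by
  rcases Nat.lt_or_ge i 2 with h | h
  · obtain rfl : i = 1 := by omega
    rw [ha.mom_one, abs_zero]; exact ha.nonneg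
  · refine (abs_integral_le_integral_abs).trans ((integral_mono_ae (ha.integrable_pow e i).abs
      (ha.integrable_pow e 2) ?_).trans (ha.sq_le e))
    filter_upwards [ha.bdd e] with ω hω
    change |a e ω ^ i| ≤ a e ω ^ 2
    rw [abs_pow, ← sq_abs (a e ω)]
    exact pow_le_pow_of_le_one (abs_nonneg _) hω h

theorem abs_mom_mul_le {i j : ℕ} (hij : i + j ≠ 0) (e : E) : |mom P a e i * mom P a e j| ≤ q := by
  rw [abs_mul]
  by_cases hi : i = 0
  · have h1 := ha.abs_mom_le (i := j) (by omega) e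
    exact (mul_le_of_le_one_left (abs_nonneg _) (ha.abs_mom_le_one e i)).trans h1
  · exact (mul_le_of_le_one_right (abs_nonneg _) (ha.abs_mom_le_one e j)).trans (ha.abs_mom_le hi e)

theorem memLp_pow (e : E) (i : ℕ) : MemLp (fun ω => a e ω ^ i) 2 P := by
  exact .of_bound ((ha.measurable e).pow_const i).aestronglyMeasurable 1 (ha.ae_abs_pow_le e i)

theorem memLp_pow_sub (e : E) (i : ℕ) : MemLp (fun ω => a e ω ^ i - mom P a e i) 2 P := by
  exact (ha.memLp_pow e i).sub (memLp_const _)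

theorem integral_pow_sub (e : E) (i : ℕ) : ∫ ω, (a e ω ^ i - mom P a e i) ∂P = 0 := by
  rw [integral_sub (ha.integrable_pow e i) (integrable_const _), integral_const]
  simp [mom]

variable [Fintype E]

theorem memLp_monomialVar (m : E → ℕ) : MemLp (monomialVar a m) 2 P := by
  refine .of_bound (Measurable.aestronglyMeasurable ?_) 1 ?_
  · exact Finset.measurable_fun_prod _ fun e _ => (ha.measurable e).pow_const _
  · filter_upwards [ae_all_iff.2 fun e => ha.ae_abs_pow_le e (m e)] with ω h
    rw [monomialVar, Real.norm_eq_abs, Finset.abs_prod]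
    exact Finset.prod_le_one (fun _ _ => abs_nonneg _) fun e _ => h e

theorem integral_monomialVar (m : E → ℕ) : ∫ ω, monomialVar a m ω ∂P = monomialMean P a m :=
  ha.indep.integral_fun_prod_comp (f := fun e x => x ^ m e) (fun e => (ha.measurable e).aemeasurable)
    fun e => by fun_prop

theorem memLp_monomialCen (m : E → ℕ) : MemLp (monomialCen P a m) 2 P := by
  exact (ha.memLp_monomialVar m).sub (memLp_const _)

theorem integral_monomialCen (m : E → ℕ) : ∫ ω, monomialCen P a m ω ∂P = 0 := by
  unfold monomialCen
  rw [integral_sub ((ha.memLp_monomialVar m).integrable one_le_two) (integrable_const _),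
    ha.integral_monomialVar, integral_const]
  simp

omit [MeasurableSpace Ω] ha in
theorem monomialVar_mul (m m' : E → ℕ) (ω : Ω) :
    monomialVar a m ω * monomialVar a m' ω = monomialVar a (m + m') ω := by
  simp only [monomialVar, ← Finset.prod_mul_distrib, Pi.add_apply, pow_add]

theorem integral_cen_mul_cen (m m' : E → ℕ) :
    ∫ ω, monomialCen P a m ω * monomialCen P a m' ω ∂P =
      monomialMean P a (m + m') - monomialMean P a m * monomialMean P a m' := by
  have h1 := (ha.memLp_monomialVar m).integrable one_le_two
  have h2 := (ha.memLp_monomialCen m').integrable one_le_two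
  have h3 : ∀ ω, monomialCen P a m ω * monomialCen P a m' ω =
      (monomialVar a (m + m') ω - monomialVar a m ω * monomialMean P a m') -
        monomialMean P a m * monomialCen P a m' ω := fun ω => by
    rw [← monomialVar_mul]; simp only [monomialCen]; ring
  simp only [h3]
  rw [integral_sub _ (h2.const_mul _), integral_sub _ (h1.mul_const _), integral_const_mul,
    integral_mul_const, ha.integral_monomialCen, ha.integral_monomialVar, ha.integral_monomialVar]
  · ring
  · exact (ha.memLp_monomialVar _).integrable one_le_two
  · exact ((ha.memLp_monomialVar _).integrable one_le_two).sub (h1.mul_const _)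

variable [DecidableEq E]

omit ha in
theorem monomialMean_eq (m : E → ℕ) (e : E) :
    monomialMean P a m = mom P a e (m e) * ∏ f ∈ Finset.univ.erase e, mom P a f (m f) :=
  (Finset.mul_prod_erase _ _ (Finset.mem_univ e)).symm

/-- Multiplying by `a e ^ i` only raises the exponent of `e`; by independence all other factors come
out unchanged. -/
theorem integral_pow_sub_mul_monomialVar (e : E) (i : ℕ) (m : E → ℕ) :
    ∫ ω, (a e ω ^ i - mom P a e i) * monomialVar a m ω ∂P =
      (mom P a e (i + m e) - mom P a e i * mom P a e (m e)) *
        ∏ f ∈ Finset.univ.erase e, mom P a f (m f) := by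
  have h1 : ∀ ω, a e ω ^ i = monomialVar a (Pi.single e i) ω := fun ω => by
    rw [monomialVar, Finset.prod_eq_single e]
    · simp
    · intro f _ hf; simp [hf]
    · simp
  simp only [sub_mul, h1, monomialVar_mul]
  rw [integral_sub ((ha.memLp_monomialVar _).integrable one_le_two)
    (((ha.memLp_monomialVar _).integrable one_le_two).const_mul _), integral_const_mul,
    ha.integral_monomialVar, ha.integral_monomialVar, monomialMean_eq _ e, monomialMean_eq m e]
  have h2 : ∏ f ∈ Finset.univ.erase e, mom P a f ((Pi.single e i + m : E → ℕ) f) =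
      ∏ f ∈ Finset.univ.erase e, mom P a f (m f) := by
    refine Finset.prod_congr rfl fun f hf => ?_
    simp [Pi.single_eq_of_ne (Finset.ne_of_mem_erase hf)]
  rw [h2]
  simp only [Pi.add_apply, Pi.single_eq_same]
  ring

theorem integral_pow_sub_mul_pow_sub (e e' : E) (i j : ℕ) :
    ∫ ω, (a e ω ^ i - mom P a e i) * (a e' ω ^ j - mom P a e' j) ∂P =
      if e = e' then mom P a e (i + j) - mom P a e i * mom P a e j else 0 := by
  have h1 : ∀ ω, a e' ω ^ j = monomialVar a (Pi.single e' j) ω := fun ω => by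
    rw [monomialVar, Finset.prod_eq_single e']
    · simp
    · intro f _ hf; simp [hf]
    · simp
  simp only [mul_sub (_ - _)]
  rw [integral_sub ((ha.memLp_pow_sub e i).integrable_fun_mul (ha.memLp_pow e' j))
    (((ha.memLp_pow_sub e i).integrable one_le_two).mul_const _), integral_mul_const,
    ha.integral_pow_sub, zero_mul, sub_zero]
  simp only [h1, ha.integral_pow_sub_mul_monomialVar]
  split_ifs with h
  · subst h
    rw [Pi.single_eq_same, Finset.prod_eq_one, mul_one]
    intro f hf
    rw [Pi.single_eq_of_ne (Finset.ne_of_mem_erase hf), ha.mom_zero]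
  · rw [Pi.single_eq_of_ne h, ha.mom_zero, add_zero, mul_one, sub_self, zero_mul]

theorem memLp_monomialLin (m : E → ℕ) : MemLp (monomialLin P a m) 2 P :=
  memLp_finsetSum _ fun e _ => (ha.memLp_pow_sub e (m e)).mul_const _

theorem integral_monomialLin (m : E → ℕ) : ∫ ω, monomialLin P a m ω ∂P = 0 := by
  unfold monomialLin
  rw [integral_finsetSum _ fun e _ => ((ha.memLp_pow_sub e (m e)).integrable one_le_two).mul_const _]
  simp [integral_mul_const, ha.integral_pow_sub]

/-- `monomialLin` is the orthogonal projection of `monomialCen` onto sums of functions of single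
variables. Pairing it with a centered monomial therefore sees only the projection of the latter, and
this value agrees with `integral_lin_mul_lin`. -/
theorem integral_lin_mul_cen (m m' : E → ℕ) :
    ∫ ω, monomialLin P a m ω * monomialCen P a m' ω ∂P = linCov P a m m' := by
  simp only [monomialCen, mul_sub]
  rw [integral_sub ((ha.memLp_monomialLin m).integrable_fun_mul (ha.memLp_monomialVar m'))
    (((ha.memLp_monomialLin m).integrable one_le_two).mul_const _), integral_mul_const,
    ha.integral_monomialLin, zero_mul, sub_zero]
  simp only [monomialLin, Finset.sum_mul]
  rw [integral_finsetSum, linCov]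
  · refine Finset.sum_congr rfl fun e _ => ?_
    simp only [mul_right_comm _ (∏ f ∈ Finset.univ.erase e, mom P a f (m f))]
    rw [integral_mul_const, ha.integral_pow_sub_mul_monomialVar, Finset.prod_mul_distrib]
    ring
  · intro e _
    exact ((ha.memLp_pow_sub e (m e)).mul_const _).integrable_fun_mul (ha.memLp_monomialVar m')

omit ha in
theorem linCov_comm (m m' : E → ℕ) : linCov P a m m' = linCov P a m' m := by
  unfold linCov
  refine Finset.sum_congr rfl fun e _ => ?_
  rw [add_comm (m e), mul_comm (mom P a e (m e))]
  congr 1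
  exact Finset.prod_congr rfl fun f _ => mul_comm _ _

theorem integral_cen_mul_lin (m m' : E → ℕ) :
    ∫ ω, monomialCen P a m ω * monomialLin P a m' ω ∂P = linCov P a m m' := by
  rw [linCov_comm, ← ha.integral_lin_mul_cen]
  simp only [mul_comm]

theorem integral_lin_mul_lin (m m' : E → ℕ) :
    ∫ ω, monomialLin P a m ω * monomialLin P a m' ω ∂P = linCov P a m m' := by
  simp only [monomialLin, Finset.sum_mul_sum]
  rw [integral_finsetSum, linCov]
  · refine Finset.sum_congr rfl fun e _ => ?_
    rw [integral_finsetSum]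
    · rw [Finset.sum_eq_single e]
      · have : ∀ ω, (a e ω ^ m e - mom P a e (m e)) * (∏ f ∈ Finset.univ.erase e, mom P a f (m f)) *
            ((a e ω ^ m' e - mom P a e (m' e)) * ∏ f ∈ Finset.univ.erase e, mom P a f (m' f)) =
            ((a e ω ^ m e - mom P a e (m e)) * (a e ω ^ m' e - mom P a e (m' e))) *
            ∏ f ∈ Finset.univ.erase e, (mom P a f (m f) * mom P a f (m' f)) := fun ω => by
          rw [Finset.prod_mul_distrib]; ring
        simp only [this]
        rw [integral_mul_const, ha.integral_pow_sub_mul_pow_sub, if_pos rfl]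
      · intro e' _ he'
        have : ∀ ω, (a e ω ^ m e - mom P a e (m e)) * (∏ f ∈ Finset.univ.erase e, mom P a f (m f)) *
            ((a e' ω ^ m' e' - mom P a e' (m' e')) *
              ∏ f ∈ Finset.univ.erase e', mom P a f (m' f)) =
            ((a e ω ^ m e - mom P a e (m e)) * (a e' ω ^ m' e' - mom P a e' (m' e'))) *
            ((∏ f ∈ Finset.univ.erase e, mom P a f (m f)) *
              ∏ f ∈ Finset.univ.erase e', mom P a f (m' f)) := fun ω => by ring
        simp only [this]
        rw [integral_mul_const, ha.integral_pow_sub_mul_pow_sub, if_neg he'.symm, zero_mul]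
      · simp
    · intro e' _
      exact ((ha.memLp_pow_sub e _).mul_const _).integrable_fun_mul ((ha.memLp_pow_sub e' _).mul_const _)
  · intro e _
    exact integrable_finsetSum _ fun e' _ =>
      ((ha.memLp_pow_sub e _).mul_const _).integrable_fun_mul ((ha.memLp_pow_sub e' _).mul_const _)

end IsSmallIndep

/-! ### Vanishing and size of covariances of monomials -/

namespace IsSmallIndep

variable {Ω E : Type*} [MeasurableSpace Ω] {P : Measure Ω} [IsProbabilityMeasure P]
  {a : E → Ω → ℝ} {q : ℝ} (ha : IsSmallIndep P a q) [Fintype E] [DecidableEq E]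

include ha

theorem abs_prod_le_pow (s : Finset E) (x : E → ℝ) (U : Finset E)
    (hU : ∀ e ∈ U, |x e| ≤ q) (h1 : ∀ e ∉ U, |x e| ≤ 1) :
    |∏ e ∈ s, x e| ≤ q ^ (s ∩ U).card := by
  rw [Finset.abs_prod]
  refine (Finset.prod_le_prod (g := fun e => if e ∈ U then q else 1) (fun _ _ => abs_nonneg _)
    fun e _ => ?_).trans_eq ?_
  · split_ifs with h
    exacts [hU e h, h1 e h]
  · rw [Finset.prod_ite, Finset.prod_const, Finset.prod_const_one, mul_one,
      Finset.filter_mem_eq_inter]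

/-- The difference between the covariance of two monomials and, if `θ = 1`, the covariance of their
projections is small. -/
theorem abs_cov_sub_le (m m' : E → ℕ) {θ : ℝ} (hθ : |θ| ≤ 1) (U : Finset E)
    (hU : ∀ e, e ∈ U ↔ m e + m' e ≠ 0) :
    |monomialMean P a (m + m') - monomialMean P a m * monomialMean P a m' - θ * linCov P a m m'| ≤
      (2 + 2 * U.card) * q ^ U.card := by
  have hU0 : ∀ e, e ∉ U → m e = 0 ∧ m' e = 0 := fun e he => by
    have := (hU e).not.1 he
    omega
  have h1 : |monomialMean P a (m + m')| ≤ q ^ U.card := by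
    have := ha.abs_prod_le_pow Finset.univ (fun e => mom P a e ((m + m') e)) U
      (fun e he => ha.abs_mom_le ((hU e).1 he) e) (fun e _ => ha.abs_mom_le_one _ _)
    rwa [Finset.univ_inter] at this
  have h2 : |monomialMean P a m * monomialMean P a m'| ≤ q ^ U.card := by
    have := ha.abs_prod_le_pow Finset.univ (fun e => mom P a e (m e) * mom P a e (m' e)) U
      (fun e he => ha.abs_mom_mul_le ((hU e).1 he) e) (fun e he => by
        rw [(hU0 e he).1, (hU0 e he).2, ha.mom_zero]; simp)
    rwa [Finset.univ_inter, Finset.prod_mul_distrib] at this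
  have h3 : |linCov P a m m'| ≤ 2 * U.card * q ^ U.card := by
    have hterm : ∀ e, |(mom P a e (m e + m' e) - mom P a e (m e) * mom P a e (m' e)) *
        ∏ f ∈ Finset.univ.erase e, (mom P a f (m f) * mom P a f (m' f))| ≤
        if e ∈ U then 2 * q ^ U.card else 0 := by
      intro e
      split_ifs with he
      · have hb := ha.abs_prod_le_pow (Finset.univ.erase e)
          (fun e => mom P a e (m e) * mom P a e (m' e)) U
          (fun e he => ha.abs_mom_mul_le ((hU e).1 he) e) (fun e he => by
            rw [(hU0 e he).1, (hU0 e he).2, ha.mom_zero]; simp)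
        -- Erasing `e` loses one factor `q` from the product; the covariance factor at `e`, at most
        -- `2 * q`, restores it.
        have hcard : (Finset.univ.erase e ∩ U).card + 1 = U.card := by
          rw [Finset.erase_inter, Finset.univ_inter, Finset.card_erase_add_one he]
        rw [abs_mul, ← hcard, pow_succ', ← mul_assoc]
        refine mul_le_mul ?_ hb (abs_nonneg _) (by have := ha.nonneg; positivity)
        refine (abs_sub _ _).trans ?_
        have := ha.abs_mom_le ((hU e).1 he) e
        have := ha.abs_mom_mul_le ((hU e).1 he) e
        linarith
      · rw [(hU0 e he).1, (hU0 e he).2, add_zero, ha.mom_zero]; simp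
    refine (Finset.abs_sum_le_sum_abs _ _).trans ((Finset.sum_le_sum fun e _ => hterm e).trans_eq ?_)
    rw [← Finset.sum_filter, Finset.sum_const, nsmul_eq_mul, Finset.filter_mem_eq_inter,
      Finset.univ_inter]
    ring
  have h4 : |θ * linCov P a m m'| ≤ 2 * U.card * q ^ U.card := by
    rw [abs_mul]
    exact (mul_le_of_le_one_left (abs_nonneg _) hθ).trans h3
  refine (abs_sub _ _).trans ((add_le_add ((abs_sub _ _).trans (add_le_add h1 h2)) h4).trans_eq ?_)
  ring

/-- The variable `e` occurs in only one of the monomials and to the first power, so its mean zero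
enters every summand: through the product when `f ≠ e`, and through both parts of the covariance
when `f = e`. -/
theorem linCov_eq_zero_of_add_eq_one {m m' : E → ℕ} {e : E} (he : m e + m' e = 1) :
    linCov P a m m' = 0 := by
  have h0 : mom P a e (m e) * mom P a e (m' e) = 0 := by
    rcases Nat.eq_zero_or_pos (m e) with h | h
    · have : m' e = 1 := by omega
      rw [this, ha.mom_one, mul_zero]
    · have : m e = 1 := by omega
      rw [this, ha.mom_one, zero_mul]
  refine Finset.sum_eq_zero fun f _ => ?_
  by_cases hf : f = e
  · subst hf
    rw [h0, he, ha.mom_one, sub_zero, zero_mul]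
  · rw [Finset.prod_eq_zero (Finset.mem_erase.2 ⟨Ne.symm hf, Finset.mem_univ e⟩) h0, mul_zero]

theorem cov_eq_zero_of_add_eq_one {m m' : E → ℕ} {e : E} (he : m e + m' e = 1) :
    monomialMean P a (m + m') - monomialMean P a m * monomialMean P a m' = 0 := by
  have h0 : mom P a e (m e) * mom P a e (m' e) = 0 := by
    rcases Nat.eq_zero_or_pos (m e) with h | h
    · have : m' e = 1 := by omega
      rw [this, ha.mom_one, mul_zero]
    · have : m e = 1 := by omega
      rw [this, ha.mom_one, zero_mul]
  have h1 : monomialMean P a (m + m') = 0 :=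
    Finset.prod_eq_zero (Finset.mem_univ e) (by rw [Pi.add_apply, he, ha.mom_one])
  rw [h1, monomialMean, monomialMean, ← Finset.prod_mul_distrib,
    Finset.prod_eq_zero (Finset.mem_univ e) h0, sub_zero]

theorem mom_add_eq_mul {i j : ℕ} (h : i = 0 ∨ j = 0) (e : E) :
    mom P a e (i + j) = mom P a e i * mom P a e j := by
  rcases h with rfl | rfl <;> simp [ha.mom_zero]

theorem cov_eq_zero_of_disjoint {m m' : E → ℕ} (h : ∀ e, m e = 0 ∨ m' e = 0) :
    monomialMean P a (m + m') - monomialMean P a m * monomialMean P a m' = 0 := by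
  rw [monomialMean, monomialMean, monomialMean, ← Finset.prod_mul_distrib, sub_eq_zero]
  exact Finset.prod_congr rfl fun e _ => ha.mom_add_eq_mul (h e) e

theorem linCov_eq_zero_of_disjoint {m m' : E → ℕ} (h : ∀ e, m e = 0 ∨ m' e = 0) :
    linCov P a m m' = 0 :=
  Finset.sum_eq_zero fun e _ => by rw [ha.mom_add_eq_mul (h e), sub_self, zero_mul]

/-- If two monomials have just one variable in common, then their covariance equals the covariance
of their projections. -/
theorem linCov_eq_cov {m m' : E → ℕ} (e : E) (h : ∀ f, f ≠ e → m f = 0 ∨ m' f = 0) :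
    monomialMean P a (m + m') - monomialMean P a m * monomialMean P a m' = linCov P a m m' := by
  rw [linCov, Finset.sum_eq_single e]
  · rw [monomialMean_eq (m + m') e, monomialMean, monomialMean, ← Finset.prod_mul_distrib,
      ← Finset.mul_prod_erase _ _ (Finset.mem_univ e), sub_mul]
    congr 2
    exact Finset.prod_congr rfl fun f hf => ha.mom_add_eq_mul (h f (Finset.ne_of_mem_erase hf)) f
  · intro f _ hf
    rw [ha.mom_add_eq_mul (h f hf), sub_self, zero_mul]
  · simp

/-- The second moment of a sum of centered monomials, some of them reduced by their projections. -/
theorem integral_sq_sum {W : Type*} [Fintype W] (m : W → E → ℕ) (θ : W → ℝ) :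
    ∫ ω, (∑ w, (monomialCen P a (m w) ω - θ w * monomialLin P a (m w) ω)) ^ 2 ∂P =
      ∑ x : W × W, (monomialMean P a (m x.1 + m x.2) -
        monomialMean P a (m x.1) * monomialMean P a (m x.2) -
        (θ x.1 + θ x.2 - θ x.1 * θ x.2) * linCov P a (m x.1) (m x.2)) := by
  have hL : ∀ w, MemLp (fun ω => monomialCen P a (m w) ω - θ w * monomialLin P a (m w) ω) 2 P :=
    fun w => (ha.memLp_monomialCen (m w)).sub ((ha.memLp_monomialLin (m w)).const_mul _)
  simp only [sq, Finset.sum_mul_sum, ← Fintype.sum_prod_type']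
  rw [integral_finsetSum _ fun x _ => (hL x.1).integrable_fun_mul (hL x.2)]
  refine Finset.sum_congr rfl fun x _ => ?_
  -- All three products involving a projection integrate to the same `linCov`; this produces the
  -- combination `θ + θ' - θ * θ'`, which for indicators is the indicator that at least one of them
  -- is `1`.
  have hexp : ∀ ω, (monomialCen P a (m x.1) ω - θ x.1 * monomialLin P a (m x.1) ω) *
      (monomialCen P a (m x.2) ω - θ x.2 * monomialLin P a (m x.2) ω) =
      monomialCen P a (m x.1) ω * monomialCen P a (m x.2) ω -
        θ x.2 * (monomialCen P a (m x.1) ω * monomialLin P a (m x.2) ω) -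
        θ x.1 * (monomialLin P a (m x.1) ω * monomialCen P a (m x.2) ω) +
        θ x.1 * θ x.2 * (monomialLin P a (m x.1) ω * monomialLin P a (m x.2) ω) := fun ω => by ring
  have i1 := (ha.memLp_monomialCen (m x.1)).integrable_fun_mul (ha.memLp_monomialCen (m x.2))
  have i2 := ((ha.memLp_monomialCen (m x.1)).integrable_fun_mul
    (ha.memLp_monomialLin (m x.2))).const_mul (θ x.2)
  have i3 := ((ha.memLp_monomialLin (m x.1)).integrable_fun_mul
    (ha.memLp_monomialCen (m x.2))).const_mul (θ x.1)
  have i4 := ((ha.memLp_monomialLin (m x.1)).integrable_fun_mul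
    (ha.memLp_monomialLin (m x.2))).const_mul (θ x.1 * θ x.2)
  have i12 : Integrable (fun ω => monomialCen P a (m x.1) ω * monomialCen P a (m x.2) ω -
      θ x.2 * (monomialCen P a (m x.1) ω * monomialLin P a (m x.2) ω)) P := i1.sub i2
  have i123 : Integrable (fun ω => monomialCen P a (m x.1) ω * monomialCen P a (m x.2) ω -
      θ x.2 * (monomialCen P a (m x.1) ω * monomialLin P a (m x.2) ω) -
      θ x.1 * (monomialLin P a (m x.1) ω * monomialCen P a (m x.2) ω)) P := i12.sub i3
  simp only [hexp]
  rw [integral_add i123 i4, integral_sub i12 i3, integral_sub i1 i2,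
    integral_const_mul, integral_const_mul, integral_const_mul, ha.integral_cen_mul_cen,
    ha.integral_cen_mul_lin, ha.integral_lin_mul_cen, ha.integral_lin_mul_lin]
  ring

end IsSmallIndep

/-! ## Reduction of traces to sums over double walks -/

/-- The number of traversals of the edges by a closed walk. -/
def walkExp {V : Type*} [DecidableEq V] {k : ℕ} (w : ClosedWalk V k) (e : Sym2 V) : ℕ :=
  w.2.1.edges.count e

open Classical in
/-- The indicator of double walks. -/
def doubleInd {V : Type*} [DecidableEq V] {k : ℕ} (w : ClosedWalk V k) : ℝ :=
  if w.2.1.IsDouble then 1 else 0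

/-- Here `p * (N p)^{-k}` is the normalisation of a second moment, `(C p) ^ E` the size of a
covariance with `E` edges, and `N ^ v` the number of labellings. If `v ≤ E`, then `p ^ E * N ^ v ≤
(N p) ^ k` and the prefactor `p` survives. If `v = E + 1`, the prefactor completes `(N p) ^ (E + 1)
≤ (N p) ^ (k - 1)`, and `(N p)⁻¹` survives. -/
theorem pair_weight_le {N p C : ℝ} (hN : 1 ≤ N) (hp : 0 < p) (hC : 1 ≤ C) (hNp : 1 ≤ N * p)
    {k E v : ℕ} (hE : E ≤ k) (hv : v ≤ E ∨ v = E + 1 ∧ E + 2 ≤ k) :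
    p * ((N * p) ^ k)⁻¹ * (C * p) ^ E ≤ C ^ k * (p + (N * p)⁻¹) * (N⁻¹) ^ v := by
  have hN0 : 0 < N := by linarith
  have hD : 0 < N * p := by linarith
  have hCk : C ^ E ≤ C ^ k := pow_le_pow_right₀ hC hE
  have hC0 : 0 < C ^ k := by positivity
  rw [inv_pow, ← div_eq_mul_inv _ (N ^ v), le_div_iff₀ (by positivity), mul_pow C p]
  rcases hv with hv | ⟨rfl, hk⟩
  · have h1 : p ^ E * N ^ v ≤ (N * p) ^ k := by
      calc p ^ E * N ^ v ≤ p ^ E * N ^ E := by gcongr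
        _ = (N * p) ^ E := by rw [mul_pow, mul_comm]
        _ ≤ (N * p) ^ k := pow_le_pow_right₀ hNp hE
    have h2 : ((N * p) ^ k)⁻¹ * (p ^ E * N ^ v) ≤ 1 := by
      rw [inv_mul_le_iff₀ (by positivity), mul_one]; exact h1
    calc p * ((N * p) ^ k)⁻¹ * (C ^ E * p ^ E) * N ^ v
        = p * C ^ E * (((N * p) ^ k)⁻¹ * (p ^ E * N ^ v)) := by ring
      _ ≤ p * C ^ k * 1 := by gcongr
      _ ≤ C ^ k * (p + (N * p)⁻¹) := by
        rw [mul_one, mul_comm]; gcongr; exact le_add_of_nonneg_right (by positivity)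
  · have h1 : p * p ^ E * N ^ (E + 1) = (N * p) ^ (E + 1) := by rw [mul_pow]; ring
    have h2 : ((N * p) ^ k)⁻¹ * (N * p) ^ (E + 1) ≤ (N * p)⁻¹ := by
      rw [inv_mul_le_iff₀ (by positivity), ← div_eq_mul_inv, le_div_iff₀ hD, ← pow_succ]
      exact pow_le_pow_right₀ hNp hk
    calc p * ((N * p) ^ k)⁻¹ * (C ^ E * p ^ E) * N ^ (E + 1)
        = C ^ E * (((N * p) ^ k)⁻¹ * (p * p ^ E * N ^ (E + 1))) := by ring
      _ ≤ C ^ k * (N * p)⁻¹ := by rw [h1]; gcongr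
      _ ≤ C ^ k * (p + (N * p)⁻¹) := by gcongr; simp [hp.le]

namespace IsSmallIndep

open SimpleGraph.Walk

variable {Ω V : Type*} [MeasurableSpace Ω] {P : Measure Ω} [IsProbabilityMeasure P]
  [Fintype V] [DecidableEq V] {a : Sym2 V → Ω → ℝ} {p C : ℝ} (ha : IsSmallIndep P a (C * p))

include ha

/-- A nonzero term needs a shared edge and no edge used just once. With a single shared edge and a
double walk among the two, the covariance equals that of the projections and is subtracted off.
Every other pair either contains a cycle in its union or has at most `k - 2` edges, which are the
two cases of `pair_weight_le`. -/
theorem pair_term_le (hN : 1 ≤ Fintype.card V) (hp : 0 < p) (hC : 1 ≤ C)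
    (hNp : 1 ≤ Fintype.card V * p) {k : ℕ} (w w' : ClosedWalk V k) :
    p * ((Fintype.card V * p) ^ k)⁻¹ * (monomialMean P a (walkExp w + walkExp w') -
        monomialMean P a (walkExp w) * monomialMean P a (walkExp w') -
        (doubleInd w + doubleInd w' - doubleInd w * doubleInd w') *
          linCov P a (walkExp w) (walkExp w')) ≤
      (2 + 2 * k) * (C ^ k * (p + (Fintype.card V * p)⁻¹)) *
        ((Fintype.card V : ℝ)⁻¹) ^ (pairVerts w.2.1 w'.2.1).card := by
  have hN' : (1 : ℝ) ≤ Fintype.card V := by exact_mod_cast hN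
  have hD : 0 < (Fintype.card V : ℝ) * p := by linarith
  have hrhs : 0 ≤ (2 + 2 * k) * (C ^ k * (p + (Fintype.card V * p)⁻¹)) *
      ((Fintype.card V : ℝ)⁻¹) ^ (pairVerts w.2.1 w'.2.1).card := by positivity
  have hU : ∀ e, e ∈ pairEdges w.2.1 w'.2.1 ↔ walkExp w e + walkExp w' e ≠ 0 := fun e => by
    rw [pairEdges, Finset.mem_union, List.mem_toFinset, List.mem_toFinset, ← List.count_pos_iff,
      ← List.count_pos_iff, walkExp, walkExp]
    omega
  by_cases h1 : ∃ e, walkExp w e + walkExp w' e = 1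
  · obtain ⟨e, he⟩ := h1
    rw [ha.cov_eq_zero_of_add_eq_one he, ha.linCov_eq_zero_of_add_eq_one he]
    simpa using hrhs
  have h2 : ∀ e ∈ pairEdges w.2.1 w'.2.1, 2 ≤ pairCount w.2.1 w'.2.1 e := fun e he => by
    have h3 := (hU e).1 he
    have h4 : walkExp w e + walkExp w' e ≠ 1 := fun h => h1 ⟨e, h⟩
    unfold pairCount
    unfold walkExp at h3 h4
    omega
  have hshare : ∀ e, e ∉ sharedEdges w.2.1 w'.2.1 → walkExp w e = 0 ∨ walkExp w' e = 0 := by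
    intro e he
    rw [sharedEdges, Finset.mem_inter, List.mem_toFinset, List.mem_toFinset, ← List.count_pos_iff,
      ← List.count_pos_iff] at he
    unfold walkExp
    omega
  rcases (sharedEdges w.2.1 w'.2.1).eq_empty_or_nonempty with hs | hs
  · have h3 : ∀ e, walkExp w e = 0 ∨ walkExp w' e = 0 := fun e => hshare e (by simp [hs])
    rw [ha.cov_eq_zero_of_disjoint h3, ha.linCov_eq_zero_of_disjoint h3]
    simpa using hrhs
  have hθ : doubleInd w + doubleInd w' - doubleInd w * doubleInd w' = 1 ∨
      (doubleInd w + doubleInd w' - doubleInd w * doubleInd w' = 0 ∧ ¬ w.2.1.IsDouble) := by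
    unfold doubleInd; split_ifs <;> simp_all
  by_cases h5 : (sharedEdges w.2.1 w'.2.1).card = 1 ∧
      doubleInd w + doubleInd w' - doubleInd w * doubleInd w' = 1
  · obtain ⟨e, he⟩ := Finset.card_eq_one.1 h5.1
    rw [h5.2, ha.linCov_eq_cov e fun f hf => hshare f (by rw [he]; simpa using hf), one_mul, sub_self,
      mul_zero]
    exact hrhs
  have hlen := two_mul_card_pairEdges_le h2
  rw [w.2.2, w'.2.2] at hlen
  have hE : (pairEdges w.2.1 w'.2.1).card ≤ k := by omega
  have hv : (pairVerts w.2.1 w'.2.1).card ≤ (pairEdges w.2.1 w'.2.1).card ∨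
      (pairVerts w.2.1 w'.2.1).card = (pairEdges w.2.1 w'.2.1).card + 1 ∧
        (pairEdges w.2.1 w'.2.1).card + 2 ≤ k := by
    have hle := card_pairVerts_le hs
    rcases hle.lt_or_eq with hlt | heq
    · exact Or.inl (by omega)
    · right
      refine ⟨heq, ?_⟩
      have h6 := two_mul_card_add_le_of_pair hs h2 heq
      rw [w.2.2, w'.2.2] at h6
      have h7 := Finset.card_pos.2 hs
      -- One shared edge leaves at most `k - 1` edges, and equality would make both walks double, a
      -- case already removed. Two shared edges leave at most `k - 2` edges at once.
      by_cases h8 : (sharedEdges w.2.1 w'.2.1).card = 1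
      · have h9 : ¬ w.2.1.IsDouble := by
          rcases hθ with h | h
          exacts [(h5 ⟨h8, h⟩).elim, h.2]
        by_contra h10
        refine h9 (isDouble_of_pair h8 heq ?_).1
        rw [w.2.2, w'.2.2]
        omega
      · omega
  have habs := ha.abs_cov_sub_le (walkExp w) (walkExp w')
    (θ := doubleInd w + doubleInd w' - doubleInd w * doubleInd w')
    (by rcases hθ with h | h
        · rw [h, abs_one]
        · rw [h.1, abs_zero]; exact zero_le_one) _ hU
  have hbound := (le_abs_self _).trans habs
  calc _ ≤ p * ((Fintype.card V * p) ^ k)⁻¹ * ((2 + 2 * (pairEdges w.2.1 w'.2.1).card) *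
        (C * p) ^ (pairEdges w.2.1 w'.2.1).card) := by gcongr
    _ ≤ p * ((Fintype.card V * p) ^ k)⁻¹ * ((2 + 2 * k) *
        (C * p) ^ (pairEdges w.2.1 w'.2.1).card) := by gcongr
    _ = (2 + 2 * k) * (p * ((Fintype.card V * p) ^ k)⁻¹ *
        (C * p) ^ (pairEdges w.2.1 w'.2.1).card) := by ring
    _ ≤ (2 + 2 * k) * (C ^ k * (p + (Fintype.card V * p)⁻¹) *
        ((Fintype.card V : ℝ)⁻¹) ^ (pairVerts w.2.1 w'.2.1).card) := by
      refine mul_le_mul_of_nonneg_left ?_ (by positivity)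
      exact pair_weight_le hN' hp hC hNp hE hv
    _ = _ := by ring

/-- The centered sum over all closed walks is close in `L²` to the sum of the projections over the
double walks. -/
theorem integral_sq_trace_sub_le (hN : 1 ≤ Fintype.card V) (hp : 0 < p) (hC : 1 ≤ C)
    (hNp : 1 ≤ Fintype.card V * p) (k : ℕ) :
    p * ((Fintype.card V * p) ^ k)⁻¹ * ∫ ω, (∑ w : ClosedWalk V k,
        (monomialCen P a (walkExp w) ω - doubleInd w * monomialLin P a (walkExp w) ω)) ^ 2 ∂P ≤
      (2 + 2 * k) * (C ^ k * (p + (Fintype.card V * p)⁻¹)) *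
        ((2 * (k + 1) + 1) * (2 * (k + 1) : ℝ) ^ (2 * (k + 1))) := by
  rw [ha.integral_sq_sum, Finset.mul_sum]
  refine (Finset.sum_le_sum fun x _ => ha.pair_term_le hN hp hC hNp x.1 x.2).trans ?_
  rw [← Finset.mul_sum]
  have hD : 0 < (Fintype.card V : ℝ) * p := by linarith
  exact mul_le_mul_of_nonneg_left (sum_pair_inv_pow_le k) (by positivity)

end IsSmallIndep

/-! ## Characteristic functions of weighted sums of small independent variables -/

theorem norm_prod_sub_prod_le_sum {ι : Type*} (s : Finset ι) (z w : ι → ℂ) (hz : ∀ i, ‖z i‖ ≤ 1)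
    (hw : ∀ i, ‖w i‖ ≤ 1) : ‖∏ i ∈ s, z i - ∏ i ∈ s, w i‖ ≤ ∑ i ∈ s, ‖z i - w i‖ := by
  classical
  induction s using Finset.induction with
  | empty => simp
  | insert i s hi ih =>
    rw [Finset.prod_insert hi, Finset.prod_insert hi, Finset.sum_insert hi]
    have h : z i * ∏ j ∈ s, z j - w i * ∏ j ∈ s, w j =
        (z i - w i) * ∏ j ∈ s, z j + w i * (∏ j ∈ s, z j - ∏ j ∈ s, w j) := by ring
    rw [h]
    refine (norm_add_le _ _).trans (add_le_add ?_ ?_)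
    · rw [norm_mul, norm_prod]
      exact mul_le_of_le_one_right (norm_nonneg _)
        (Finset.prod_le_one (fun _ _ => norm_nonneg _) fun j _ => hz j)
    · rw [norm_mul]
      exact (mul_le_of_le_one_left (norm_nonneg _) (hw i)).trans ih

theorem norm_exp_mul_I_sub_le {x : ℝ} (hx : |x| ≤ 1) :
    ‖Complex.exp (x * Complex.I) - (1 + x * Complex.I - x ^ 2 / 2)‖ ≤ |x| ^ 3 := by
  have hn : ‖(x : ℂ) * Complex.I‖ = |x| := by simp
  have h := Complex.exp_bound (x := x * Complex.I) (by rw [hn]; exact hx) (n := 3) (by norm_num)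
  rw [hn] at h
  have h2 : ∑ m ∈ Finset.range 3, ((x : ℂ) * Complex.I) ^ m / (m.factorial : ℂ) =
      1 + x * Complex.I - x ^ 2 / 2 := by
    simp [Finset.sum_range_succ, mul_pow, Nat.factorial]; ring
  rw [h2] at h
  refine h.trans (mul_le_of_le_one_right (by positivity) ?_)
  norm_num [Nat.factorial]

section

variable {Ω : Type*} [MeasurableSpace Ω] {P : Measure Ω} [IsProbabilityMeasure P]

/-- Both exponentials are compared with `1 - b² v / 2`, where `v` is the variance. The linear Taylor
term drops out by centering, the cubic one is at most `δ` times the quadratic one, and the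
second-order error of the real exponential is of the same kind. An error proportional to the
variance can be summed over many variables. -/
theorem norm_integral_exp_sub_exp_le {ξ : Ω → ℝ} (hξ : Measurable ξ) (hb : ∀ᵐ ω ∂P, |ξ ω| ≤ 1)
    (hmean : ∫ ω, ξ ω ∂P = 0) {b δ : ℝ} (hbδ : |b| ≤ δ) (hδ : δ ≤ 1) :
    ‖∫ ω, Complex.exp ((b * ξ ω : ℝ) * Complex.I) ∂P -
        Complex.exp ((-(b ^ 2 * ∫ ω, ξ ω ^ 2 ∂P) / 2 : ℝ))‖ ≤
      2 * δ * (b ^ 2 * ∫ ω, ξ ω ^ 2 ∂P) := by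
  have i0 : Integrable ξ P := .of_bound hξ.aestronglyMeasurable 1 hb
  have hb2 : ∀ᵐ ω ∂P, ξ ω ^ 2 ≤ 1 := by
    filter_upwards [hb] with ω h
    rw [← sq_abs]; exact pow_le_one₀ (abs_nonneg _) h
  have i2 : Integrable (fun ω => ξ ω ^ 2) P := by
    refine .of_bound (hξ.pow_const 2).aestronglyMeasurable 1 ?_
    filter_upwards [hb2] with ω h
    rwa [Real.norm_eq_abs, abs_of_nonneg (sq_nonneg _)]
  set v := ∫ ω, ξ ω ^ 2 ∂P with hv
  have hv0 : 0 ≤ v := integral_nonneg fun ω => sq_nonneg _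
  have hv1 : v ≤ 1 := by
    have := integral_mono_ae i2 (integrable_const (1 : ℝ)) hb2
    simpa using this
  have hδ0 : 0 ≤ δ := (abs_nonneg b).trans hbδ
  have hb1 : b ^ 2 ≤ δ ^ 2 := by rw [← sq_abs b]; gcongr
  have hδ2 : δ ^ 2 ≤ δ := by nlinarith
  have hiexp : Integrable (fun ω => Complex.exp ((b * ξ ω : ℝ) * Complex.I)) P := by
    refine .of_bound (Measurable.aestronglyMeasurable (by fun_prop)) 1 (ae_of_all _ fun ω => ?_)
    rw [Complex.norm_exp_ofReal_mul_I]
  have hipoly : Integrable (fun ω => (1 : ℂ) + ((b * ξ ω : ℝ) : ℂ) * Complex.I -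
      ((b * ξ ω : ℝ) : ℂ) ^ 2 / 2) P := by
    refine ((integrable_const _).add ((i0.const_mul b).ofReal.mul_const _)).sub ?_
    have : Integrable (fun ω => ((b ^ 2 * ξ ω ^ 2 : ℝ) : ℂ) / 2) P :=
      (i2.const_mul (b ^ 2)).ofReal.div_const 2
    refine this.congr (ae_of_all _ fun ω => ?_)
    push_cast; ring
  have hpoly : ∫ ω, ((1 : ℂ) + ((b * ξ ω : ℝ) : ℂ) * Complex.I -
      ((b * ξ ω : ℝ) : ℂ) ^ 2 / 2) ∂P = ((1 - b ^ 2 * v / 2 : ℝ) : ℂ) := by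
    have e : ∀ ω, (1 : ℂ) + ((b * ξ ω : ℝ) : ℂ) * Complex.I - ((b * ξ ω : ℝ) : ℂ) ^ 2 / 2 =
        ((1 - b ^ 2 * ξ ω ^ 2 / 2 : ℝ) : ℂ) + ((b * ξ ω : ℝ) : ℂ) * Complex.I := fun ω => by
      push_cast; ring
    have i3 : Integrable (fun ω => 1 - b ^ 2 * ξ ω ^ 2 / 2) P :=
      (integrable_const _).sub ((i2.const_mul _).div_const _)
    simp only [e]
    rw [integral_add i3.ofReal ((i0.const_mul b).ofReal.mul_const _), integral_mul_const,
      integral_complex_ofReal, integral_complex_ofReal, integral_const_mul, hmean,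
      integral_sub (integrable_const _) ((i2.const_mul _).div_const _), integral_div,
      integral_const_mul, ← hv]
    simp
  have h1 : ‖∫ ω, Complex.exp ((b * ξ ω : ℝ) * Complex.I) ∂P - ((1 - b ^ 2 * v / 2 : ℝ) : ℂ)‖ ≤
      δ * (b ^ 2 * v) := by
    rw [← hpoly, ← integral_sub hiexp hipoly]
    have i4 : Integrable (fun ω => δ * (b ^ 2 * ξ ω ^ 2)) P := (i2.const_mul _).const_mul _
    refine (norm_integral_le_of_norm_le i4 ?_).trans_eq ?_
    · filter_upwards [hb] with ω h
      have hbx : |b * ξ ω| ≤ δ := by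
        rw [abs_mul]; exact (mul_le_of_le_one_right (abs_nonneg _) h).trans hbδ
      refine (norm_exp_mul_I_sub_le (hbx.trans hδ)).trans ?_
      rw [pow_succ', sq_abs, mul_pow]
      gcongr
    · rw [integral_const_mul, integral_const_mul]
  have h2 : ‖((1 - b ^ 2 * v / 2 : ℝ) : ℂ) - Complex.exp ((-(b ^ 2 * v) / 2 : ℝ))‖ ≤
      δ * (b ^ 2 * v) := by
    rw [← Complex.ofReal_exp, ← Complex.ofReal_sub, Complex.norm_real, Real.norm_eq_abs, abs_sub_comm]
    have hx0 : 0 ≤ b ^ 2 * v := by positivity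
    have hx1 : b ^ 2 * v ≤ δ := (mul_le_of_le_one_right (sq_nonneg _) hv1).trans (hb1.trans hδ2)
    have := Real.abs_exp_sub_one_sub_id_le (x := -(b ^ 2 * v) / 2) (by
      rw [abs_le]; constructor <;> linarith)
    have e : Real.exp (-(b ^ 2 * v) / 2) - 1 - -(b ^ 2 * v) / 2 =
        Real.exp (-(b ^ 2 * v) / 2) - (1 - b ^ 2 * v / 2) := by ring
    rw [e] at this
    refine this.trans ?_
    nlinarith
  refine (norm_sub_le_norm_sub_add_norm_sub _ ((1 - b ^ 2 * v / 2 : ℝ) : ℂ) _).trans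
    ((add_le_add h1 h2).trans_eq ?_)
  ring

/-- Independence factorises the characteristic function, and replacing the factors one at a time
adds up the individual errors. If the total variance stays bounded, only the maximal coefficient has
to tend to zero. -/
theorem norm_integral_exp_sum_sub_exp_le {E : Type*} [Fintype E] {ξ : E → Ω → ℝ}
    (hξ : ∀ e, Measurable (ξ e)) (hind : iIndepFun ξ P) (hb : ∀ e, ∀ᵐ ω ∂P, |ξ e ω| ≤ 1)
    (hmean : ∀ e, ∫ ω, ξ e ω ∂P = 0) {b : E → ℝ} {δ : ℝ} (hbδ : ∀ e, |b e| ≤ δ) (hδ : δ ≤ 1) :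
    ‖∫ ω, Complex.exp ((∑ e, b e * ξ e ω : ℝ) * Complex.I) ∂P -
        Complex.exp ((-(∑ e, b e ^ 2 * ∫ ω, ξ e ω ^ 2 ∂P) / 2 : ℝ))‖ ≤
      2 * δ * ∑ e, b e ^ 2 * ∫ ω, ξ e ω ^ 2 ∂P := by
  have h1 : ∫ ω, Complex.exp ((∑ e, b e * ξ e ω : ℝ) * Complex.I) ∂P =
      ∏ e, ∫ ω, Complex.exp ((b e * ξ e ω : ℝ) * Complex.I) ∂P := by
    rw [← hind.integral_fun_prod_comp (f := fun e x => Complex.exp ((b e * x : ℝ) * Complex.I))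
      (fun e => (hξ e).aemeasurable) fun e => Measurable.aestronglyMeasurable (by fun_prop)]
    refine integral_congr_ae (ae_of_all _ fun ω => ?_)
    simp only
    rw [← Complex.exp_sum, ← Finset.sum_mul]
    push_cast
    rfl
  have h2 : Complex.exp ((-(∑ e, b e ^ 2 * ∫ ω, ξ e ω ^ 2 ∂P) / 2 : ℝ)) =
      ∏ e, Complex.exp ((-(b e ^ 2 * ∫ ω, ξ e ω ^ 2 ∂P) / 2 : ℝ)) := by
    rw [← Complex.exp_sum]
    congr 1
    rw [← Finset.sum_neg_distrib, Finset.sum_div]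
    push_cast
    rfl
  rw [h1, h2, Finset.mul_sum]
  refine (norm_prod_sub_prod_le_sum _ _ _ (fun e => ?_) (fun e => ?_)).trans
    (Finset.sum_le_sum fun e _ => norm_integral_exp_sub_exp_le (hξ e) (hb e) (hmean e) (hbδ e) hδ)
  · refine (norm_integral_le_of_norm_le_const (C := 1) (ae_of_all _ fun ω => ?_)).trans_eq (by simp)
    rw [Complex.norm_exp_ofReal_mul_I]
  · rw [← Complex.ofReal_exp, Complex.norm_real, Real.norm_eq_abs, Real.abs_exp, Real.exp_le_one_iff]
    have : 0 ≤ ∫ ω, ξ e ω ^ 2 ∂P := integral_nonneg fun ω => sq_nonneg _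
    have : 0 ≤ b e ^ 2 * ∫ ω, ξ e ω ^ 2 ∂P := by positivity
    linarith

/-- Characteristic functions of variables close in `L²`. -/
theorem norm_integral_exp_sub_integral_exp_le {X Y : Ω → ℝ} (hX : MemLp X 2 P) (hY : MemLp Y 2 P) :
    ‖∫ ω, Complex.exp (X ω * Complex.I) ∂P - ∫ ω, Complex.exp (Y ω * Complex.I) ∂P‖ ≤
      √(∫ ω, (X ω - Y ω) ^ 2 ∂P) := by
  have hi : ∀ {Z : Ω → ℝ}, MemLp Z 2 P → Integrable (fun ω => Complex.exp (Z ω * Complex.I)) P := by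
    intro Z hZ
    refine .of_bound ?_ 1 (ae_of_all _ fun ω => ?_)
    · exact Complex.continuous_exp.comp_aestronglyMeasurable
        ((Complex.continuous_ofReal.comp_aestronglyMeasurable hZ.1).mul_const _)
    · rw [Complex.norm_exp_ofReal_mul_I]
  have hXY : MemLp (fun ω => X ω - Y ω) 2 P := hX.sub hY
  have habs : MemLp (fun ω => |X ω - Y ω|) 2 P := hXY.abs
  rw [← integral_sub (hi hX) (hi hY)]
  have h1 : ‖∫ ω, (Complex.exp (X ω * Complex.I) - Complex.exp (Y ω * Complex.I)) ∂P‖ ≤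
      ∫ ω, |X ω - Y ω| ∂P := by
    refine norm_integral_le_of_norm_le (habs.integrable one_le_two) (ae_of_all _ fun ω => ?_)
    have e : Complex.exp (X ω * Complex.I) - Complex.exp (Y ω * Complex.I) =
        Complex.exp (Y ω * Complex.I) * (Complex.exp (Complex.I * ((X ω - Y ω : ℝ) : ℂ)) - 1) := by
      rw [mul_sub, ← Complex.exp_add, mul_one]
      congr 2
      push_cast; ring
    rw [e, norm_mul, Complex.norm_exp_ofReal_mul_I, one_mul]
    exact Real.norm_exp_I_mul_ofReal_sub_one_le
  refine h1.trans (Real.le_sqrt_of_sq_le ?_)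
  -- Nonnegativity of the variance of `|X - Y|` bounds its first moment by the root of its second.
  have hvar := variance_nonneg (fun ω => |X ω - Y ω|) P
  rw [variance_eq_sub habs] at hvar
  simp only [Pi.pow_apply, sq_abs] at hvar
  linarith

end

/-! ## Gaussian processes with given covariance -/

/-- Moore–Aronszajn: the vectors are the kernel functions in the reproducing kernel Hilbert space.
The scalar kernel is written as a kernel of operators on `ℝ`, the form in which `RKHS` takes it. -/
theorem exists_inner_eq {X : Type} (K : X → X → ℝ) (hsymm : ∀ i j, K i j = K j i)
    (hpos : ∀ (s : Finset X) (c : X → ℝ), 0 ≤ ∑ i ∈ s, ∑ j ∈ s, c i * c j * K i j) :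
    ∃ (H : Type) (_ : NormedAddCommGroup H) (_ : InnerProductSpace ℝ H) (v : X → H),
      ∀ i j, inner ℝ (v i) (v j) = K i j := by
  let M : Matrix X X (ℝ →L[ℝ] ℝ) := Matrix.of fun i j => K i j • ContinuousLinearMap.id ℝ ℝ
  have hM : M.PosSemidef := by
    have h := (RKHS.posSemidef_tfae (K := M)).out 0 2
    refine h.2 ⟨?_, fun c => ?_⟩
    · ext i j
      have h1 : ContinuousLinearMap.id ℝ ℝ = 1 := rfl
      simp [M, hsymm i j, Matrix.conjTranspose_apply, h1]
    · refine (hpos c.support c).trans_eq ?_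
      simp only [Finsupp.sum, M, Matrix.of_apply]
      simp only [RCLike.re_to_real]
      refine Finset.sum_congr rfl fun i _ => Finset.sum_congr rfl fun j _ => ?_
      simp [hsymm j i]
      ring
  have : Fact M.PosSemidef := ⟨hM⟩
  refine ⟨RKHS.OfKernel M, inferInstance, inferInstance, fun i => RKHS.kerFun (RKHS.OfKernel M) i 1,
    fun i j => ?_⟩
  rw [← RKHS.kernel_inner, RKHS.OfKernel.kernel_ofKernel]
  simp [M, hsymm j i]

/-- Triangular factorization of a positive semidefinite kernel on `ℕ`. -/
theorem exists_triangular_factor (K : ℕ → ℕ → ℝ) (hsymm : ∀ i j, K i j = K j i)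
    (hpos : ∀ (s : Finset ℕ) (c : ℕ → ℝ), 0 ≤ ∑ i ∈ s, ∑ j ∈ s, c i * c j * K i j) :
    ∃ d : ℕ → ℕ → ℝ, ∀ i j, ∑ l ∈ Finset.range (i + 1), ∑ m ∈ Finset.range (j + 1),
      (if l = m then d i l * d j m else 0) = K i j := by
  obtain ⟨H, _, _, v, hv⟩ := exists_inner_eq K hsymm hpos
  let g := InnerProductSpace.gramSchmidt ℝ v
  have hexp : ∀ i, ∃ c : ℕ → ℝ, v i = ∑ l ∈ Finset.range (i + 1), c l • g l := by
    intro i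
    refine ⟨fun l => if l = i then 1 else inner ℝ (g l) (v i) / ‖g l‖ ^ 2, ?_⟩
    rw [Finset.sum_range_succ]
    have h := InnerProductSpace.gramSchmidt_def'' ℝ v i
    rw [Nat.Iio_eq_range] at h
    simp only [if_true, one_smul]
    conv_lhs => rw [h]
    rw [add_comm]
    congr 1
    refine Finset.sum_congr rfl fun l hl => ?_
    rw [if_neg (Finset.mem_range.1 hl).ne]
    rfl
  choose c hc using hexp
  -- The Gram–Schmidt vectors are orthogonal but not normalised. Absorbing their norms into the
  -- coefficients avoids normalising them, so a degenerate kernel, for which some `g l` vanish,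
  -- needs no separate treatment.
  refine ⟨fun i l => c i l * ‖g l‖, fun i j => ?_⟩
  rw [← hv i j, hc i, hc j, sum_inner]
  refine Finset.sum_congr rfl fun l _ => ?_
  rw [inner_sum]
  refine Finset.sum_congr rfl fun m _ => ?_
  rw [real_inner_smul_left, real_inner_smul_right]
  split_ifs with h
  · subst h
    rw [real_inner_self_eq_norm_sq]
    ring
  · rw [InnerProductSpace.gramSchmidt_orthogonal ℝ v h, mul_zero, mul_zero]

/-- A positive semidefinite kernel on `ℕ` is the covariance of a centered Gaussian process. -/
theorem exists_isGaussianProcess (K : ℕ → ℕ → ℝ) (hsymm : ∀ i j, K i j = K j i)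
    (hpos : ∀ (s : Finset ℕ) (c : ℕ → ℝ), 0 ≤ ∑ i ∈ s, ∑ j ∈ s, c i * c j * K i j) :
    ∃ (Q : Measure (ℕ → ℝ)) (_ : IsProbabilityMeasure Q) (X : ℕ → (ℕ → ℝ) → ℝ),
      IsGaussianProcess X Q ∧ (∀ k, Measurable (X k)) ∧ (∀ k, ∫ ω, X k ω ∂Q = 0) ∧
        ∀ k h, cov[X k, X h; Q] = K k h := by
  obtain ⟨d, hd⟩ := exists_triangular_factor K hsymm hpos
  let Q : Measure (ℕ → ℝ) := Measure.infinitePi fun _ => gaussianReal 0 1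
  have hlaw : ∀ j, HasLaw (fun ω : ℕ → ℝ => ω j) (gaussianReal 0 1) Q := fun j =>
    (measurePreserving_eval_infinitePi (fun _ => gaussianReal 0 1) j).hasLaw
  have hind : iIndepFun (fun j (ω : ℕ → ℝ) => ω j) Q :=
    iIndepFun_infinitePi (X := fun _ x => x) fun _ => measurable_id
  have hG : ∀ j, HasGaussianLaw (fun ω : ℕ → ℝ => ω j) Q := fun j => (hlaw j).hasGaussianLaw
  have hZ : IsGaussianProcess (fun j (ω : ℕ → ℝ) => ω j) Q :=
    ⟨fun s => iIndepFun.hasGaussianLaw (X := fun (i : s) (ω : ℕ → ℝ) => ω i.1) (fun i => hG i.1) (hind.precomp Subtype.val_injective)⟩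
  have hL2 : ∀ j, MemLp (fun ω : ℕ → ℝ => ω j) 2 Q := fun j => (hG j).memLp_two
  have hcov : ∀ l m, cov[fun ω : ℕ → ℝ => ω l, fun ω => ω m; Q] = if l = m then 1 else 0 := by
    intro l m
    split_ifs with h
    · subst h
      rw [covariance_self (measurable_pi_apply l).aemeasurable, (hlaw l).variance_eq]
      simp
    · exact (hind.indepFun h).covariance_eq_zero (hL2 l) (hL2 m)
  -- Apply the triangular factor to a sequence of independent standard Gaussians; each coordinate is
  -- a finite sum.
  refine ⟨Q, inferInstance, fun k ω => ∑ l ∈ Finset.range (k + 1), d k l * ω l, ?_, ?_, ?_, ?_⟩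
  · refine hZ.of_isGaussianProcess fun k => ⟨Finset.range (k + 1),
      ∑ l : Finset.range (k + 1), d k l • ContinuousLinearMap.proj l, fun ω => ?_⟩
    simp only [_root_.sum_apply, _root_.smul_apply,
      ContinuousLinearMap.proj_apply, Finset.restrict, smul_eq_mul]
    exact (Finset.sum_coe_sort (Finset.range (k + 1)) fun l => d k l * ω l).symm
  · intro k
    fun_prop
  · intro k
    rw [integral_finsetSum _ fun l _ => ((hL2 l).integrable one_le_two).const_mul _]
    refine Finset.sum_eq_zero fun l _ => ?_
    rw [integral_const_mul, (hlaw l).integral_eq, integral_id_gaussianReal, mul_zero]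
  · intro k h
    rw [← hd k h, covariance_fun_sum_fun_sum' (fun l _ => (hL2 l).const_mul _)
      fun m _ => (hL2 m).const_mul _]
    refine Finset.sum_congr rfl fun l _ => Finset.sum_congr rfl fun m _ => ?_
    rw [covariance_const_mul_left, covariance_const_mul_right, hcov]
    split_ifs <;> ring

/-! ## The centered entries of an inhomogeneous random graph -/

/-- A constant variable either misses its set, so that both sides are zero, or imposes no condition.
This adds the zero diagonal to the independent entries, so that all unordered pairs can serve as
indices. -/
theorem ProbabilityTheory.iIndepFun.of_restrict {Ω E : Type*} [MeasurableSpace Ω] {P : Measure Ω}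
    [IsProbabilityMeasure P] {f : E → Ω → ℝ} {q : E → Prop} {c : ℝ}
    (h : iIndepFun (fun (e : {e // q e}) => f e) P) (hc : ∀ e, ¬ q e → ∀ ω, f e ω = c) :
    iIndepFun f P := by
  classical
  rw [iIndepFun_iff_measure_inter_preimage_eq_mul]
  intro S sets H
  by_cases hS : ∃ e ∈ S, ¬ q e ∧ c ∉ sets e
  · obtain ⟨e, he, hq, hce⟩ := hS
    have h0 : f e ⁻¹' sets e = ∅ := by
      ext ω; simp [hc e hq ω, hce]
    rw [Finset.prod_eq_zero he (by rw [h0, measure_empty])]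
    exact measure_mono_null ((Set.biInter_subset_of_mem he).trans h0.subset) measure_empty
  · push Not at hS
    have huniv : ∀ e ∈ S, ¬ q e → f e ⁻¹' sets e = Set.univ := fun e he hq => by
      ext ω; simp [hc e hq ω, hS e he hq]
    have h1 := h.measure_inter_preimage_eq_mul (S.subtype q) (sets := fun e => sets e)
      fun e he => H e (Finset.mem_subtype.1 he)
    rw [Finset.prod_subtype_eq_prod_filter (s := S) (p := q) fun e => P (f e ⁻¹' sets e)] at h1
    rw [← Finset.prod_filter_mul_prod_filter_not S q, ← h1,
      Finset.prod_eq_one (s := S.filter fun e => ¬ q e), mul_one]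
    · congr 1
      ext ω
      simp only [Set.mem_iInter, Finset.mem_subtype, Subtype.forall]
      refine ⟨fun h e _ he => h e he, fun h e he => ?_⟩
      by_cases hq : q e
      · exact h e hq he
      · rw [huniv e he hq]; trivial
    · intro e he
      rw [Finset.mem_filter] at he
      rw [huniv e he.1 he.2, measure_univ]

/-- The centered entry of a random matrix, indexed by unordered pairs. -/
def edgeVar {Ω : Type*} [MeasurableSpace Ω] (P : Measure Ω) {n : ℕ}
    (A : Ω → Matrix (Fin n) (Fin n) ℝ) (e : Sym2 (Fin n)) (ω : Ω) : ℝ :=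
  centered P A ω e.inf e.sup

/-- The coefficient of the centered trace in the spectral statistic. -/
def statCoef (n : ℕ) (p : ℝ) (k : ℕ) : ℝ := √p * (√(n * p))⁻¹ ^ k

theorem statCoef_sq (n : ℕ) {p : ℝ} (hp : 0 ≤ p) (k : ℕ) :
    statCoef n p k ^ 2 = p * ((n * p) ^ k)⁻¹ := by
  rw [statCoef, mul_pow, Real.sq_sqrt hp, ← pow_mul, mul_comm k, pow_mul, inv_pow,
    Real.sq_sqrt (by positivity), inv_pow]

namespace IsInhomRandomGraph

variable {Ω : Type*} [MeasurableSpace Ω] {P : Measure Ω} [IsProbabilityMeasure P] {n : ℕ} {p : ℝ}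
  {S : Matrix (Fin n) (Fin n) ℝ} {A : Ω → Matrix (Fin n) (Fin n) ℝ}
  (hA : IsInhomRandomGraph P p S A)

include hA

omit [IsProbabilityMeasure P] in
theorem centered_diag (i : Fin n) (ω : Ω) : centered P A ω i i = 0 := by
  simp [centered, hA.diag]

omit [IsProbabilityMeasure P] in
theorem edgeVar_mk (i j : Fin n) (ω : Ω) : edgeVar P A s(i, j) ω = centered P A ω i j := by
  rcases le_total i j with h | h
  · simp [edgeVar, h]
  · have h1 : ∀ ω, A ω j i = A ω i j := fun ω => (hA.symm ω).apply i j
    simp [edgeVar, h, centered, h1]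

omit [IsProbabilityMeasure P] in
theorem measurable_edgeVar (e : Sym2 (Fin n)) : Measurable (edgeVar P A e) :=
  (hA.measurable _ _).sub_const _

theorem iIndepFun_edgeVar : iIndepFun (edgeVar P A) P := by
  have hlt : ∀ e : Sym2 (Fin n), ¬ e.IsDiag → e.inf < e.sup := by
    intro e he
    induction e with | _ i j => ?_
    rw [Sym2.mk_isDiag_iff] at he
    simpa [eq_comm] using he
  refine iIndepFun.of_restrict (q := fun e => ¬ e.IsDiag) (c := 0) ?_ ?_
  · let g : {e : Sym2 (Fin n) // ¬ e.IsDiag} → {e : Fin n × Fin n // e.1 < e.2} :=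
      fun e => ⟨(e.1.inf, e.1.sup), hlt e.1 e.2⟩
    have hg : g.Injective := by
      intro e e' h
      simp only [g, Subtype.mk.injEq, Prod.mk.injEq] at h
      exact Subtype.ext (Sym2.inf_eq_inf_and_sup_eq_sup.1 h)
    exact (hA.indep.precomp hg).comp
      (fun e x => x - ∫ ω, A ω e.1.inf e.1.sup ∂P) fun e => measurable_id.sub_const _
  · intro e he ω
    induction e with | _ i j => ?_
    rw [not_not, Sym2.mk_isDiag_iff] at he
    rw [hA.edgeVar_mk, he, hA.centered_diag]

omit [IsProbabilityMeasure P] in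
/-- The moments of the entries. -/
theorem integral_comp_edgeVar {i j : Fin n} (hij : i ≠ j) (f : ℝ → ℝ) (hf : Measurable f) :
    ∫ ω, f (edgeVar P A s(i, j) ω) ∂P =
      p * S i j * f (1 - p * S i j) + (1 - p * S i j) * f (-(p * S i j)) := by
  obtain ⟨q, hq, hlaw⟩ := hA.bernoulli i j hij
  have hm : ∫ ω, A ω i j ∂P = p * S i j := by
    rw [hlaw.integral_eq, integral_bernoulliMeasure, hq]; simp
  have h1 : ∀ ω, f (edgeVar P A s(i, j) ω) = ((fun x => f (x - p * S i j)) ∘ fun ω => A ω i j) ω := by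
    intro ω
    rw [hA.edgeVar_mk]
    simp [centered, hm]
  simp only [h1]
  rw [hlaw.integral_comp (Measurable.aestronglyMeasurable (by fun_prop)), integral_bernoulliMeasure, hq]
  simp

omit [IsProbabilityMeasure P] in
theorem abs_edgeVar_le (e : Sym2 (Fin n)) : ∀ᵐ ω ∂P, |edgeVar P A e ω| ≤ 1 := by
  induction e with | _ i j => ?_
  by_cases hij : i = j
  · simp [hA.edgeVar_mk, hij, hA.centered_diag]
  · obtain ⟨q, hq, hlaw⟩ := hA.bernoulli i j hij
    have hm : ∫ ω, A ω i j ∂P = q := by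
      rw [hlaw.integral_eq, integral_bernoulliMeasure]; simp
    have h2 : ∀ᵐ ω ∂P, |A ω i j - q| ≤ 1 := by
      have hmeas : Measurable fun x : ℝ => |x - q| ≤ 1 := by
        exact measurableSet_setOfPred.1 (measurableSet_le (by fun_prop) measurable_const)
      rw [hlaw.ae_iff hmeas, ae_iff]
      have h1 : |1 - (q : ℝ)| ≤ 1 := abs_le.2 ⟨by linarith [q.2.2], by linarith [q.2.1]⟩
      have h0 : |0 - (q : ℝ)| ≤ 1 := abs_le.2 ⟨by linarith [q.2.2], by linarith [q.2.1]⟩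
      exact bernoulliMeasure_apply_of_notMem_of_notMem q
        (measurableSet_setOfPred.2 hmeas).compl (fun h => h h1) fun h => h h0
    filter_upwards [h2] with ω h
    rw [hA.edgeVar_mk]
    simpa [centered, hm] using h

omit [IsProbabilityMeasure P] in
theorem mom_edgeVar {i j : Fin n} (hij : i ≠ j) (m : ℕ) :
    mom P (edgeVar P A) s(i, j) m =
      p * S i j * (1 - p * S i j) ^ m + (1 - p * S i j) * (-(p * S i j)) ^ m :=
  hA.integral_comp_edgeVar hij (fun x => x ^ m) (by fun_prop)

theorem isSmallIndep {C : ℝ} (hp : 0 ≤ p) (hS : ∀ i j, 0 ≤ S i j ∧ S i j ≤ C)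
    (hC : 0 ≤ C) : IsSmallIndep P (edgeVar P A) (C * p) where
  measurable := hA.measurable_edgeVar
  indep := hA.iIndepFun_edgeVar
  bdd := hA.abs_edgeVar_le
  mean e := by
    induction e with | _ i j => ?_
    by_cases hij : i = j
    · simp [hA.edgeVar_mk, hij, hA.centered_diag]
    · rw [hA.integral_comp_edgeVar hij (fun x => x) measurable_id]; ring
  sq_le e := by
    induction e with | _ i j => ?_
    by_cases hij : i = j
    · simp only [hA.edgeVar_mk, hij, hA.centered_diag]
      simp; positivity
    · rw [hA.integral_comp_edgeVar hij (fun x => x ^ 2) (by fun_prop)]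
      have h1 : p * S i j ≤ C * p := by nlinarith [hS i j]
      have h2 : 0 ≤ p * S i j := mul_nonneg hp (hS i j).1
      nlinarith
  nonneg := by positivity

omit [IsProbabilityMeasure P] in
theorem centeredTrace_eq (k : ℕ) (ω : Ω) :
    centeredTrace P p A k ω = (√(n * p))⁻¹ ^ k *
      ∑ w : ClosedWalk (Fin n) k, monomialVar (edgeVar P A) (walkExp w) ω := by
  rw [centeredTrace, smul_pow, Matrix.trace_smul, smul_eq_mul,
    SimpleGraph.trace_pow_eq_sum_closedWalk _ (fun e => edgeVar P A e ω)
      (fun i j _ => (hA.edgeVar_mk i j ω).symm) (fun i => hA.centered_diag i ω)]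
  rfl

theorem spectralStat_eq {q : ℝ} (ha : IsSmallIndep P (edgeVar P A) q) (k : ℕ) (ω : Ω) :
    spectralStat P p A k ω = statCoef n p k *
      ∑ w : ClosedWalk (Fin n) k, monomialCen P (edgeVar P A) (walkExp w) ω := by
  have h1 : ∫ ω, centeredTrace P p A k ω ∂P = (√(n * p))⁻¹ ^ k *
      ∑ w : ClosedWalk (Fin n) k, monomialMean P (edgeVar P A) (walkExp w) := by
    simp only [hA.centeredTrace_eq]
    rw [integral_const_mul, integral_finsetSum _ fun w _ =>
      (ha.memLp_monomialVar (walkExp w)).integrable one_le_two]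
    simp only [ha.integral_monomialVar]
  rw [spectralStat, h1, hA.centeredTrace_eq]
  simp only [monomialCen, Finset.sum_sub_distrib]
  rw [statCoef]
  ring

end IsInhomRandomGraph

/-! ## Linear statistics as sums over labelled planar trees -/

/-- The projection of a monomial in which distinct variables occur squared. -/
theorem monomialLin_of_injective {Ω E X : Type*} [MeasurableSpace Ω] {P : Measure Ω}
    [IsProbabilityMeasure P] [Fintype E] [DecidableEq E] [Fintype X] [DecidableEq X] {a : E → Ω → ℝ}
    {q : ℝ} (ha : IsSmallIndep P a q) {f : X → E} (hf : Function.Injective f) {m : E → ℕ}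
    (hm : ∀ e, m e = ∑ x, if f x = e then 2 else 0) (ω : Ω) :
    monomialLin P a m ω = ∑ x, (a (f x) ω ^ 2 - mom P a (f x) 2) *
      ∏ y ∈ Finset.univ.erase x, mom P a (f y) 2 := by
  have h2 : ∀ x, m (f x) = 2 := fun x => by
    rw [hm, Finset.sum_eq_single x] <;> simp [hf.eq_iff]
  have h0 : ∀ e, e ∉ Set.range f → m e = 0 := fun e he => by
    rw [hm]
    exact Finset.sum_eq_zero fun x _ => if_neg fun h => he ⟨x, h⟩
  rw [monomialLin, ← Finset.sum_subset (Finset.subset_univ (Finset.univ.map ⟨f, hf⟩))]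
  · rw [Finset.sum_map]
    refine Finset.sum_congr rfl fun x _ => ?_
    simp only [Function.Embedding.coeFn_mk, h2]
    congr 1
    rw [← Finset.prod_subset (s₁ := (Finset.univ.erase x).map ⟨f, hf⟩)]
    · rw [Finset.prod_map]
      simp [h2]
    · intro e he
      simp only [Finset.mem_map, Finset.mem_erase, Finset.mem_univ, and_true,
        Function.Embedding.coeFn_mk] at he ⊢
      obtain ⟨y, hy, rfl⟩ := he
      exact fun h => hy (hf h)
    · intro e he he'
      rw [h0, ha.mom_zero]
      rintro ⟨y, rfl⟩
      refine he' (Finset.mem_map.2 ⟨y, ?_, rfl⟩)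
      simp only [Finset.mem_erase, Finset.mem_univ, and_true] at he ⊢
      exact fun h => he (h ▸ rfl)
  · intro e _ he
    rw [h0 e, pow_zero, ha.mom_zero, sub_self, zero_mul]
    rintro ⟨x, rfl⟩
    exact he (Finset.mem_map.2 ⟨x, Finset.mem_univ _, rfl⟩)

/-- The number of labellings with prescribed labels of two vertices. -/
theorem card_map_pair_eq_le {X V : Type*} [Fintype X] [DecidableEq X] [Fintype V] [DecidableEq V]
    {u v : X} (huv : u ≠ v) (e : Sym2 V) :
    (Finset.univ.filter fun Φ : X → V => s(Φ u, Φ v) = e).card ≤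
      2 * Fintype.card V ^ (Fintype.card X - 2) := by
  induction e with | _ a b => ?_
  have hcard : Fintype.card {x // x ≠ u ∧ x ≠ v} = Fintype.card X - 2 := by
    rw [Fintype.card_subtype]
    have : (Finset.univ.filter fun x => x ≠ u ∧ x ≠ v) = Finset.univ \ {u, v} := by
      ext x; simp
    rw [this, Finset.card_sdiff_of_subset (Finset.subset_univ _), Finset.card_pair huv,
      Finset.card_univ]
  have h1 : Fintype.card (Bool × ({x // x ≠ u ∧ x ≠ v} → V)) =
      2 * Fintype.card V ^ (Fintype.card X - 2) := by
    rw [Fintype.card_prod, Fintype.card_bool, Fintype.card_fun, hcard]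
  rw [← h1, ← Finset.card_univ]
  -- Such a labelling is determined by which endpoint of `e` is the label of `u`, together with the
  -- labels of the remaining vertices.
  refine Finset.card_le_card_of_injOn (fun Φ => (decide (Φ u = a), fun x => Φ x)) (by simp) ?_
  intro Φ hΦ Ψ hΨ h
  simp only [Finset.coe_filter, Finset.mem_univ, true_and, Set.mem_ofPred_eq, Sym2.eq_iff] at hΦ hΨ
  simp only [Prod.mk.injEq, decide_eq_decide] at h
  have huv' : Φ u = Ψ u ∧ Φ v = Ψ v := by
    by_cases hu : Φ u = a
    · have := h.1.1 hu
      rcases hΦ with h1 | h1 <;> rcases hΨ with h2 | h2 <;> grind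
    · have : ¬ Ψ u = a := fun h' => hu (h.1.2 h')
      rcases hΦ with h1 | h1 <;> rcases hΨ with h2 | h2 <;> grind
  funext x
  by_cases hu : x = u
  · rw [hu, huv'.1]
  by_cases hv : x = v
  · rw [hv, huv'.2]
  exact congrFun h.2 ⟨x, hu, hv⟩

/-- The number of labellings that are not injective. -/
theorem card_not_injective_le (X V : Type*) [Fintype X] [Fintype V] [DecidableEq X]
    [DecidableEq V] :
    (Finset.univ.filter fun Φ : X → V => ¬ Function.Injective Φ).card ≤
      Fintype.card X ^ 2 * Fintype.card V ^ (Fintype.card X - 1) := by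
  have hsub : (Finset.univ.filter fun Φ : X → V => ¬ Function.Injective Φ) ⊆
      (Finset.univ.filter fun x : X × X => x.1 ≠ x.2).biUnion
        fun x => Finset.univ.filter fun Φ : X → V => Φ x.1 = Φ x.2 := by
    intro Φ hΦ
    simp only [Finset.mem_filter, Finset.mem_univ, true_and, Function.Injective, not_forall] at hΦ
    obtain ⟨u, v, h, huv⟩ := hΦ
    simp only [Finset.mem_biUnion, Finset.mem_filter, Finset.mem_univ, true_and]
    exact ⟨(u, v), huv, h⟩
  have h1 : ∀ x ∈ Finset.univ.filter fun x : X × X => x.1 ≠ x.2,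
      (Finset.univ.filter fun Φ : X → V => Φ x.1 = Φ x.2).card ≤
        Fintype.card V ^ (Fintype.card X - 1) := by
    rintro ⟨u, v⟩ hx
    simp only [Finset.mem_filter, Finset.mem_univ, true_and] at hx
    have hcard : Fintype.card ({x // x ≠ u} → V) = Fintype.card V ^ (Fintype.card X - 1) := by
      rw [Fintype.card_fun, Fintype.card_subtype_compl, Fintype.card_subtype_eq]
    rw [← hcard, ← Finset.card_univ]
    -- The label of `u` repeats that of `v`, so the labels away from `u` determine everything.
    refine Finset.card_le_card_of_injOn (fun Φ x => Φ x) (by simp) ?_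
    intro Φ hΦ Ψ hΨ h
    simp only [Finset.coe_filter, Finset.mem_univ, true_and, Set.mem_ofPred_eq] at hΦ hΨ
    have hne : ∀ x, x ≠ u → Φ x = Ψ x := fun x hx => congrFun h ⟨x, hx⟩
    funext x
    by_cases hxu : x = u
    · rw [hxu, hΦ, hΨ, hne v hx.symm]
    · exact hne x hxu
  refine (Finset.card_le_card hsub).trans (Finset.card_biUnion_le.trans
    ((Finset.sum_le_sum h1).trans ?_))
  rw [Finset.sum_const, smul_eq_mul]
  refine Nat.mul_le_mul_right _ ((Finset.card_le_univ _).trans ?_)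
  rw [Fintype.card_prod, sq]

/-! ### The projected trace as a linear form in centered squares -/

section

variable {Ω V : Type*} [MeasurableSpace Ω] (P : Measure Ω) [Fintype V] [DecidableEq V]
  (a : Sym2 V → Ω → ℝ)

open Classical in
/-- The weight of an edge of a labelled tree: the product of the second moments of the other
edges. -/
def treeWeight {T : PlanarTree} (φ : T.Vertex → V) (ε : T.Edge) : ℝ :=
  ∏ ε' ∈ Finset.univ.erase ε, mom P a ((T.ends ε').map φ) 2

open Classical in
/-- The coefficient of a squared variable in the projection of the trace of a power. -/
def linCoef (k : ℕ) (e : Sym2 V) : ℝ :=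
  if Even k then ∑ T : PlanarTree.OfSize (k / 2), ∑ φ : T.1.Vertex ↪ V, ∑ ε : T.1.Edge,
    if (T.1.ends ε).map φ = e then treeWeight P a φ ε else 0
  else 0

variable {P a} in
-- Double walks are labelled trees, and the projection of such a monomial is a sum over tree edges.
-- Collecting the terms by the pair `e` under the tree edge gives the coefficients. For odd `k`
-- there are no double walks.
theorem sum_doubleInd_mul_monomialLin [IsProbabilityMeasure P] {q : ℝ} (ha : IsSmallIndep P a q)
    (k : ℕ) (ω : Ω) :
    ∑ w : ClosedWalk V k, doubleInd w * monomialLin P a (walkExp w) ω =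
      ∑ e, linCoef P a k e * (a e ω ^ 2 - mom P a e 2) := by
  classical
  by_cases hk : Even k
  · have h1 : ∑ w : ClosedWalk V k, doubleInd w * monomialLin P a (walkExp w) ω =
        ∑ w : {w : ClosedWalk V k // w.2.1.IsDouble}, monomialLin P a (walkExp w.1) ω := by
      simp only [doubleInd, ite_mul, one_mul, zero_mul]
      rw [← Finset.sum_filter]
      exact (Finset.sum_subtype _ (by simp) _)
    rw [h1, ← (PlanarTree.toDouble_bijective hk).sum_comp, Fintype.sum_sigma]
    have h2 : ∀ (T : PlanarTree.OfSize (k / 2)) (φ : T.1.Vertex ↪ V),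
        monomialLin P a (walkExp (PlanarTree.toDouble hk ⟨T, φ⟩).1) ω =
          ∑ ε, (a ((T.1.ends ε).map φ) ω ^ 2 - mom P a ((T.1.ends ε).map φ) 2) *
            treeWeight P a φ ε := by
      intro T φ
      exact monomialLin_of_injective ha (f := fun ε => (T.1.ends ε).map φ)
        ((Sym2.map.injective φ.injective).comp T.1.ends_injective)
        (fun e => T.1.count_edges_contour φ φ.injective e) ω
    simp only [h2, linCoef, if_pos hk, Finset.sum_mul, ite_mul, zero_mul]
    conv_rhs => rw [Finset.sum_comm]
    refine Finset.sum_congr rfl fun T _ => ?_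
    conv_rhs => rw [Finset.sum_comm]
    refine Finset.sum_congr rfl fun φ _ => ?_
    conv_rhs => rw [Finset.sum_comm]
    refine Finset.sum_congr rfl fun ε _ => ?_
    rw [Finset.sum_ite_eq, if_pos (Finset.mem_univ _), mul_comm]
  · simp only [linCoef, if_neg hk, zero_mul, Finset.sum_const_zero]
    refine Finset.sum_eq_zero fun w _ => ?_
    rw [doubleInd, if_neg, zero_mul]
    intro h
    exact hk (w.2.2 ▸ h.even_length)

variable {P a} in
-- Fixing the image of one edge leaves `k / 2 - 1` free vertices, each with at most `card V` labels,
-- and `k / 2 - 1` further edges, each weighing at most `q`. The factor `2` is the orientation of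
-- the fixed edge.
theorem abs_linCoef_le [IsProbabilityMeasure P] {q : ℝ} (ha : IsSmallIndep P a q) (k : ℕ)
    (e : Sym2 V) :
    |linCoef P a k e| ≤ (∑ T : PlanarTree.OfSize (k / 2), (Fintype.card T.1.Edge : ℝ)) *
      (2 * (Fintype.card V * q) ^ (k / 2 - 1)) := by
  classical
  unfold linCoef
  split_ifs
  · rw [Finset.sum_mul]
    refine (Finset.abs_sum_le_sum_abs _ _).trans (Finset.sum_le_sum fun T _ => ?_)
    rw [Finset.sum_comm]
    refine (Finset.abs_sum_le_sum_abs _ _).trans ?_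
    rw [← nsmul_eq_mul, ← Finset.card_univ]
    refine Finset.sum_le_card_nsmul _ _ _ fun ε _ => ?_
    refine (Finset.abs_sum_le_sum_abs _ _).trans ?_
    have hcard : Fintype.card T.1.Vertex = k / 2 + 1 := by rw [T.1.card_vertex, T.2]
    have h1 : ∀ φ : T.1.Vertex ↪ V, |if (T.1.ends ε).map φ = e then treeWeight P a φ ε else 0| ≤
        if (T.1.ends ε).map φ = e then q ^ (k / 2 - 1) else 0 := by
      intro φ
      split_ifs
      · rw [treeWeight, Finset.abs_prod]
        refine (Finset.prod_le_prod (fun _ _ => abs_nonneg _)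
          fun ε' _ => ha.abs_mom_le two_ne_zero _).trans ?_
        rw [Finset.prod_const, Finset.card_erase_of_mem (Finset.mem_univ _), Finset.card_univ,
          T.1.card_edge, T.2]
      · rw [abs_zero]
    refine (Finset.sum_le_sum fun φ _ => h1 φ).trans ?_
    rw [← Finset.sum_filter, Finset.sum_const, nsmul_eq_mul, mul_pow, ← mul_assoc]
    refine mul_le_mul_of_nonneg_right ?_ (pow_nonneg ha.nonneg _)
    have h2 := card_map_pair_eq_le (V := V) (T.1.parent_ne_child ε) e
    rw [hcard, show k / 2 + 1 - 2 = k / 2 - 1 by omega] at h2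
    have h3 := (Nat.cast_le (α := ℝ)).2 h2
    rw [Nat.cast_mul, Nat.cast_pow, Nat.cast_ofNat] at h3
    refine le_trans (Nat.cast_le.2 ?_) h3
    rw [← Finset.card_map ⟨fun φ : T.1.Vertex ↪ V => (φ : T.1.Vertex → V), DFunLike.coe_injective⟩]
    refine Finset.card_le_card fun Φ hΦ => ?_
    simp only [Finset.mem_map, Finset.mem_filter, Finset.mem_univ, true_and] at hΦ ⊢
    obtain ⟨φ, hφ, rfl⟩ := hΦ
    exact hφ
  · rw [abs_zero]
    exact mul_nonneg (Finset.sum_nonneg fun _ _ => Nat.cast_nonneg _)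
      (mul_nonneg zero_le_two (pow_nonneg (mul_nonneg (Nat.cast_nonneg _) ha.nonneg) _))

end

/-! ## The underlying trees -/

namespace PlanarTree

theorem graph_adj_iff (T : PlanarTree) {u v : T.Vertex} :
    T.graph.Adj u v ↔ ∃ ε, T.ends ε = s(u, v) := by
  rw [graph, SimpleGraph.fromRel_adj]
  constructor
  · rintro ⟨_, ⟨ε, rfl, rfl⟩ | ⟨ε, rfl, rfl⟩⟩
    · exact ⟨ε, rfl⟩
    · exact ⟨ε, Sym2.eq_swap⟩
  · rintro ⟨ε, hε⟩
    rcases Sym2.eq_iff.1 hε with ⟨rfl, rfl⟩ | ⟨rfl, rfl⟩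
    · exact ⟨T.parent_ne_child ε, Or.inl ⟨ε, rfl, rfl⟩⟩
    · exact ⟨(T.parent_ne_child ε).symm, Or.inr ⟨ε, rfl, rfl⟩⟩

theorem graph_adj_of_ends {T T' : PlanarTree} {f : T.Vertex → T'.Vertex}
    (h : ∀ ε, ∃ ε', T'.ends ε' = (T.ends ε).map f) {u v : T.Vertex} (huv : T.graph.Adj u v) :
    T'.graph.Adj (f u) (f v) := by
  obtain ⟨ε, hε⟩ := T.graph_adj_iff.1 huv
  obtain ⟨ε', hε'⟩ := h ε
  exact T'.graph_adj_iff.2 ⟨ε', by rw [hε', hε, Sym2.map_mk]⟩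

theorem reachable_root : (T : PlanarTree) → (v : T.Vertex) → T.graph.Reachable T.root v
  | point, _ => SimpleGraph.Reachable.refl _
  | graft s r, v => by
    have hr : ∀ v, (graft s r).graph.Reachable (graft s r).root (inR s r v) := fun v =>
      (reachable_root r v).map
        ⟨inR s r, fun h => graph_adj_of_ends (f := inR s r)
          (fun ε => ⟨some (Sum.inr ε), ends_graft_inr s r ε⟩) h⟩
    refine vertex_cases (C := fun v => (graft s r).graph.Reachable (graft s r).root v)
      (fun v => ?_) hr v
    have h1 : (graft s r).graph.Reachable (inL s r s.root) (inL s r v) :=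
      (reachable_root s v).map
        ⟨inL s r, fun h => graph_adj_of_ends (f := inL s r)
          (fun ε => ⟨some (Sum.inl ε), ends_graft_inl s r ε⟩) h⟩
    have h2 : (graft s r).graph.Adj (inR s r r.root) (inL s r s.root) :=
      (graph_adj_iff _).2 ⟨none, ends_graft_none s r⟩
    exact (hr r.root).trans (h2.reachable.trans h1)

end PlanarTree

namespace JoinedTree

variable {k h : ℕ} (T : JoinedTree k h)

theorem ofLeft_injective : Function.Injective T.ofLeft := Sum.inl_injective

theorem ofRight_child :
    T.ofRight (T.right.child T.rightEdge) =
      T.ofLeft (if T.flip then T.left.parent T.leftEdge else T.left.child T.leftEdge) := by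
  exact dif_pos rfl

theorem ofRight_parent :
    T.ofRight (T.right.parent T.rightEdge) =
      T.ofLeft (if T.flip then T.left.child T.leftEdge else T.left.parent T.leftEdge) := by
  exact (dif_neg (T.right.parent_ne_child _)).trans (dif_pos rfl)

/-- The vertices of the second tree outside the first tree. -/
def ofRest (v : {v : T.right.Vertex //
    v ≠ T.right.child T.rightEdge ∧ v ≠ T.right.parent T.rightEdge}) : T.Vertex := Sum.inr v

theorem ofRight_of_ne {v : T.right.Vertex}
    (hv : v ≠ T.right.child T.rightEdge ∧ v ≠ T.right.parent T.rightEdge) :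
    T.ofRight v = T.ofRest ⟨v, hv⟩ :=
  (dif_neg hv.1).trans (dif_neg hv.2)

theorem ofRight_mem_range {v : T.right.Vertex} (hv : T.ofRight v ∈ Set.range T.ofLeft) :
    v = T.right.child T.rightEdge ∨ v = T.right.parent T.rightEdge := by
  by_contra hne
  push Not at hne
  rw [T.ofRight_of_ne hne] at hv
  obtain ⟨x, hx⟩ := hv
  exact Sum.inl_ne_inr hx

theorem map_ends_rightEdge :
    (T.right.ends T.rightEdge).map T.ofRight = (T.left.ends T.leftEdge).map T.ofLeft := by
  rw [PlanarTree.ends, PlanarTree.ends, Sym2.map_mk, Sym2.map_mk, ofRight_child, ofRight_parent]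
  split_ifs
  · exact Sym2.eq_swap
  · rfl

theorem ofRight_injective : Function.Injective T.ofRight := by
  have h1 : T.ofRight (T.right.child T.rightEdge) ≠ T.ofRight (T.right.parent T.rightEdge) := by
    rw [ofRight_child, ofRight_parent]
    intro h
    have h := T.ofLeft_injective h
    split_ifs at h
    · exact T.left.parent_ne_child _ h
    · exact T.left.parent_ne_child _ h.symm
  intro v w hvw
  by_cases hv : v = T.right.child T.rightEdge ∨ v = T.right.parent T.rightEdge
  · have hw : w = T.right.child T.rightEdge ∨ w = T.right.parent T.rightEdge := by
      refine T.ofRight_mem_range ?_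
      rw [← hvw]
      rcases hv with rfl | rfl
      · rw [ofRight_child]; exact ⟨_, rfl⟩
      · rw [ofRight_parent]; exact ⟨_, rfl⟩
    rcases hv with rfl | rfl <;> rcases hw with rfl | rfl
    · rfl
    · exact absurd hvw h1
    · exact absurd hvw.symm h1
    · rfl
  · have hw : ¬ (w = T.right.child T.rightEdge ∨ w = T.right.parent T.rightEdge) := by
      intro hw
      refine hv (T.ofRight_mem_range ?_)
      rw [hvw]
      rcases hw with rfl | rfl
      · rw [ofRight_child]; exact ⟨_, rfl⟩
      · rw [ofRight_parent]; exact ⟨_, rfl⟩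
    push Not at hv hw
    rw [T.ofRight_of_ne hv, T.ofRight_of_ne hw] at hvw
    exact congrArg Subtype.val (Sum.inr_injective hvw)

theorem vertex_cases {C : T.Vertex → Prop} (hl : ∀ v, C (T.ofLeft v)) (hr : ∀ v, C (T.ofRight v)) :
    ∀ v, C v
  | Sum.inl v => hl v
  | Sum.inr v => Eq.mp (congrArg C (T.ofRight_of_ne v.2)) (hr v.1)

/-- The edges of the joined tree. -/
abbrev Edge : Type := T.left.Edge ⊕ {ε : T.right.Edge // ε ≠ T.rightEdge}

/-- The endpoints of an edge. -/
def ends : T.Edge → Sym2 T.Vertex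
  | Sum.inl ε => (T.left.ends ε).map T.ofLeft
  | Sum.inr ε => (T.right.ends ε.1).map T.ofRight

/-- The images of the two trees meet only in the endpoints of the overlapping edge. An edge of the
second tree lying over one of the first would join these endpoints and so be the excluded edge
itself. -/
theorem ends_injective : Function.Injective T.ends := by
  have hlr : ∀ ε ε', T.ends (Sum.inl ε) ≠ T.ends (Sum.inr ε') := by
    intro ε ε' h
    have hmem : ∀ v ∈ T.right.ends ε'.1,
        v = T.right.child T.rightEdge ∨ v = T.right.parent T.rightEdge := by
      intro v hv
      refine T.ofRight_mem_range ?_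
      have h1 : T.ofRight v ∈ T.ends (Sum.inr ε') := Sym2.mem_map.2 ⟨v, hv, rfl⟩
      rw [← h] at h1
      obtain ⟨u, _, hu⟩ := Sym2.mem_map.1 h1
      exact ⟨u, hu⟩
    refine ε'.2 (T.right.ends_injective ?_)
    have h1 := hmem _ (Sym2.mem_mk_left _ _)
    have h2 := hmem _ (Sym2.mem_mk_right _ _)
    have h3 := T.right.parent_ne_child ε'.1
    rw [PlanarTree.ends, PlanarTree.ends, Sym2.eq_iff]
    rcases h1 with h1 | h1 <;> rcases h2 with h2 | h2
    · exact absurd (h1.trans h2.symm) h3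
    · exact Or.inr ⟨h1, h2⟩
    · exact Or.inl ⟨h1, h2⟩
    · exact absurd (h1.trans h2.symm) h3
  rintro (ε | ε) (ε' | ε') h
  · exact congrArg Sum.inl (T.left.ends_injective (Sym2.map.injective T.ofLeft_injective h))
  · exact absurd h (hlr _ _)
  · exact absurd h.symm (hlr _ _)
  · exact congrArg Sum.inr
      (Subtype.ext (T.right.ends_injective (Sym2.map.injective T.ofRight_injective h)))

theorem map_adj_iff (G : PlanarTree) {W : Type*} {f : G.Vertex → W} (hf : Function.Injective f)
    {u v : W} : (G.graph.map f).Adj u v ↔ ∃ ε, (G.ends ε).map f = s(u, v) := by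
  have h1 : (G.graph.map f).Adj u v ↔ ∃ u' v', G.graph.Adj u' v' ∧ f u' = u ∧ f v' = v :=
    SimpleGraph.map_adj ⟨f, hf⟩ G.graph u v
  rw [h1]
  constructor
  · rintro ⟨u', v', h, rfl, rfl⟩
    obtain ⟨ε, hε⟩ := G.graph_adj_iff.1 h
    exact ⟨ε, by rw [hε, Sym2.map_mk]⟩
  · rintro ⟨ε, hε⟩
    rw [PlanarTree.ends, Sym2.map_mk] at hε
    rcases Sym2.eq_iff.1 hε with ⟨rfl, rfl⟩ | ⟨rfl, rfl⟩
    · exact ⟨_, _, G.graph_adj_iff.2 ⟨ε, rfl⟩, rfl, rfl⟩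
    · exact ⟨_, _, G.graph_adj_iff.2 ⟨ε, Sym2.eq_swap⟩, rfl, rfl⟩

theorem mem_edgeSet_iff {e : Sym2 T.Vertex} : e ∈ T.graph.edgeSet ↔ ∃ j, T.ends j = e := by
  induction e with | _ u v => ?_
  rw [SimpleGraph.mem_edgeSet, graph, SimpleGraph.sup_adj, map_adj_iff _ T.ofLeft_injective,
    map_adj_iff _ T.ofRight_injective]
  constructor
  · rintro (⟨ε, hε⟩ | ⟨ε, hε⟩)
    · exact ⟨Sum.inl ε, hε⟩
    · by_cases h : ε = T.rightEdge
      · refine ⟨Sum.inl T.leftEdge, ?_⟩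
        rw [← hε, h, map_ends_rightEdge]
        rfl
      · exact ⟨Sum.inr ⟨ε, h⟩, hε⟩
  · rintro ⟨ε | ε, hε⟩
    · exact Or.inl ⟨ε, hε⟩
    · exact Or.inr ⟨ε.1, hε⟩

theorem card_edge_left : Fintype.card T.left.Edge = k / 2 := by
  rw [T.left.card_edge]; exact T.1.2

theorem card_edge_right : Fintype.card T.right.Edge = h / 2 := by
  rw [T.right.card_edge]; exact T.2.1.2

open Classical in
theorem card_edge : Fintype.card T.Edge = k / 2 + (h / 2 - 1) := by
  rw [Fintype.card_sum, card_edge_left, Fintype.card_subtype_compl, Fintype.card_subtype_eq,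
    card_edge_right]

include T in
-- Makes the truncated `h / 2 - 1` a true difference in the edge count.
theorem right_pos : 1 ≤ h / 2 := by
  rw [← T.card_edge_right]
  exact Fintype.card_pos_iff.2 ⟨T.rightEdge⟩

theorem card_vertex : Fintype.card T.Vertex = k / 2 + h / 2 := by
  classical
  have h1 : Fintype.card T.Vertex = Fintype.card (T.left.Vertex ⊕
      {v : T.right.Vertex // v ≠ T.right.child T.rightEdge ∧ v ≠ T.right.parent T.rightEdge}) :=
    Fintype.card_congr (Equiv.refl _)
  have h2 : Fintype.card {v : T.right.Vertex //
      v ≠ T.right.child T.rightEdge ∧ v ≠ T.right.parent T.rightEdge} =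
      Fintype.card T.right.Vertex - 2 := by
    rw [Fintype.card_subtype]
    have : (Finset.univ.filter fun x =>
        x ≠ T.right.child T.rightEdge ∧ x ≠ T.right.parent T.rightEdge) =
        Finset.univ \ {T.right.child T.rightEdge, T.right.parent T.rightEdge} := by
      ext x; simp
    rw [this, Finset.card_sdiff_of_subset (Finset.subset_univ _),
      Finset.card_pair (T.right.parent_ne_child _).symm, Finset.card_univ]
  have h3 : T.right.numEdges = h / 2 := T.2.1.2
  have h4 : T.left.numEdges = k / 2 := T.1.2
  have h5 := T.right_pos
  rw [h1, Fintype.card_sum, h2, T.left.card_vertex, T.right.card_vertex, h3, h4]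
  omega

theorem connected_graph : T.graph.Connected := by
  have hl : ∀ u v, T.left.graph.Reachable u v → T.graph.Reachable (T.ofLeft u) (T.ofLeft v) :=
    fun u v huv => huv.map ⟨T.ofLeft, fun {a b} hab => by
      obtain ⟨ε, hε⟩ := T.left.graph_adj_iff.1 hab
      refine Or.inl ((map_adj_iff _ T.ofLeft_injective).2 ⟨ε, ?_⟩)
      rw [hε, Sym2.map_mk]⟩
  have hr : ∀ u v, T.right.graph.Reachable u v → T.graph.Reachable (T.ofRight u) (T.ofRight v) :=
    fun u v huv => huv.map ⟨T.ofRight, fun {a b} hab => by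
      obtain ⟨ε, hε⟩ := T.right.graph_adj_iff.1 hab
      refine Or.inr ((map_adj_iff _ T.ofRight_injective).2 ⟨ε, ?_⟩)
      rw [hε, Sym2.map_mk]⟩
  rw [SimpleGraph.connected_iff_exists_forall_reachable]
  have hl' : ∀ u v, T.left.graph.Reachable u v := fun u v =>
    (T.left.reachable_root u).symm.trans (T.left.reachable_root v)
  refine ⟨T.ofLeft T.left.root, T.vertex_cases (fun v => hl _ _ (hl' _ _)) fun v => ?_⟩
  refine (hl _ _ (hl' _ _)).trans (T.ofRight_child ▸ hr _ v
    ((T.right.reachable_root _).symm.trans (T.right.reachable_root v)))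

theorem isTree_graph : T.graph.IsTree := by
  classical
  rw [SimpleGraph.isTree_iff_connected_and_card]
  refine ⟨T.connected_graph, ?_⟩
  have h1 : T.graph.edgeSet = Set.range T.ends := by
    ext e; exact T.mem_edgeSet_iff
  have h2 := T.right_pos
  rw [h1, ← Nat.card_congr (Equiv.ofInjective _ T.ends_injective), Nat.card_eq_fintype_card,
    Nat.card_eq_fintype_card, T.card_edge, T.card_vertex]
  omega

end JoinedTree

/-! ## Homomorphism densities in step graphons -/

/-- The entries of a symmetric matrix, as a function of unordered pairs. -/
def symEntry {n : ℕ} {S : Matrix (Fin n) (Fin n) ℝ} (hS : S.IsSymm) : Sym2 (Fin n) → ℝ :=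
  Sym2.lift ⟨fun i j => S i j, fun i j => hS.apply j i⟩

theorem volume_cell {n : ℕ} (hn : 0 < n) (i : Fin n) :
    volume (cell i) = ENNReal.ofReal (n : ℝ)⁻¹ := by
  have hn' : (0 : ℝ) < n := Nat.cast_pos.2 hn
  have h1 : ((↑) : I → ℝ) '' cell i = Set.Ico ((i : ℝ) / n) (((i : ℝ) + 1) / n) := by
    ext x
    simp only [cell, Set.mem_image, Set.mem_ofPred_eq, Set.mem_Ico]
    constructor
    · rintro ⟨y, hy, rfl⟩
      exact hy
    · rintro ⟨h1, h2⟩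
      refine ⟨⟨x, (div_nonneg (Nat.cast_nonneg _) hn'.le).trans h1, h2.le.trans ?_⟩, ⟨h1, h2⟩, rfl⟩
      rw [div_le_one hn']
      exact_mod_cast i.2
  rw [← volume_image_subtype_coe measurableSet_Icc, h1, Real.volume_Ico]
  congr 1
  ring

/-- The cell containing a point. -/
def cellIndex {n : ℕ} (hn : 0 < n) (x : I) : Fin n :=
  -- The minimum takes effect only at `x = 1`, which lies in no cell; being a null set, this point
  -- is discarded whenever indices are compared with cells.
  ⟨min ⌊(n : ℝ) * x⌋₊ (n - 1), by omega⟩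

theorem measurable_cellIndex {n : ℕ} (hn : 0 < n) : Measurable (cellIndex hn) := by
  refine measurable_to_countable' fun i => ?_
  have h1 : cellIndex hn ⁻¹' {i} = (fun x : I => min ⌊(n : ℝ) * x⌋₊ (n - 1)) ⁻¹' {(i : ℕ)} := by
    ext x; simp [cellIndex, Fin.ext_iff]
  rw [h1]
  have h2 : Measurable fun x : I => ⌊(n : ℝ) * x⌋₊ :=
    Nat.measurable_floor.comp (by fun_prop)
  exact (h2.min measurable_const) (measurableSet_singleton _)

theorem mem_cell_iff {n : ℕ} (hn : 0 < n) {x : I} (hx : x ≠ 1) (i : Fin n) :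
    x ∈ cell i ↔ cellIndex hn x = i := by
  have hn' : (0 : ℝ) < n := Nat.cast_pos.2 hn
  have hx1 : (x : ℝ) < 1 := lt_of_le_of_ne x.2.2 fun h => hx (Subtype.ext h)
  have hlt : ⌊(n : ℝ) * x⌋₊ < n := by
    rw [Nat.floor_lt (mul_nonneg hn'.le x.2.1)]
    nlinarith
  rw [Fin.ext_iff, cellIndex]
  simp only
  rw [min_eq_left (by omega), Nat.floor_eq_iff (mul_nonneg hn'.le x.2.1), cell, Set.mem_ofPred_eq,
    div_le_iff₀' hn', lt_div_iff₀' hn']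

theorem map_cellIndex {n : ℕ} (hn : 0 < n) (i : Fin n) :
    ((volume : Measure I).map (cellIndex hn)).real {i} = (n : ℝ)⁻¹ := by
  rw [map_measureReal_apply (measurable_cellIndex hn) (measurableSet_singleton i), measureReal_def]
  have h1 : (cellIndex hn ⁻¹' {i} : Set I) =ᵐ[volume] cell i := by
    have h0 : ∀ᵐ x : I, x ≠ 1 := compl_mem_ae_iff.2 (measure_singleton 1)
    filter_upwards [h0] with x hx
    exact propext (mem_cell_iff hn hx i).symm
  rw [measure_congr h1, volume_cell hn, ENNReal.toReal_ofReal (by positivity)]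

theorem stepGraphon_apply {n : ℕ} (hn : 0 < n) {S : Matrix (Fin n) (Fin n) ℝ} (hS : S.IsSymm)
    {x y : I} (hx : x ≠ 1) (hy : y ≠ 1) :
    (stepGraphon S hS).toFun x y = S (cellIndex hn x) (cellIndex hn y) := by
  simp only [stepGraphon, Set.indicator, Set.mem_prod, mem_cell_iff hn hx, mem_cell_iff hn hy]
  rw [Finset.sum_eq_single (cellIndex hn x), Finset.sum_eq_single (cellIndex hn y)]
  · simp
  · intro j _ hj; simp [hj.symm]
  · simp
  · intro i _ hi; simp [hi.symm]
  · simp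

/-- Integration of a function of the indices of the cells. -/
theorem integral_cellIndex {V : Type} [Fintype V] [DecidableEq V] {n : ℕ} (hn : 0 < n) (g : (V → Fin n) → ℝ) :
    ∫ x : V → I, g (fun v => cellIndex hn (x v)) = ((n : ℝ) ^ Fintype.card V)⁻¹ * ∑ Φ, g Φ := by
  have hprob : IsProbabilityMeasure ((volume : Measure I).map (cellIndex hn)) :=
    Measure.isProbabilityMeasure_map (measurable_cellIndex hn).aemeasurable
  have h1 : (volume : Measure (V → I)).map (fun x v => cellIndex hn (x v)) =
      Measure.pi fun _ : V => (volume : Measure I).map (cellIndex hn) :=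
    Measure.pi_map_pi fun _ => (measurable_cellIndex hn).aemeasurable
  have hmeas : Measurable fun (x : V → I) v => cellIndex hn (x v) :=
    measurable_pi_lambda _ fun v => (measurable_cellIndex hn).comp (measurable_pi_apply v)
  rw [← integral_map (μ := volume) hmeas.aemeasurable
    (measurable_of_countable g).aestronglyMeasurable, h1, integral_fintype (Integrable.of_finite)]
  rw [Finset.mul_sum]
  refine Finset.sum_congr rfl fun Φ _ => ?_
  rw [← Set.univ_pi_singleton, measureReal_def, Measure.pi_pi, ENNReal.toReal_prod]
  simp only [← measureReal_def, map_cellIndex hn]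
  rw [Finset.prod_const, Finset.card_univ, inv_pow, smul_eq_mul]

open Classical in
-- Almost surely the integrand depends only on the cell indices of the points, and these are
-- independent and uniform. The density is therefore an average over all labellings, injective or
-- not.
theorem homDensity_stepGraphon {V : Type} [Fintype V] (F : SimpleGraph V) {n : ℕ} (hn : 0 < n)
    {S : Matrix (Fin n) (Fin n) ℝ} (hS : S.IsSymm) :
    homDensity F (stepGraphon S hS) = ((n : ℝ) ^ Fintype.card V)⁻¹ *
      ∑ Φ : V → Fin n, ∏ e ∈ F.edgeFinset, symEntry hS (e.map Φ) := by
  rw [← integral_cellIndex hn, homDensity]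
  refine integral_congr_ae ?_
  have h0 : ∀ᵐ x : V → I, ∀ v, x v ≠ 1 := by
    refine ae_all_iff.2 fun v => ?_
    have h1 : ∀ᵐ x : I, x ≠ 1 := compl_mem_ae_iff.2 (measure_singleton 1)
    exact (measurePreserving_eval (fun _ : V => (volume : Measure I)) v).quasiMeasurePreserving.ae h1
  filter_upwards [h0] with x hx
  refine Finset.prod_congr rfl fun e _ => ?_
  induction e with | _ i j => ?_
  simp only [Sym2.lift_mk, symEntry, Sym2.map_mk]
  exact stepGraphon_apply hn hS (hx i) (hx j)

open Classical in
theorem JoinedTree.homDensity_stepGraphon {k h : ℕ} (T : JoinedTree k h) {n : ℕ} (hn : 0 < n)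
    {S : Matrix (Fin n) (Fin n) ℝ} (hS : S.IsSymm) :
    homDensity T.graph (stepGraphon S hS) = ((n : ℝ) ^ Fintype.card T.Vertex)⁻¹ *
      ∑ Φ : T.Vertex → Fin n, ∏ j : T.Edge, symEntry hS ((T.ends j).map Φ) := by
  rw [_root_.homDensity_stepGraphon _ hn]
  congr 1
  refine Finset.sum_congr rfl fun Φ _ => ?_
  refine (Finset.prod_bij (fun j _ => T.ends j) ?_ ?_ ?_ ?_).symm
  · intro j _
    rw [SimpleGraph.mem_edgeFinset, T.mem_edgeSet_iff]
    exact ⟨j, rfl⟩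
  · intro j _ j' _ h
    exact T.ends_injective h
  · intro e he
    rw [SimpleGraph.mem_edgeFinset, T.mem_edgeSet_iff] at he
    obtain ⟨j, hj⟩ := he
    exact ⟨j, Finset.mem_univ _, hj⟩
  · intro j _
    rfl

/-! ## Covariances of the linear statistics -/

/-- `B` is the common scale of the factors and `δ` an error relative to it. Keeping them apart
preserves the full power of `B`, here of order `p`, after exchanging the factors one at a time. -/
theorem abs_prod_sub_prod_le {ι : Type*} (s : Finset ι) {x y : ι → ℝ} {B δ : ℝ} (hB : 0 ≤ B)
    (hx : ∀ i, |x i| ≤ B) (hy : ∀ i, |y i| ≤ B) (hxy : ∀ i, |x i - y i| ≤ B * δ) :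
    |∏ i ∈ s, x i - ∏ i ∈ s, y i| ≤ s.card * (B ^ s.card * δ) := by
  classical
  induction s using Finset.induction with
  | empty => simp
  | insert i s hi ih =>
    rw [Finset.prod_insert hi, Finset.prod_insert hi, Finset.card_insert_of_notMem hi]
    have h : x i * ∏ j ∈ s, x j - y i * ∏ j ∈ s, y j =
        (x i - y i) * ∏ j ∈ s, x j + y i * (∏ j ∈ s, x j - ∏ j ∈ s, y j) := by ring
    have h1 : |∏ j ∈ s, x j| ≤ B ^ s.card := by
      rw [Finset.abs_prod, ← Finset.prod_const]
      exact Finset.prod_le_prod (fun _ _ => abs_nonneg _) fun j _ => hx j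
    have h0 : 0 ≤ B * δ := (abs_nonneg _).trans (hxy i)
    calc |x i * ∏ j ∈ s, x j - y i * ∏ j ∈ s, y j|
        ≤ |x i - y i| * |∏ j ∈ s, x j| + |y i| * |∏ j ∈ s, x j - ∏ j ∈ s, y j| := by
          rw [h, ← abs_mul, ← abs_mul]; exact abs_add_le _ _
      _ ≤ B * δ * B ^ s.card + B * (s.card * (B ^ s.card * δ)) :=
          add_le_add (mul_le_mul (hxy i) h1 (abs_nonneg _) h0)
            (mul_le_mul (hy i) ih (abs_nonneg _) hB)
      _ = _ := by push_cast; ring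

theorem sum_sum_mul_sum_mul {E X Y : Type*} [Fintype E] [Fintype X] [Fintype Y] (f : X → E → ℝ)
    (g : Y → E → ℝ) (v : E → ℝ) :
    ∑ e, (∑ x, f x e) * (∑ y, g y e) * v e = ∑ x, ∑ y, ∑ e, f x e * g y e * v e := by
  simp only [Finset.sum_mul_sum]
  simp only [Finset.sum_mul]
  rw [Finset.sum_comm]
  exact Finset.sum_congr rfl fun x _ => Finset.sum_comm

/-! ### Labellings of joined trees -/

namespace JoinedTree

theorem sum_eq {k h : ℕ} (f : JoinedTree k h → ℝ) :
    ∑ T, f T = ∑ T₁ : PlanarTree.OfSize (k / 2), ∑ T₂ : PlanarTree.OfSize (h / 2),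
      ∑ ε₁ : T₁.1.Edge, ∑ ε₂ : T₂.1.Edge, ∑ b : Bool, f ⟨T₁, T₂, ε₁, ε₂, b⟩ := by
  let g : (Σ (T₁ : PlanarTree.OfSize (k / 2)) (T₂ : PlanarTree.OfSize (h / 2)),
    T₁.1.Edge × T₂.1.Edge × Bool) → ℝ := f
  change ∑ x, g x = ∑ T₁ : PlanarTree.OfSize (k / 2), ∑ T₂ : PlanarTree.OfSize (h / 2),
      ∑ ε₁ : T₁.1.Edge, ∑ ε₂ : T₂.1.Edge, ∑ b : Bool, g ⟨T₁, T₂, ε₁, ε₂, b⟩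
  rw [Fintype.sum_sigma]
  refine Finset.sum_congr rfl fun T₁ _ => ?_
  rw [Fintype.sum_sigma]
  refine Finset.sum_congr rfl fun T₂ _ => ?_
  rw [Fintype.sum_prod_type]
  exact Finset.sum_congr rfl fun ε₁ _ => Fintype.sum_prod_type _

variable {k h : ℕ} (T : JoinedTree k h) {V : Type*}

/-- A labelling that is injective on the two trees. -/
def Good (Φ : T.Vertex → V) : Prop :=
  Function.Injective (Φ ∘ T.ofLeft) ∧ Function.Injective (Φ ∘ T.ofRight)

/-- Labellings of the two trees that agree on the overlapping edge. -/
def Compat (φ₁ : T.left.Vertex → V) (φ₂ : T.right.Vertex → V) : Prop :=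
  φ₂ (T.right.child T.rightEdge) =
      φ₁ (if T.flip then T.left.parent T.leftEdge else T.left.child T.leftEdge) ∧
    φ₂ (T.right.parent T.rightEdge) =
      φ₁ (if T.flip then T.left.child T.leftEdge else T.left.parent T.leftEdge)

theorem compat_comp (Φ : T.Vertex → V) : T.Compat (Φ ∘ T.ofLeft) (Φ ∘ T.ofRight) :=
  ⟨congrArg Φ T.ofRight_child, congrArg Φ T.ofRight_parent⟩

/-- The common extension of two compatible labellings. -/
def glue (φ₁ : T.left.Vertex → V) (φ₂ : T.right.Vertex → V) : T.Vertex → V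
  | Sum.inl v => φ₁ v
  | Sum.inr v => φ₂ v.1

theorem glue_ofRight {φ₁ : T.left.Vertex → V} {φ₂ : T.right.Vertex → V} (hc : T.Compat φ₁ φ₂)
    (v : T.right.Vertex) : T.glue φ₁ φ₂ (T.ofRight v) = φ₂ v := by
  by_cases h1 : v = T.right.child T.rightEdge
  · rw [h1, ofRight_child, hc.1]; rfl
  by_cases h2 : v = T.right.parent T.rightEdge
  · rw [h2, ofRight_parent, hc.2]; rfl
  rw [T.ofRight_of_ne ⟨h1, h2⟩]; rfl

open Classical in
-- Restriction to the two trees, with gluing as its inverse, matches labellings of the joined tree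
-- with pairs agreeing on the overlap. Injectivity is available on each tree separately only: the
-- trees may collide away from the overlapping edge.
theorem sum_compat [Fintype V] (F : (T.left.Vertex → V) → (T.right.Vertex → V) → ℝ) :
    ∑ φ₁ : T.left.Vertex ↪ V, ∑ φ₂ : T.right.Vertex ↪ V, (if T.Compat φ₁ φ₂ then F φ₁ φ₂ else 0) =
      ∑ Φ : T.Vertex → V, if T.Good Φ then F (Φ ∘ T.ofLeft) (Φ ∘ T.ofRight) else 0 := by
  rw [← Fintype.sum_prod_type' (f := fun (φ₁ : T.left.Vertex ↪ V) (φ₂ : T.right.Vertex ↪ V) =>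
    if T.Compat φ₁ φ₂ then F φ₁ φ₂ else 0), ← Finset.sum_filter, ← Finset.sum_filter]
  symm
  refine Finset.sum_bij (fun Φ hΦ => (⟨Φ ∘ T.ofLeft, (Finset.mem_filter.1 hΦ).2.1⟩,
    ⟨Φ ∘ T.ofRight, (Finset.mem_filter.1 hΦ).2.2⟩)) ?_ ?_ ?_ ?_
  · intro Φ hΦ
    exact Finset.mem_filter.2 ⟨Finset.mem_univ _, T.compat_comp Φ⟩
  · intro Φ hΦ Ψ hΨ h
    simp only [Prod.mk.injEq, Function.Embedding.mk.injEq] at h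
    exact funext (T.vertex_cases (fun v => congrFun h.1 v) fun v => congrFun h.2 v)
  · rintro ⟨φ₁, φ₂⟩ hφ
    have hc : T.Compat φ₁ φ₂ := (Finset.mem_filter.1 hφ).2
    have h1 : T.glue φ₁ φ₂ ∘ T.ofLeft = φ₁ := rfl
    have h2 : T.glue φ₁ φ₂ ∘ T.ofRight = φ₂ := funext (T.glue_ofRight hc)
    refine ⟨T.glue φ₁ φ₂, Finset.mem_filter.2 ⟨Finset.mem_univ _, ?_, ?_⟩, ?_⟩
    · rw [h1]; exact φ₁.injective
    · rw [h2]; exact φ₂.injective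
    · exact Prod.ext (DFunLike.ext' h1) (DFunLike.ext' h2)
  · intro Φ _
    rfl

open Classical in
/-- The weight of a labelled joined tree: `v` on the overlapping edge, `m` on the others. -/
def weight (m v : Sym2 V → ℝ) (Φ : T.Vertex → V) : ℝ :=
  ∏ j, if j = Sum.inl T.leftEdge then v ((T.ends j).map Φ) else m ((T.ends j).map Φ)

open Classical in
theorem weight_eq (m v : Sym2 V → ℝ) (Φ : T.Vertex → V) :
    T.weight m v Φ = (∏ ε ∈ Finset.univ.erase T.leftEdge, m ((T.left.ends ε).map (Φ ∘ T.ofLeft))) *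
      (∏ ε ∈ Finset.univ.erase T.rightEdge, m ((T.right.ends ε).map (Φ ∘ T.ofRight))) *
        v ((T.left.ends T.leftEdge).map (Φ ∘ T.ofLeft)) := by
  rw [weight, Fintype.prod_sum_type, ← Finset.mul_prod_erase _ _ (Finset.mem_univ T.leftEdge),
    if_pos rfl]
  have h1 : ∏ ε ∈ Finset.univ.erase T.leftEdge, (if (Sum.inl ε : T.Edge) = Sum.inl T.leftEdge then
      v ((T.ends (Sum.inl ε)).map Φ) else m ((T.ends (Sum.inl ε)).map Φ)) =
      ∏ ε ∈ Finset.univ.erase T.leftEdge, m ((T.left.ends ε).map (Φ ∘ T.ofLeft)) := by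
    refine Finset.prod_congr rfl fun ε hε => ?_
    rw [if_neg fun h => Finset.ne_of_mem_erase hε (Sum.inl_injective h), ends, Sym2.map_map]
  have h2 : (∏ ε : {ε : T.right.Edge // ε ≠ T.rightEdge},
      (if (Sum.inr ε : T.Edge) = Sum.inl T.leftEdge then
        v ((T.ends (Sum.inr ε)).map Φ) else m ((T.ends (Sum.inr ε)).map Φ))) =
      ∏ ε ∈ Finset.univ.erase T.rightEdge, m ((T.right.ends ε).map (Φ ∘ T.ofRight)) := by
    rw [Finset.prod_subtype (p := fun ε => ε ≠ T.rightEdge) _ (by simp)]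
    refine Finset.prod_congr rfl fun ε _ => ?_
    rw [if_neg Sum.inr_ne_inl, ends, Sym2.map_map]
  rw [h1, h2, ends, Sym2.map_map]
  ring

theorem ends_not_isDiag (j : T.Edge) {Φ : T.Vertex → V} (hΦ : T.Good Φ) :
    ¬ ((T.ends j).map Φ).IsDiag := by
  rcases j with ε | ε
  · intro h
    rw [ends, PlanarTree.ends, Sym2.map_map, Sym2.map_mk, Sym2.mk_isDiag_iff] at h
    exact T.left.parent_ne_child ε (hΦ.1 h)
  · intro h
    rw [ends, PlanarTree.ends, Sym2.map_map, Sym2.map_mk, Sym2.mk_isDiag_iff] at h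
    exact T.right.parent_ne_child ε.1 (hΦ.2 h)

theorem good_of_injective {Φ : T.Vertex → V} (hΦ : Function.Injective Φ) : T.Good Φ :=
  ⟨hΦ.comp T.ofLeft_injective, hΦ.comp T.ofRight_injective⟩

open Classical in
-- On good labellings no edge becomes a loop, so the off-diagonal estimates apply factor by factor.
-- Labellings that are not good are in particular not injective; there are fewer of them by a factor
-- of order `1 / card V`, and each contributes at most `B ^ card Edge`.
theorem abs_sum_weight_sub_le [Fintype V] {m v y : Sym2 V → ℝ} {B δ : ℝ} (hB : 0 ≤ B) (hδ : 0 ≤ δ)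
    (hm : ∀ e, ¬ e.IsDiag → |m e| ≤ B) (hv : ∀ e, ¬ e.IsDiag → |v e| ≤ B) (hy : ∀ e, |y e| ≤ B)
    (hmy : ∀ e, ¬ e.IsDiag → |m e - y e| ≤ B * δ) (hvy : ∀ e, ¬ e.IsDiag → |v e - y e| ≤ B * δ) :
    |(∑ Φ : T.Vertex → V, if T.Good Φ then T.weight m v Φ else 0) -
        ∑ Φ : T.Vertex → V, ∏ j, y ((T.ends j).map Φ)| ≤
      B ^ Fintype.card T.Edge * (Fintype.card V ^ Fintype.card T.Vertex * (Fintype.card T.Edge * δ) +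
        Fintype.card T.Vertex ^ 2 * Fintype.card V ^ (Fintype.card T.Vertex - 1)) := by
  have h1 : ∀ Φ : T.Vertex → V,
      |(if T.Good Φ then T.weight m v Φ else 0) - ∏ j, y ((T.ends j).map Φ)| ≤
        B ^ Fintype.card T.Edge * (Fintype.card T.Edge * δ) +
          if ¬ Function.Injective Φ then B ^ Fintype.card T.Edge else 0 := by
    intro Φ
    have hB' : 0 ≤ B ^ Fintype.card T.Edge := pow_nonneg hB _
    have hδ' : 0 ≤ B ^ Fintype.card T.Edge * (Fintype.card T.Edge * δ) :=
      mul_nonneg hB' (mul_nonneg (Nat.cast_nonneg _) hδ)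
    by_cases hΦ : T.Good Φ
    · rw [if_pos hΦ]
      have h2 := abs_prod_sub_prod_le (Finset.univ : Finset T.Edge)
        (x := fun j => if j = Sum.inl T.leftEdge then v ((T.ends j).map Φ) else m ((T.ends j).map Φ))
        (y := fun j => y ((T.ends j).map Φ)) (B := B) (δ := δ) hB
        (fun j => by
          split_ifs
          · exact hv _ (T.ends_not_isDiag j hΦ)
          · exact hm _ (T.ends_not_isDiag j hΦ)) (fun j => hy _)
        (fun j => by
          split_ifs
          · exact hvy _ (T.ends_not_isDiag j hΦ)
          · exact hmy _ (T.ends_not_isDiag j hΦ))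
      rw [Finset.card_univ] at h2
      refine (h2.trans_eq (by ring)).trans (le_add_of_nonneg_right ?_)
      split_ifs
      · exact le_rfl
      · exact hB'
    · rw [if_neg hΦ, if_pos fun h => hΦ (T.good_of_injective h), zero_sub, abs_neg, Finset.abs_prod]
      refine le_trans ?_ (le_add_of_nonneg_left hδ')
      rw [← Finset.card_univ, ← Finset.prod_const]
      exact Finset.prod_le_prod (fun _ _ => abs_nonneg _) fun j _ => hy _
  rw [← Finset.sum_sub_distrib]
  refine (Finset.abs_sum_le_sum_abs _ _).trans ((Finset.sum_le_sum fun Φ _ => h1 Φ).trans ?_)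
  rw [Finset.sum_add_distrib, ← Finset.sum_filter, Finset.sum_const, Finset.sum_const,
    Finset.card_univ, Fintype.card_fun, nsmul_eq_mul, nsmul_eq_mul]
  have h2 := (Nat.cast_le (α := ℝ)).2 (card_not_injective_le T.Vertex V)
  push_cast at h2 ⊢
  have h3 := mul_le_mul_of_nonneg_right h2 (pow_nonneg hB (Fintype.card T.Edge))
  linarith

end JoinedTree

/-! ### Products of coefficients as sums over joined trees -/

section

variable {Ω V : Type*} [MeasurableSpace Ω] (P : Measure Ω) [Fintype V] [DecidableEq V]
  (a : Sym2 V → Ω → ℝ)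

/-- The variance of the square of a variable. -/
def varSq (e : Sym2 V) : ℝ := mom P a e 4 - mom P a e 2 ^ 2

open Classical in
-- Expanding the product gives two labelled trees with marked edges over the same `e`, and summing
-- over `e` leaves the condition that the marked edges have equal images. As unordered pairs they
-- can coincide in two directions, recorded by the Boolean. The common edge carries the variance,
-- all others their second moments.
theorem sum_linCoef_mul_linCoef {k h : ℕ} (hk : Even k) (hh : Even h) :
    ∑ e, linCoef P a k e * linCoef P a h e * varSq P a e =
      ∑ T : JoinedTree k h, ∑ Φ : T.Vertex → V,
        if T.Good Φ then T.weight (fun e => mom P a e 2) (varSq P a) Φ else 0 := by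
  simp only [linCoef, if_pos hk, if_pos hh]
  rw [sum_sum_mul_sum_mul, JoinedTree.sum_eq]
  refine Finset.sum_congr rfl fun T₁ _ => Finset.sum_congr rfl fun T₂ _ => ?_
  have hswap : ∀ (T : PlanarTree) (e : Sym2 V),
      (∑ φ : T.Vertex ↪ V, ∑ ε : T.Edge,
        if (T.ends ε).map φ = e then treeWeight P a φ ε else 0) =
      ∑ ε : T.Edge, ∑ φ : T.Vertex ↪ V,
        if (T.ends ε).map φ = e then treeWeight P a φ ε else 0 := fun T e => Finset.sum_comm
  simp only [hswap]
  rw [sum_sum_mul_sum_mul]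
  refine Finset.sum_congr rfl fun ε₁ _ => Finset.sum_congr rfl fun ε₂ _ => ?_
  rw [sum_sum_mul_sum_mul]
  let T (b : Bool) : JoinedTree k h := ⟨T₁, T₂, ε₁, ε₂, b⟩
  let F (φ₁ : T₁.1.Vertex → V) (φ₂ : T₂.1.Vertex → V) : ℝ :=
    treeWeight P a φ₁ ε₁ * treeWeight P a φ₂ ε₂ * varSq P a ((T₁.1.ends ε₁).map φ₁)
  have h1 : ∀ (φ₁ : T₁.1.Vertex ↪ V) (φ₂ : T₂.1.Vertex ↪ V),
      ∑ e, (if (T₁.1.ends ε₁).map φ₁ = e then treeWeight P a φ₁ ε₁ else 0) *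
        (if (T₂.1.ends ε₂).map φ₂ = e then treeWeight P a φ₂ ε₂ else 0) * varSq P a e =
      ∑ b, if (T b).Compat φ₁ φ₂ then F φ₁ φ₂ else 0 := by
    intro φ₁ φ₂
    rw [Finset.sum_eq_single ((T₁.1.ends ε₁).map φ₁), if_pos rfl, Fintype.sum_bool]
    · have hne : φ₁ (T₁.1.parent ε₁) ≠ φ₁ (T₁.1.child ε₁) := fun h =>
        T₁.1.parent_ne_child ε₁ (φ₁.injective h)
      have hf : (T false).Compat φ₁ φ₂ ↔ φ₂ (T₂.1.child ε₂) = φ₁ (T₁.1.child ε₁) ∧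
        φ₂ (T₂.1.parent ε₂) = φ₁ (T₁.1.parent ε₁) := Iff.rfl
      have ht : (T true).Compat φ₁ φ₂ ↔ φ₂ (T₂.1.child ε₂) = φ₁ (T₁.1.parent ε₁) ∧
        φ₂ (T₂.1.parent ε₂) = φ₁ (T₁.1.child ε₁) := Iff.rfl
      have hs : (T₂.1.ends ε₂).map φ₂ = (T₁.1.ends ε₁).map φ₁ ↔
          (φ₂ (T₂.1.parent ε₂) = φ₁ (T₁.1.parent ε₁) ∧ φ₂ (T₂.1.child ε₂) = φ₁ (T₁.1.child ε₁)) ∨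
          (φ₂ (T₂.1.parent ε₂) = φ₁ (T₁.1.child ε₁) ∧
            φ₂ (T₂.1.child ε₂) = φ₁ (T₁.1.parent ε₁)) := by
        rw [PlanarTree.ends, PlanarTree.ends, Sym2.map_mk, Sym2.map_mk, Sym2.eq_iff]
      simp only [hf, ht]
      by_cases hc : φ₂ (T₂.1.child ε₂) = φ₁ (T₁.1.child ε₁) ∧
        φ₂ (T₂.1.parent ε₂) = φ₁ (T₁.1.parent ε₁)
      · have hc' : ¬ (φ₂ (T₂.1.child ε₂) = φ₁ (T₁.1.parent ε₁) ∧
          φ₂ (T₂.1.parent ε₂) = φ₁ (T₁.1.child ε₁)) := fun h => hne (h.1.symm.trans hc.1)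
        rw [if_pos (hs.2 (Or.inl hc.symm)), if_neg hc', if_pos hc, zero_add]
      · rw [if_neg hc, add_zero]
        by_cases hc' : φ₂ (T₂.1.child ε₂) = φ₁ (T₁.1.parent ε₁) ∧
          φ₂ (T₂.1.parent ε₂) = φ₁ (T₁.1.child ε₁)
        · rw [if_pos (hs.2 (Or.inr hc'.symm)), if_pos hc']
        · rw [if_neg hc', if_neg, mul_zero, zero_mul]
          intro h
          rcases hs.1 h with h | h
          · exact hc h.symm
          · exact hc' h.symm
    · intro e _ he
      rw [if_neg he.symm, zero_mul, zero_mul]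
    · simp
  simp only [h1]
  have h2 : ∀ b, ∑ φ₁ : T₁.1.Vertex ↪ V, ∑ φ₂ : T₂.1.Vertex ↪ V,
      (if (T b).Compat φ₁ φ₂ then F φ₁ φ₂ else 0) = ∑ Φ : (T b).Vertex → V,
        if (T b).Good Φ then (T b).weight (fun e => mom P a e 2) (varSq P a) Φ else 0 := by
    intro b
    refine ((T b).sum_compat F).trans (Finset.sum_congr rfl fun Φ _ => ?_)
    rw [JoinedTree.weight_eq]
    rfl
  rw [← Finset.sum_congr rfl fun b _ => h2 b]
  simp only [Finset.sum_comm (t := (Finset.univ : Finset Bool))]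

end

/-! ## The limits of the covariances -/

theorem statCoef_even (n : ℕ) {p : ℝ} (hp : 0 ≤ p) {k : ℕ} (hk : Even k) :
    statCoef n p k = √p * ((n * p) ^ (k / 2))⁻¹ := by
  have h1 : (√(n * p))⁻¹ ^ k = ((√(n * p)) ^ 2 ^ 1)⁻¹ ^ (k / 2) := by
    conv_lhs => rw [← Nat.mul_div_cancel' hk.two_dvd, pow_mul]
    rw [inv_pow, pow_one]
  rw [statCoef, h1, pow_one, Real.sq_sqrt (by positivity), inv_pow]

/-- The covariance of the projections of two spectral statistics. -/
def statCov {Ω : Type*} [MeasurableSpace Ω] (P : Measure Ω) {n : ℕ} (p : ℝ)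
    (A : Ω → Matrix (Fin n) (Fin n) ℝ) (k h : ℕ) : ℝ :=
  statCoef n p k * statCoef n p h * ∑ e, linCoef P (edgeVar P A) k e * linCoef P (edgeVar P A) h e *
    varSq P (edgeVar P A) e

namespace IsInhomRandomGraph

variable {Ω : Type*} [MeasurableSpace Ω] {P : Measure Ω} {n : ℕ} {p : ℝ}
  {S : Matrix (Fin n) (Fin n) ℝ} {A : Ω → Matrix (Fin n) (Fin n) ℝ}
  (hA : IsInhomRandomGraph P p S A)

include hA

theorem mom_two {i j : Fin n} (hij : i ≠ j) :
    mom P (edgeVar P A) s(i, j) 2 = p * S i j * (1 - p * S i j) := by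
  rw [hA.mom_edgeVar hij]; ring

theorem varSq_edgeVar {i j : Fin n} (hij : i ≠ j) :
    varSq P (edgeVar P A) s(i, j) = p * S i j * (1 - p * S i j) * (1 - 2 * (p * S i j)) ^ 2 := by
  rw [varSq, hA.mom_edgeVar hij, hA.mom_edgeVar hij]; ring

/-- For a joined tree with `N` edges the normalisation is `p ^ (-N) * n ^ (-(N + 1))`. It cancels
one factor `p` per edge and averages over the labels of `N + 1` vertices. What is left is the
density of the tree, up to relative errors `O(p)` in the edge weights and the `O(1 / n)` share of
noninjective labellings. -/
theorem abs_statCov_sub_le (hn : 0 < n) (hp : 0 < p) {C : ℝ} (hC : 0 ≤ C) (hSs : S.IsSymm)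
    (hS : ∀ i j, 0 ≤ S i j ∧ S i j ≤ C ∧ p * S i j ≤ 1) {k h : ℕ} (hk : Even k) (hh : Even h) :
    |statCov P p A k h - ∑ T : JoinedTree k h, homDensity T.graph (stepGraphon S hSs)| ≤
      ∑ _T : JoinedTree k h, C ^ (k / 2 + (h / 2 - 1)) *
        ((k / 2 + (h / 2 - 1) : ℕ) * (5 * (C * p)) +
          (k / 2 + (h / 2 - 1) + 1 : ℕ) ^ 2 * (n : ℝ)⁻¹) := by
  classical
  have hn' : (0 : ℝ) < n := Nat.cast_pos.2 hn
  rw [statCov, sum_linCoef_mul_linCoef P _ hk hh, Finset.mul_sum, ← Finset.sum_sub_distrib]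
  refine (Finset.abs_sum_le_sum_abs _ _).trans (Finset.sum_le_sum fun T _ => ?_)
  set N := k / 2 + (h / 2 - 1) with hN
  have hE : Fintype.card T.Edge = N := T.card_edge
  have hX : Fintype.card T.Vertex = N + 1 := by
    have h1 := T.right_pos
    rw [T.card_vertex]; omega
  have hcoef : statCoef n p k * statCoef n p h = (p ^ N * (n : ℝ) ^ (N + 1))⁻¹ := by
    have h1 := T.right_pos
    rw [statCoef_even n hp.le hk, statCoef_even n hp.le hh, mul_mul_mul_comm,
      Real.mul_self_sqrt hp.le, ← mul_inv, ← pow_add, show k / 2 + h / 2 = N + 1 by omega, mul_pow,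
      pow_succ p]
    field_simp
  have hr : ∀ i j, 0 ≤ p * S i j ∧ p * S i j ≤ 1 ∧ p * S i j ≤ C * p := fun i j =>
    ⟨mul_nonneg hp.le (hS i j).1, (hS i j).2.2, by
      rw [mul_comm]; exact mul_le_mul_of_nonneg_right (hS i j).2.1 hp.le⟩
  have hB : 0 ≤ C * p := mul_nonneg hC hp.le
  have key := T.abs_sum_weight_sub_le (V := Fin n) (m := fun e => mom P (edgeVar P A) e 2)
    (v := varSq P (edgeVar P A)) (y := fun e => p * symEntry hSs e) (B := C * p)
    (δ := 5 * (C * p)) hB (by positivity)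
    (fun e he => by
      induction e with | _ i j => ?_
      obtain ⟨h0, h1, h2⟩ := hr i j
      rw [hA.mom_two (by simpa using he), abs_of_nonneg (mul_nonneg h0 (by linarith))]
      nlinarith)
    (fun e he => by
      induction e with | _ i j => ?_
      obtain ⟨h0, h1, h2⟩ := hr i j
      rw [hA.varSq_edgeVar (by simpa using he), abs_of_nonneg
        (mul_nonneg (mul_nonneg h0 (by linarith)) (sq_nonneg _)), mul_assoc]
      refine (mul_le_of_le_one_right h0 (mul_le_one₀ (by linarith) (sq_nonneg _) ?_)).trans h2
      exact (sq_le_one_iff_abs_le_one _).2 (abs_le.2 ⟨by linarith, by linarith⟩))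
    (fun e => by
      induction e with | _ i j => ?_
      obtain ⟨h0, h1, h2⟩ := hr i j
      change |p * S i j| ≤ _
      rwa [abs_of_nonneg h0])
    (fun e he => by
      induction e with | _ i j => ?_
      obtain ⟨h0, h1, h2⟩ := hr i j
      change |_ - p * S i j| ≤ _
      rw [hA.mom_two (by simpa using he), abs_le]
      constructor <;> nlinarith)
    (fun e he => by
      induction e with | _ i j => ?_
      obtain ⟨h0, h1, h2⟩ := hr i j
      change |_ - p * S i j| ≤ _
      rw [hA.varSq_edgeVar (by simpa using he)]
      generalize p * S i j = r at *
      -- This identity is the source of the constant `5`: the bracket is at most `5` for `0 ≤ r ≤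
      -- 1`.
      have h3 : r * (1 - r) * (1 - 2 * r) ^ 2 - r = -(r ^ 2 * (4 * (1 - r) ^ 2 + 1)) := by ring
      have h4 : 4 * (1 - r) ^ 2 + 1 ≤ 5 := by nlinarith
      have h5 : r ^ 2 ≤ (C * p) ^ 2 := pow_le_pow_left₀ h0 h2 2
      rw [h3, abs_neg, abs_of_nonneg (by positivity)]
      calc r ^ 2 * (4 * (1 - r) ^ 2 + 1) ≤ (C * p) ^ 2 * 5 :=
            mul_le_mul h5 h4 (by positivity) (by positivity)
        _ = _ := by ring)
  have hprod : ∑ Φ : T.Vertex → Fin n, ∏ j, p * symEntry hSs ((T.ends j).map Φ) =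
      p ^ N * ∑ Φ : T.Vertex → Fin n, ∏ j, symEntry hSs ((T.ends j).map Φ) := by
    rw [Finset.mul_sum]
    refine Finset.sum_congr rfl fun Φ _ => ?_
    rw [Finset.prod_mul_distrib, Finset.prod_const, Finset.card_univ, hE]
  have hdens : homDensity T.graph (stepGraphon S hSs) = (p ^ N * (n : ℝ) ^ (N + 1))⁻¹ *
      ∑ Φ : T.Vertex → Fin n, ∏ j, p * symEntry hSs ((T.ends j).map Φ) := by
    rw [T.homDensity_stepGraphon hn, hprod, hX]
    field_simp
  rw [hdens, hcoef, ← mul_sub, abs_mul, abs_of_nonneg (by positivity),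
    inv_mul_le_iff₀ (by positivity)]
  refine key.trans_eq ?_
  rw [hE, hX, Fintype.card_fin, Nat.add_sub_cancel, pow_succ (n : ℝ) N, mul_pow]
  field_simp

end IsInhomRandomGraph

/-! ## Characteristic functions of the spectral statistics -/

/-- A bound for the coefficients of the projections. -/
def coefBound (C : ℝ) (k : ℕ) : ℝ :=
  (∑ T : PlanarTree.OfSize (k / 2), (Fintype.card T.1.Edge : ℝ)) * (2 * C ^ (k / 2 - 1))

/-- A bound for the remainders after projection. -/
def remBound (C : ℝ) (k : ℕ) : ℝ :=
  (2 + 2 * k) * C ^ k * ((2 * (k + 1) + 1) * (2 * (k + 1) : ℝ) ^ (2 * (k + 1)))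

/-- The quadratic form is the variance of a combination of linear statistics, diagonal over the
independent entries. It supplies both the variance in the Gaussian approximation and the positivity
of the limit kernel. -/
theorem sum_sum_statCov {Ω : Type*} [MeasurableSpace Ω] (P : Measure Ω) {n : ℕ} (p : ℝ)
    (A : Ω → Matrix (Fin n) (Fin n) ℝ) (s : Finset ℕ) (t : ℕ → ℝ) :
    ∑ k ∈ s, ∑ h ∈ s, t k * t h * statCov P p A k h =
      ∑ e, (∑ k ∈ s, t k * (statCoef n p k * linCoef P (edgeVar P A) k e)) ^ 2 *
        varSq P (edgeVar P A) e := by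
  simp only [sq (∑ k ∈ s, _), Finset.sum_mul_sum]
  simp only [Finset.sum_mul, statCov, Finset.mul_sum]
  conv_rhs => rw [Finset.sum_comm]
  refine Finset.sum_congr rfl fun k _ => ?_
  conv_rhs => rw [Finset.sum_comm]
  refine Finset.sum_congr rfl fun h _ => Finset.sum_congr rfl fun e _ => ?_
  ring

namespace IsInhomRandomGraph

variable {Ω : Type*} [MeasurableSpace Ω] {P : Measure Ω} [IsProbabilityMeasure P] {n : ℕ} {p : ℝ}
  {S : Matrix (Fin n) (Fin n) ℝ} {A : Ω → Matrix (Fin n) (Fin n) ℝ}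
  (hA : IsInhomRandomGraph P p S A)

theorem coefBound_nonneg {C : ℝ} (hC : 0 ≤ C) (k : ℕ) : 0 ≤ coefBound C k :=
  mul_nonneg (Finset.sum_nonneg fun _ _ => Nat.cast_nonneg _) (by positivity)

/-- The coefficient is at most of order `(n p) ^ (k / 2 - 1)`, which the normalisation `√p * (n p) ^
(-k / 2)` reduces below `√p`. No single entry therefore matters in the limit. -/
theorem abs_statCoef_mul_linCoef_le {C : ℝ} (ha : IsSmallIndep P (edgeVar P A) (C * p))
    (hp : 0 < p) (hC : 0 ≤ C) (hnp : 1 ≤ n * p) (k : ℕ) (e : Sym2 (Fin n)) :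
    |statCoef n p k * linCoef P (edgeVar P A) k e| ≤ coefBound C k * √p := by
  have hnp0 : 0 < (n : ℝ) * p := by linarith
  by_cases hk : Even k
  · have h1 := abs_linCoef_le ha k e
    rw [Fintype.card_fin, show (n : ℝ) * (C * p) = C * (n * p) by ring, mul_pow] at h1
    have hc : 0 ≤ statCoef n p k := by unfold statCoef; positivity
    rw [abs_mul, abs_of_nonneg hc]
    refine (mul_le_mul_of_nonneg_left h1 hc).trans ?_
    have h2 : statCoef n p k * (n * p) ^ (k / 2 - 1) ≤ √p := by
      rw [statCoef_even n hp.le hk, mul_assoc]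
      refine mul_le_of_le_one_right (Real.sqrt_nonneg _) ?_
      rw [inv_mul_le_iff₀ (by positivity), mul_one]
      exact pow_le_pow_right₀ hnp (Nat.sub_le _ _)
    calc statCoef n p k * ((∑ T : PlanarTree.OfSize (k / 2), (Fintype.card T.1.Edge : ℝ)) *
          (2 * (C ^ (k / 2 - 1) * (n * p) ^ (k / 2 - 1))))
        = coefBound C k * (statCoef n p k * (n * p) ^ (k / 2 - 1)) := by unfold coefBound; ring
      _ ≤ _ := mul_le_mul_of_nonneg_left h2 (coefBound_nonneg hC k)
  · rw [linCoef, if_neg hk, mul_zero, abs_zero]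
    exact mul_nonneg (coefBound_nonneg hC k) (Real.sqrt_nonneg _)

include hA

/-- The first error is the `L²` distance between the combined statistics and their projections, the
second that of the Gaussian approximation for the projections, which form a sum of independent
variables. -/
theorem norm_integral_exp_sub_le {C : ℝ} (ha : IsSmallIndep P (edgeVar P A) (C * p)) (hn : 0 < n)
    (hp : 0 < p) (hC : 1 ≤ C) (hnp : 1 ≤ n * p) (s : Finset ℕ) (t : ℕ → ℝ) {δ : ℝ}
    (hδ : ∑ k ∈ s, |t k| * (coefBound C k * √p) ≤ δ) (hδ1 : δ ≤ 1) :
    ‖∫ ω, Complex.exp ((∑ k ∈ s, t k * spectralStat P p A k ω : ℝ) * Complex.I) ∂P -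
        Complex.exp ((-(∑ k ∈ s, ∑ h ∈ s, t k * t h * statCov P p A k h) / 2 : ℝ))‖ ≤
      √(s.card * ∑ k ∈ s, t k ^ 2 * (remBound C k * (p + (n * p)⁻¹))) +
        2 * δ * ∑ k ∈ s, ∑ h ∈ s, t k * t h * statCov P p A k h := by
  set a := edgeVar P A with hadef
  let ξ (e : Sym2 (Fin n)) (ω : Ω) : ℝ := a e ω ^ 2 - mom P a e 2
  let b (e : Sym2 (Fin n)) : ℝ := ∑ k ∈ s, t k * (statCoef n p k * linCoef P a k e)
  have hξm : ∀ e, Measurable (ξ e) := fun e => ((ha.measurable e).pow_const 2).sub_const _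
  have hξi : iIndepFun ξ P := ha.indep.comp (fun e x => x ^ 2 - mom P a e 2) fun e => by fun_prop
  have hξb : ∀ e, ∀ᵐ ω ∂P, |ξ e ω| ≤ 1 := by
    intro e
    have h1 : 0 ≤ mom P a e 2 := integral_nonneg fun ω => sq_nonneg _
    have h2 := (abs_le.1 (ha.abs_mom_le_one e 2)).2
    filter_upwards [ha.ae_abs_pow_le e 2] with ω hω
    have h3 := (abs_le.1 hω).2
    have h4 := sq_nonneg (a e ω)
    exact abs_le.2 ⟨by simp only [ξ]; linarith, by simp only [ξ]; linarith⟩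
  have hξ0 : ∀ e, ∫ ω, ξ e ω ∂P = 0 := fun e => ha.integral_pow_sub e 2
  have hξv : ∀ e, ∫ ω, ξ e ω ^ 2 ∂P = varSq P a e := by
    intro e
    have h1 := ha.integral_pow_sub_mul_pow_sub e e 2 2
    rw [if_pos rfl] at h1
    simp only [sq (ξ e _)]
    rw [h1, varSq, sq]
  have hbδ : ∀ e, |b e| ≤ δ := by
    intro e
    refine ((Finset.abs_sum_le_sum_abs _ _).trans (Finset.sum_le_sum fun k _ => ?_)).trans hδ
    rw [abs_mul]
    exact mul_le_mul_of_nonneg_left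
      (abs_statCoef_mul_linCoef_le ha hp (by linarith) hnp k e) (abs_nonneg _)
  have hvar : ∑ e, b e ^ 2 * ∫ ω, ξ e ω ^ 2 ∂P =
      ∑ k ∈ s, ∑ h ∈ s, t k * t h * statCov P p A k h := by
    simp only [hξv]
    exact (sum_sum_statCov P p A s t).symm
  have hlin : ∀ ω, ∑ e, b e * ξ e ω = ∑ k ∈ s, t k * (statCoef n p k *
      ∑ w : ClosedWalk (Fin n) k, doubleInd w * monomialLin P a (walkExp w) ω) := by
    intro ω
    simp only [sum_doubleInd_mul_monomialLin ha, b, Finset.sum_mul, Finset.mul_sum]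
    rw [Finset.sum_comm]
    refine Finset.sum_congr rfl fun k _ => Finset.sum_congr rfl fun e _ => ?_
    simp only [ξ]
    ring
  have hX : ∀ k, MemLp (fun ω => spectralStat P p A k ω) 2 P := by
    intro k
    simp only [hA.spectralStat_eq ha]
    exact (memLp_finsetSum _ fun w _ => ha.memLp_monomialCen _).const_mul _
  have hL : ∀ k, MemLp (fun ω => statCoef n p k *
      ∑ w : ClosedWalk (Fin n) k, doubleInd w * monomialLin P a (walkExp w) ω) 2 P := fun k =>
    (memLp_finsetSum _ fun w _ => (ha.memLp_monomialLin _).const_mul _).const_mul _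
  have h1 := norm_integral_exp_sum_sub_exp_le (P := P) hξm hξi hξb hξ0 hbδ hδ1
  rw [hvar] at h1
  have h2 := norm_integral_exp_sub_integral_exp_le (P := P)
    (X := fun ω => ∑ k ∈ s, t k * spectralStat P p A k ω) (Y := fun ω => ∑ e, b e * ξ e ω)
    (memLp_finsetSum _ fun k _ => (hX k).const_mul _) (by
      simp only [hlin]
      exact memLp_finsetSum _ fun k _ => (hL k).const_mul _)
  have hsub : ∀ k, MemLp (fun ω => spectralStat P p A k ω - statCoef n p k *
      ∑ w : ClosedWalk (Fin n) k, doubleInd w * monomialLin P a (walkExp w) ω) 2 P :=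
    fun k => (hX k).sub (hL k)
  have h3 : ∫ ω, (∑ k ∈ s, t k * spectralStat P p A k ω - ∑ e, b e * ξ e ω) ^ 2 ∂P ≤
      s.card * ∑ k ∈ s, t k ^ 2 * (remBound C k * (p + (n * p)⁻¹)) := by
    -- Cauchy–Schwarz over `s`, the source of `s.card`, reduces the remainder to one power `k` at a
    -- time; pairs of walks of different lengths never have to be compared.
    have hle : ∀ ω, (∑ k ∈ s, t k * spectralStat P p A k ω - ∑ e, b e * ξ e ω) ^ 2 ≤
        s.card * ∑ k ∈ s, t k ^ 2 * (spectralStat P p A k ω - statCoef n p k *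
          ∑ w : ClosedWalk (Fin n) k, doubleInd w * monomialLin P a (walkExp w) ω) ^ 2 := by
      intro ω
      rw [hlin, ← Finset.sum_sub_distrib]
      refine sq_sum_le_card_mul_sum_sq.trans_eq ?_
      congr 1
      refine Finset.sum_congr rfl fun k _ => ?_
      ring
    have hint : ∀ k, Integrable (fun ω => t k ^ 2 * (spectralStat P p A k ω - statCoef n p k *
          ∑ w : ClosedWalk (Fin n) k, doubleInd w * monomialLin P a (walkExp w) ω) ^ 2) P :=
      fun k => (hsub k).integrable_sq.const_mul _
    refine (integral_mono_of_nonneg (ae_of_all _ fun ω => sq_nonneg _)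
      ((integrable_finsetSum _ fun k _ => hint k).const_mul _) (ae_of_all _ hle)).trans ?_
    rw [integral_const_mul, integral_finsetSum _ fun k _ => hint k]
    refine mul_le_mul_of_nonneg_left (Finset.sum_le_sum fun k _ => ?_) (Nat.cast_nonneg _)
    rw [integral_const_mul]
    refine mul_le_mul_of_nonneg_left ?_ (sq_nonneg _)
    have h4 : ∀ ω, (spectralStat P p A k ω - statCoef n p k *
          ∑ w : ClosedWalk (Fin n) k, doubleInd w * monomialLin P a (walkExp w) ω) ^ 2 =
        p * ((n * p) ^ k)⁻¹ * (∑ w : ClosedWalk (Fin n) k,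
          (monomialCen P a (walkExp w) ω - doubleInd w * monomialLin P a (walkExp w) ω)) ^ 2 := by
      intro ω
      rw [hA.spectralStat_eq ha, ← mul_sub, ← Finset.sum_sub_distrib, mul_pow, statCoef_sq n hp.le]
    simp only [h4]
    rw [integral_const_mul]
    have h5 := ha.integral_sq_trace_sub_le (by rw [Fintype.card_fin]; exact hn) hp hC
      (by rw [Fintype.card_fin]; exact hnp) k
    rw [Fintype.card_fin] at h5
    refine h5.trans_eq ?_
    rw [remBound]
    ring
  refine (norm_sub_le_norm_sub_add_norm_sub _ _ _).trans
    (add_le_add (h2.trans (Real.sqrt_le_sqrt h3)) h1)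

end IsInhomRandomGraph

/-! ### Limits of covariances and characteristic functions -/

section Limits

variable {Ω : ℕ → Type*} [∀ n, MeasurableSpace (Ω n)] {P : ∀ n, Measure (Ω n)}
  [∀ n, IsProbabilityMeasure (P n)] {p : ℕ → ℝ} {S : ∀ n, Matrix (Fin n) (Fin n) ℝ} {C : ℝ}
  {A : ∀ n, Ω n → Matrix (Fin n) (Fin n) ℝ}

omit [∀ n, IsProbabilityMeasure (P n)] in
theorem tendsto_statCov (hp : ∀ n, 0 < p n ∧ p n < 1) (hSsymm : ∀ n, (S n).IsSymm)
    (hS : ∀ n i j, 0 ≤ S n i j ∧ S n i j ≤ C ∧ p n * S n i j ≤ 1)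
    (hA : ∀ n, IsInhomRandomGraph (P n) (p n) (S n) (A n)) (hp_zero : Tendsto p atTop (𝓝 0))
    {β : ∀ (V : Type) [Fintype V], SimpleGraph V → ℝ}
    (hβ : ∀ (V : Type) [Fintype V] (T : SimpleGraph V), T.IsTree →
      Tendsto (fun n => homDensity T (stepGraphon (S n) (hSsymm n))) atTop (𝓝 (β V T)))
    (k h : ℕ) :
    Tendsto (fun n => statCov (P n) (p n) (A n) k h) atTop
      (𝓝 (if Even k ∧ Even h then ∑ T : JoinedTree k h, β T.Vertex T.graph else 0)) := by
  split_ifs with hkh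
  · have h1 : Tendsto (fun n => ∑ T : JoinedTree k h,
        homDensity T.graph (stepGraphon (S n) (hSsymm n))) atTop
        (𝓝 (∑ T : JoinedTree k h, β T.Vertex T.graph)) :=
      tendsto_finsetSum _ fun T _ => hβ T.Vertex T.graph T.isTree_graph
    have h2 : Tendsto (fun n => statCov (P n) (p n) (A n) k h - ∑ T : JoinedTree k h,
        homDensity T.graph (stepGraphon (S n) (hSsymm n))) atTop (𝓝 0) := by
      -- Replacing `C` by `max C 0` provides a nonnegative bound without a separate argument about
      -- its sign.
      refine squeeze_zero_norm' (a := fun n => ∑ _T : JoinedTree k h,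
        (max C 0) ^ (k / 2 + (h / 2 - 1)) * ((k / 2 + (h / 2 - 1) : ℕ) * (5 * (max C 0 * p n)) +
          (k / 2 + (h / 2 - 1) + 1 : ℕ) ^ 2 * (n : ℝ)⁻¹)) ?_ ?_
      · filter_upwards [eventually_gt_atTop 0] with n hn
        exact (hA n).abs_statCov_sub_le hn (hp n).1 (le_max_right _ _) (hSsymm n)
          (fun i j => ⟨(hS n i j).1, (hS n i j).2.1.trans (le_max_left _ _), (hS n i j).2.2⟩)
          hkh.1 hkh.2
      · have h3 : Tendsto (fun n : ℕ => (n : ℝ)⁻¹) atTop (𝓝 0) :=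
          tendsto_inv_atTop_zero.comp tendsto_natCast_atTop_atTop
        have h4 := tendsto_finsetSum (Finset.univ : Finset (JoinedTree k h)) fun _ _ =>
          (((hp_zero.const_mul (max C 0)).const_mul 5).const_mul
            ((k / 2 + (h / 2 - 1) : ℕ) : ℝ) |>.add
            (h3.const_mul (((k / 2 + (h / 2 - 1) + 1 : ℕ) : ℝ) ^ 2))).const_mul
              ((max C 0) ^ (k / 2 + (h / 2 - 1)))
        simpa using h4
    simpa using h2.add h1
  · have h0 : ∀ n, statCov (P n) (p n) (A n) k h = 0 := by
      intro n
      rw [statCov, Finset.sum_eq_zero, mul_zero]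
      intro e _
      rw [not_and_or] at hkh
      rcases hkh with hk | hh
      · rw [linCoef, if_neg hk, zero_mul, zero_mul]
      · rw [linCoef.eq_def _ _ h, if_neg hh, mul_zero, zero_mul]
    simp only [h0]
    exact tendsto_const_nhds

theorem tendsto_integral_exp_spectralStat (hp : ∀ n, 0 < p n ∧ p n < 1)
    (hS : ∀ n i j, 0 ≤ S n i j ∧ S n i j ≤ C ∧ p n * S n i j ≤ 1)
    (hA : ∀ n, IsInhomRandomGraph (P n) (p n) (S n) (A n)) (hp_zero : Tendsto p atTop (𝓝 0))
    (hnp : Tendsto (fun n : ℕ => (n : ℝ) * p n) atTop atTop) {K : ℕ → ℕ → ℝ}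
    (hK : ∀ k h, Tendsto (fun n => statCov (P n) (p n) (A n) k h) atTop (𝓝 (K k h)))
    (s : Finset ℕ) (t : ℕ → ℝ) :
    Tendsto (fun n => ∫ ω, Complex.exp ((∑ k ∈ s, t k * spectralStat (P n) (p n) (A n) k ω : ℝ) *
        Complex.I) ∂(P n)) atTop
      (𝓝 (Complex.exp ((-(∑ k ∈ s, ∑ h ∈ s, t k * t h * K k h) / 2 : ℝ)))) := by
  -- The remainder estimate raises powers of the bound up to exponent `k` and so needs it to be at
  -- least `1`.
  set D := max C 1 with hD
  have hD1 : 1 ≤ D := le_max_right _ _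
  have hσ : Tendsto (fun n => ∑ k ∈ s, ∑ h ∈ s, t k * t h * statCov (P n) (p n) (A n) k h) atTop
      (𝓝 (∑ k ∈ s, ∑ h ∈ s, t k * t h * K k h)) :=
    tendsto_finsetSum _ fun k _ => tendsto_finsetSum _ fun h _ => (hK k h).const_mul _
  have h1 : Tendsto (fun n => Complex.exp
      ((-(∑ k ∈ s, ∑ h ∈ s, t k * t h * statCov (P n) (p n) (A n) k h) / 2 : ℝ))) atTop
      (𝓝 (Complex.exp ((-(∑ k ∈ s, ∑ h ∈ s, t k * t h * K k h) / 2 : ℝ)))) :=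
    (Complex.continuous_exp.comp Complex.continuous_ofReal).continuousAt.tendsto.comp
      (hσ.neg.div_const 2)
  have hsq : Tendsto (fun n => √(p n)) atTop (𝓝 0) := by
    have h := (Real.continuous_sqrt.tendsto 0).comp hp_zero
    rw [Real.sqrt_zero] at h
    exact h
  have hδ : Tendsto (fun n => ∑ k ∈ s, |t k| * (coefBound D k * √(p n))) atTop (𝓝 0) := by
    simpa using tendsto_finsetSum s fun k _ => (hsq.const_mul (coefBound D k)).const_mul |t k|
  have hrem : Tendsto (fun n : ℕ => p n + (n * p n)⁻¹) atTop (𝓝 0) := by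
    simpa using hp_zero.add (tendsto_inv_atTop_zero.comp hnp)
  have hR : Tendsto (fun n : ℕ => √(s.card * ∑ k ∈ s, t k ^ 2 *
      (remBound D k * (p n + (n * p n)⁻¹)))) atTop (𝓝 0) := by
    have h2 := (tendsto_finsetSum s fun k _ =>
      (hrem.const_mul (remBound D k)).const_mul (t k ^ 2)).const_mul (s.card : ℝ)
    simp only [mul_zero, Finset.sum_const_zero] at h2
    have h := (Real.continuous_sqrt.tendsto 0).comp h2
    rw [Real.sqrt_zero] at h
    exact h
  have h2 : Tendsto (fun n => ∫ ω, Complex.exp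
      ((∑ k ∈ s, t k * spectralStat (P n) (p n) (A n) k ω : ℝ) * Complex.I) ∂(P n) - Complex.exp
      ((-(∑ k ∈ s, ∑ h ∈ s, t k * t h * statCov (P n) (p n) (A n) k h) / 2 : ℝ))) atTop (𝓝 0) := by
    refine squeeze_zero_norm' (a := fun n : ℕ => √(s.card * ∑ k ∈ s, t k ^ 2 *
      (remBound D k * (p n + (n * p n)⁻¹))) + 2 * (∑ k ∈ s, |t k| * (coefBound D k * √(p n))) *
        ∑ k ∈ s, ∑ h ∈ s, t k * t h * statCov (P n) (p n) (A n) k h) ?_ ?_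
    · filter_upwards [eventually_gt_atTop 0, hnp.eventually_ge_atTop 1,
        hδ.eventually_le_const zero_lt_one]
        with n hn hnpn hδn
      have ha : IsSmallIndep (P n) (edgeVar (P n) (A n)) (D * p n) :=
        (hA n).isSmallIndep (hp n).1.le
          (fun i j => ⟨(hS n i j).1, (hS n i j).2.1.trans (le_max_left _ _)⟩) (by linarith)
      exact (hA n).norm_integral_exp_sub_le ha hn (hp n).1 hD1 hnpn s t le_rfl hδn
    · simpa using hR.add ((hδ.const_mul 2).mul hσ)
  simpa using h2.add h1

end Limits

/-! ## Convergence in distribution -/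

theorem charFun_map_toLp {Ω ι : Type*} [MeasurableSpace Ω] [Fintype ι] (μ : Measure Ω)
    {Y : Ω → ι → ℝ} (hY : AEMeasurable Y μ) (t : EuclideanSpace ℝ ι) :
    charFun (μ.map fun ω => (WithLp.toLp 2 (Y ω) : EuclideanSpace ℝ ι)) t =
      ∫ ω, Complex.exp ((∑ i, t i * Y ω i : ℝ) * Complex.I) ∂μ := by
  have hm : AEMeasurable (fun ω => (WithLp.toLp 2 (Y ω) : EuclideanSpace ℝ ι)) μ :=
    (PiLp.continuous_toLp 2 _).measurable.comp_aemeasurable hY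
  rw [charFun_apply, integral_map hm (Measurable.aestronglyMeasurable (by fun_prop))]
  refine integral_congr_ae (ae_of_all _ fun ω => ?_)
  simp [PiLp.inner_apply]

/-- Lévy's continuity theorem is applied in `EuclideanSpace`, where characteristic functions use the
inner product. The result returns to plain functions by the continuous mapping theorem. -/
theorem tendstoInDistribution_of_tendsto_integral_exp {Ω : ℕ → Type*} [∀ n, MeasurableSpace (Ω n)]
    {P : ∀ n, Measure (Ω n)} [∀ n, IsProbabilityMeasure (P n)] {Ω' : Type*} [MeasurableSpace Ω']
    {Q : Measure Ω'} [IsProbabilityMeasure Q] {ι : Type*} [Fintype ι] {X : ∀ n, Ω n → ι → ℝ}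
    {Z : Ω' → ι → ℝ} (hX : ∀ n, AEMeasurable (X n) (P n)) (hZ : AEMeasurable Z Q)
    (h : ∀ t : ι → ℝ, Tendsto
      (fun n => ∫ ω, Complex.exp ((∑ i, t i * X n ω i : ℝ) * Complex.I) ∂(P n)) atTop
      (𝓝 (∫ ω, Complex.exp ((∑ i, t i * Z ω i : ℝ) * Complex.I) ∂Q))) :
    TendstoInDistribution X atTop Z P Q := by
  have hm : Measurable (WithLp.toLp 2 : (ι → ℝ) → EuclideanSpace ℝ ι) :=
    (PiLp.continuous_toLp 2 _).measurable
  have h1 : TendstoInDistribution (fun n ω => (WithLp.toLp 2 (X n ω) : EuclideanSpace ℝ ι)) atTop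
      (fun ω => WithLp.toLp 2 (Z ω)) P Q :=
    { forall_aemeasurable := fun n => hm.comp_aemeasurable (hX n)
      aemeasurable_limit := hm.comp_aemeasurable hZ
      tendsto := by
        refine ProbabilityMeasure.tendsto_iff_tendsto_charFun.2 fun t => ?_
        simpa only [ProbabilityMeasure.coe_mk, charFun_map_toLp _ (hX _), charFun_map_toLp _ hZ] using
          h t }
  exact h1.continuous_comp (PiLp.continuous_ofLp 2 _)

theorem ProbabilityTheory.IsGaussianProcess.integral_exp_sum {Ω T : Type*} [MeasurableSpace Ω]
    {Q : Measure Ω} [IsProbabilityMeasure Q] {X : T → Ω → ℝ} (hX : IsGaussianProcess X Q)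
    (hmean : ∀ k, ∫ ω, X k ω ∂Q = 0) (s : Finset T) (t : T → ℝ) :
    ∫ ω, Complex.exp ((∑ k ∈ s, t k * X k ω : ℝ) * Complex.I) ∂Q =
      Complex.exp ((-(∑ k ∈ s, ∑ h ∈ s, t k * t h * cov[X k, X h; Q]) / 2 : ℝ)) := by
  have hL2 : ∀ k, MemLp (X k) 2 Q := fun k => (hX.hasGaussianLaw_eval k).memLp_two
  have hY : HasGaussianLaw (fun ω => ∑ k ∈ s, t k * X k ω) Q :=
    (hX.smul t).hasGaussianLaw_fun_sum
  have h1 := hY.charFun_map_eq (1 : ℝ)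
  rw [charFun_apply_real, integral_map hY.aemeasurable
    (Measurable.aestronglyMeasurable (by fun_prop))] at h1
  have h2 : ∫ ω, ∑ k ∈ s, t k * X k ω ∂Q = 0 := by
    rw [integral_finsetSum _ fun k _ => ((hL2 k).integrable one_le_two).const_mul _]
    simp [integral_const_mul, hmean]
  have h3 : Var[fun ω => ∑ k ∈ s, t k * X k ω; Q] =
      ∑ k ∈ s, ∑ h ∈ s, t k * t h * cov[X k, X h; Q] := by
    rw [← covariance_self hY.aemeasurable, covariance_fun_sum_fun_sum'
      (fun k _ => (hL2 k).const_mul _) fun k _ => (hL2 k).const_mul _]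
    refine Finset.sum_congr rfl fun k _ => Finset.sum_congr rfl fun h _ => ?_
    rw [covariance_const_mul_left, covariance_const_mul_right]
    ring
  simp only [Complex.ofReal_one, one_mul, RCLike.inner_apply, conj_trivial, mul_one, h2, h3] at h1
  rw [h1]
  congr 1
  push_cast
  ring

theorem IsInhomRandomGraph.measurable_spectralStat {Ω : Type*} [MeasurableSpace Ω] {P : Measure Ω}
    {n : ℕ} {p : ℝ} {S : Matrix (Fin n) (Fin n) ℝ} {A : Ω → Matrix (Fin n) (Fin n) ℝ}
    (hA : IsInhomRandomGraph P p S A) (k : ℕ) : Measurable (spectralStat P p A k) := by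
  have h1 : Measurable fun ω => centeredTrace P p A k ω := by
    simp only [hA.centeredTrace_eq]
    refine Measurable.const_mul (Finset.measurable_fun_sum _ fun w _ => ?_) _
    exact Finset.measurable_fun_prod _ fun e _ => (hA.measurable_edgeVar e).pow_const _
  exact (h1.sub_const _).const_mul _

theorem IsInhomRandomGraph.varSq_nonneg {Ω : Type*} [MeasurableSpace Ω] {P : Measure Ω}
    {n : ℕ} {p : ℝ} {S : Matrix (Fin n) (Fin n) ℝ} {A : Ω → Matrix (Fin n) (Fin n) ℝ}
    (hA : IsInhomRandomGraph P p S A) (hp : 0 ≤ p) (hS : ∀ i j, 0 ≤ S i j ∧ p * S i j ≤ 1)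
    (e : Sym2 (Fin n)) : 0 ≤ varSq P (edgeVar P A) e := by
  induction e with | _ i j => ?_
  by_cases hij : i = j
  · simp [varSq, mom, hA.edgeVar_mk, hij, hA.centered_diag]
  · rw [hA.varSq_edgeVar hij]
    exact mul_nonneg (mul_nonneg (mul_nonneg hp (hS i j).1) (by linarith [(hS i j).2]))
      (sq_nonneg _)

theorem tendstoInDistribution_spectralStat
    {Ω : ℕ → Type*} [∀ n, MeasurableSpace (Ω n)]
    (P : ∀ n, Measure (Ω n)) [∀ n, IsProbabilityMeasure (P n)]
    (p : ℕ → ℝ) (hp : ∀ n, 0 < p n ∧ p n < 1) (S : ∀ n, Matrix (Fin n) (Fin n) ℝ)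
    (C : ℝ) (hS : ∀ n i j, 0 ≤ S n i j ∧ S n i j ≤ C ∧ p n * S n i j ≤ 1)
    (A : ∀ n, Ω n → Matrix (Fin n) (Fin n) ℝ)
    (hA : ∀ n, IsInhomRandomGraph (P n) (p n) (S n) (A n))
    (hp_zero : Tendsto p atTop (𝓝 0))
    (hnp : Tendsto (fun n : ℕ => (n : ℝ) * p n) atTop atTop)
    (K : ℕ → ℕ → ℝ)
    (hK : ∀ k h, Tendsto (fun n => statCov (P n) (p n) (A n) k h) atTop (𝓝 (K k h)))
    {Ω' : Type*} [MeasurableSpace Ω'] (Q : Measure Ω') [IsProbabilityMeasure Q] (X : ℕ → Ω' → ℝ)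
    (hX : IsGaussianProcess X Q) (hXm : ∀ k, Measurable (X k)) (hX0 : ∀ k, ∫ ω, X k ω ∂Q = 0)
    (hXc : ∀ k h, cov[X k, X h; Q] = K k h) (s : Finset {k : ℕ // 2 ≤ k}) :
    TendstoInDistribution
      (fun n ω => fun k : s => spectralStat (P n) (p n) (A n) k.1.1 ω) atTop
      (fun ω => fun k : s => X k.1.1 ω) P Q := by
  have hY : ∀ n, AEMeasurable (fun ω (k : s) => spectralStat (P n) (p n) (A n) k.1.1 ω) (P n) := by
    intro n
    refine Measurable.aemeasurable (measurable_pi_iff.2 fun k => ?_)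
    exact (hA n).measurable_spectralStat k.1.1
  have hZ : AEMeasurable (fun ω (k : s) => X k.1.1 ω) Q := by
    refine Measurable.aemeasurable (measurable_pi_iff.2 fun k => ?_)
    exact hXm k.1.1
  refine tendstoInDistribution_of_tendsto_integral_exp hY hZ fun t => ?_
  classical
  let f : s ↪ ℕ := ⟨fun k => k.1.1, fun k h hkh => Subtype.ext (Subtype.ext hkh)⟩
  -- The estimates run over finite sets of natural numbers, so the coefficients are carried along
  -- the embedding and extended by zero.
  let t' : ℕ → ℝ := Function.extend f t 0
  have ht' : ∀ k, t' (f k) = t k := fun k => f.injective.extend_apply t 0 k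
  have hsum : ∀ g : ℕ → ℝ, ∑ k ∈ Finset.univ.map f, t' k * g k = ∑ k, t k * g (f k) := by
    intro g
    rw [Finset.sum_map]
    simp only [ht']
  have h1 := tendsto_integral_exp_spectralStat hp hS hA hp_zero hnp hK (Finset.univ.map f) t'
  have h2 := hX.integral_exp_sum hX0 (Finset.univ.map f) t'
  simp only [hXc] at h2
  rw [← h2] at h1
  simp only [hsum] at h1
  exact h1

theorem exists_isGaussianProcess_tendstoInDistribution
    {Ω : ℕ → Type*} [∀ n, MeasurableSpace (Ω n)]
    (P : ∀ n, Measure (Ω n)) [∀ n, IsProbabilityMeasure (P n)]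
    (p : ℕ → ℝ) (hp : ∀ n, 0 < p n ∧ p n < 1)
    (S : ∀ n, Matrix (Fin n) (Fin n) ℝ)
    (C : ℝ) (hS : ∀ n i j, 0 ≤ S n i j ∧ S n i j ≤ C ∧ p n * S n i j ≤ 1)
    (A : ∀ n, Ω n → Matrix (Fin n) (Fin n) ℝ)
    (hA : ∀ n, IsInhomRandomGraph (P n) (p n) (S n) (A n))
    (hp_zero : Tendsto p atTop (𝓝 0))
    (hnp : Tendsto (fun n : ℕ => (n : ℝ) * p n) atTop atTop)
    (K : ℕ → ℕ → ℝ)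
    (hK : ∀ k h, Tendsto (fun n => statCov (P n) (p n) (A n) k h) atTop (𝓝 (K k h))) :
    ∃ (Ω' : Type) (_ : MeasurableSpace Ω') (Q : Measure Ω') (_ : IsProbabilityMeasure Q)
      (X : {k : ℕ // 2 ≤ k} → Ω' → ℝ),
      IsGaussianProcess X Q ∧
      (∀ k, ∫ ω, X k ω ∂Q = 0) ∧
      (∀ k h, cov[X k, X h; Q] = K k.1 h.1) ∧
      ∀ s : Finset {k : ℕ // 2 ≤ k},
        TendstoInDistribution
          (fun n ω => fun k : s => spectralStat (P n) (p n) (A n) k.1.1 ω) atTop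
          (fun ω => fun k : s => X k.1 ω) P Q := by
  have hsymm : ∀ k h, K k h = K h k := by
    intro k h
    refine tendsto_nhds_unique (hK k h) ((hK h k).congr fun n => ?_)
    simp only [statCov, mul_comm]
  -- Positivity is inherited from finite `n`, where the quadratic form is a sum of squares weighted
  -- by variances. Thus existence of the Gaussian process needs no direct argument about sums of
  -- tree densities.
  have hpos : ∀ (s : Finset ℕ) (c : ℕ → ℝ), 0 ≤ ∑ i ∈ s, ∑ j ∈ s, c i * c j * K i j := by
    intro s c
    refine ge_of_tendsto (tendsto_finsetSum s fun i _ => tendsto_finsetSum s fun j _ =>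
      (hK i j).const_mul (c i * c j)) (Eventually.of_forall fun n => ?_)
    rw [sum_sum_statCov]
    exact Finset.sum_nonneg fun e _ => mul_nonneg (sq_nonneg _)
      ((hA n).varSq_nonneg (hp n).1.le (fun i j => ⟨(hS n i j).1, (hS n i j).2.2⟩) e)
  obtain ⟨Q, hQ, X, hX, hXm, hX0, hXc⟩ := exists_isGaussianProcess K hsymm hpos
  refine ⟨ℕ → ℝ, inferInstance, Q, hQ, fun k => X k.1, hX.comp_right Subtype.val,
    fun k => hX0 k.1, fun k h => hXc k.1 h.1, fun s => ?_⟩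
  exact tendstoInDistribution_spectralStat P p hp S C hS A hA hp_zero hnp K hK Q X hX hXm hX0 hXc s

theorem mainTheorem4
    {Ω : ℕ → Type*} [∀ n, MeasurableSpace (Ω n)]
    (P : ∀ n, Measure (Ω n)) [∀ n, IsProbabilityMeasure (P n)]
    (p : ℕ → ℝ) (hp : ∀ n, 0 < p n ∧ p n < 1)
    (S : ∀ n, Matrix (Fin n) (Fin n) ℝ) (hSsymm : ∀ n, (S n).IsSymm)
    (C : ℝ) (hS : ∀ n i j, 0 ≤ S n i j ∧ S n i j ≤ C ∧ p n * S n i j ≤ 1)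
    (A : ∀ n, Ω n → Matrix (Fin n) (Fin n) ℝ)
    (hA : ∀ n, IsInhomRandomGraph (P n) (p n) (S n) (A n))
    (hp_zero : Tendsto p atTop (𝓝 0))
    (hnp : Tendsto (fun n : ℕ => (n : ℝ) * p n) atTop atTop)
    (β : ∀ (V : Type) [Fintype V], SimpleGraph V → ℝ)
    (hβ : ∀ (V : Type) [Fintype V] (T : SimpleGraph V), T.IsTree →
      Tendsto (fun n => homDensity T (stepGraphon (S n) (hSsymm n))) atTop (𝓝 (β V T))) :
    ∃ (Ω' : Type) (_ : MeasurableSpace Ω') (Q : Measure Ω') (_ : IsProbabilityMeasure Q)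
      (X : {k : ℕ // 2 ≤ k} → Ω' → ℝ),
      IsGaussianProcess X Q ∧
      (∀ k, ∫ ω, X k ω ∂Q = 0) ∧
      (∀ k h, cov[X k, X h; Q] =
        if Even k.1 ∧ Even h.1 then ∑ T : JoinedTree k.1 h.1, β T.Vertex T.graph else 0) ∧
      ∀ K : Finset {k : ℕ // 2 ≤ k},
        TendstoInDistribution
          (fun n ω => fun k : K => spectralStat (P n) (p n) (A n) k.1.1 ω) atTop
          (fun ω => fun k : K => X k.1 ω) P Q := by
  exact exists_isGaussianProcess_tendstoInDistribution P p hp S C hS A hA hp_zero hnp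
    (fun k h => if Even k ∧ Even h then ∑ T : JoinedTree k h, β T.Vertex T.graph else 0)
    (tendsto_statCov hp hSsymm hS hA hp_zero hβ)

end
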